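/- Let $W:(0,\infty)\to[0,\infty)$ be a continuous function such that $W(F)=0$ if and only if $F=1$, $W(F)$ has a finite limit as $F\to+\infty$, and, for some constants $C>0$ and $M>1$, $W(F)\ge C/F$ for all $0<F\le 1/M$. Let $W^*(H):=H\,W(1/H)$ for $H>0$, $W^*(0):=0$, and $C_{W^*}:=\int_0^1\sqrt{2W^*(\tau)}\,d\tau$. Let $\lambda\ge 1$ and $\mu>0$. For $\varepsilon>0$ and $h\in H^1(0,\lambda)$ let $$V_\varepsilon[h]:=\int_0^\lambda\Big(\frac{\varepsilon}{2}(h'')^2+\frac1\varepsilon W^*(h')+\frac{\mu h'}{2}(y-\lambda h)^2\Big)dy$$ if $h\in H^2(0,\lambda)$, $h'>0$ a.e. in $(0,\lambda)$, $h(0)=0$ and $h(\lambda)=1$, and $V_\varepsilon[h]:=+\infty$ otherwise; that is, on these $h$, $V_\varepsilon=\frac1\varepsilon U_\varepsilon$ with $U_\varepsilon[h]=\int_0^\lambda\big(\frac{\varepsilon^2}{2}(h'')^2+W^*(h')+\frac{k h'}{2}(y-\lambda h)^2\big)dy$ and $k=\varepsilon\mu$. Let $PC^1(0,\lambda)$ be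 the space of continuous functions on $(0,\lambda)$ with piecewise constant derivative (finitely many pieces), and let $\#D(h')$ be the number of discontinuities of $h'$ in $(0,\lambda)$. Then the family $\{V_\varepsilon\}_{\varepsilon>0}$ $\Gamma$-converges, as $\varepsilon\searrow0$, in the strong $H^1(0,\lambda)$ topology to $$V[h]=\begin{cases}\displaystyle C_{W^*}\,\#D(h')+\frac{\mu}{2}\int_0^\lambda h'(y-\lambda h)^2\,dy & \text{if } h\in PC^1(0,\lambda),\ h'\in\{0,1\}\text{ a.e. in }(0,\lambda),\ h(0)=0,\ h(\lambda)=1,\\ +\infty&\text{otherwise.}\end{cases}$$ Moreover, if $\varepsilon_n>0$, $\varepsilon_n\to0$, and $h_n\in H^2(0,\lambda)$ are such that $\{V_{\varepsilon_n}[h_n]\}$ is uniformly bounded, then $\{h_n\}$ has a subsequence converging in $H^1(0,\lambda)$, and the limit $h_*$ of every $H^1(0,\lambda)$-convergent subsequence of $\{h_n\}$ is an element of $PC^1(0,\lambda)$ with $h_*'\in\{0,1\}$ a.e. in $(0,\lambda)$, $h_*(0)=0$ and $h_*(\lambda)=1$. -/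

import Mathlib

open MeasureTheory Set Filter Topology
open scoped ENNReal ContDiff

noncomputable section

/-- The space `L²(0, lam)`. -/
abbrev L2 (lam : ℝ) : Type := Lp ℝ 2 (volume.restrict (Ioo 0 lam))

/-- `g` is the weak (distributional) derivative of `f` on the open interval `(0, lam)`. -/
def IsWeakDeriv (lam : ℝ) (f g : ℝ → ℝ) : Prop :=
  ∀ φ : ℝ → ℝ, ContDiff ℝ ∞ φ → HasCompactSupport φ → tsupport φ ⊆ Ioo 0 lam →
    ∫ y in Ioo 0 lam, f y * deriv φ y = -∫ y in Ioo 0 lam, g y * φ y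

/-- The Sobolev space `H¹(0, lam)`: pairs `(h, h')` in `L² × L²` with `h'` the weak derivative
of `h`, metrized by the norm `(‖h‖² + ‖h'‖²)^(1/2)`. -/
abbrev SobolevH1 (lam : ℝ) : Type :=
  {p : WithLp 2 (L2 lam × L2 lam) // IsWeakDeriv lam p.fst p.snd}

namespace SobolevH1

variable {lam : ℝ}

/-- The underlying function of an element of `H¹(0, lam)`. -/
def toFun (h : SobolevH1 lam) : ℝ → ℝ := h.1.fst

/-- The weak derivative of an element of `H¹(0, lam)`. -/
def weakDeriv (h : SobolevH1 lam) : ℝ → ℝ := h.1.snd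

/-- `h` belongs to `H²(0, lam)`. -/
def MemH2 (h : SobolevH1 lam) : Prop := ∃ w : L2 lam, IsWeakDeriv lam h.weakDeriv w

open Classical in
/-- The second weak derivative of `h`; it is zero by convention if `h` is not in `H²(0, lam)`. -/
def weakDeriv2 (h : SobolevH1 lam) : ℝ → ℝ := if hh : h.MemH2 then (hh.choose : L2 lam) else 0

/-- `g` is the representative of `h` that is continuous on `[0, lam]`. -/
def IsContRep (h : SobolevH1 lam) (g : ℝ → ℝ) : Prop :=
  ContinuousOn g (Icc 0 lam) ∧ g =ᵐ[volume.restrict (Ioo 0 lam)] h.toFun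

/-- The boundary conditions `h(0) = 0` and `h(lam) = 1`. -/
def BoundaryConditions (h : SobolevH1 lam) : Prop :=
  ∃ g, h.IsContRep g ∧ g 0 = 0 ∧ g lam = 1

/-- `h ∈ PC¹(0, lam)`: `h` is continuous and, off a finite set, it is differentiable with locally
constant derivative. -/
def MemPC1 (h : SobolevH1 lam) : Prop :=
  ∃ g, h.IsContRep g ∧ ∃ S : Finset ℝ, ∀ y ∈ Ioo 0 lam, y ∉ S →
    ∃ c : ℝ, ∀ᶠ z in 𝓝 y, HasDerivAt g c z

end SobolevH1

/-- The discontinuities in `(0, lam)` of a function considered up to equality almost everywhere: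
the points at which no representative is continuous. -/
def discontSet (lam : ℝ) (u : ℝ → ℝ) : Set ℝ :=
  {y | y ∈ Ioo 0 lam ∧ ¬ ∃ w : ℝ → ℝ, w =ᵐ[volume.restrict (Ioo 0 lam)] u ∧ ContinuousAt w y}

/-- The inverse stored energy `W*(H) = H W(1/H)` for `H > 0`, extended by `W*(0) = 0`. -/
def inverseEnergy (W : ℝ → ℝ) (H : ℝ) : ℝ := H * W H⁻¹

/-- The constant `∫₀¹ √(2 W*(τ)) dτ`. -/
def surfaceConstant (W : ℝ → ℝ) : ℝ := ∫ τ in (0 : ℝ)..1, √(2 * inverseEnergy W τ)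

/-- `U_ε[h] = ∫₀^lam (ε²/2 (h'')² + W*(h') + k h'/2 (y - lam h)²) dy`, for `h ∈ H²(0, lam)` with
`h' ≥ 0` (the integrand is then nonnegative). -/
def deformationEnergy (W : ℝ → ℝ) (lam k ε : ℝ) (h : SobolevH1 lam) : ℝ≥0∞ :=
  ∫⁻ y in Ioo 0 lam, ENNReal.ofReal
    (ε ^ 2 / 2 * h.weakDeriv2 y ^ 2 + inverseEnergy W (h.weakDeriv y)
      + k * h.weakDeriv y / 2 * (y - lam * h.toFun y) ^ 2)

open Classical in
/-- `V_ε = U_ε / ε` with `k = ε μ` if `h ∈ H²(0, lam)`, `h' > 0`, `h(0) = 0` and `h(lam) = 1`,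
and `V_ε = +∞` otherwise. -/
def rescaledEnergy (W : ℝ → ℝ) (lam μ ε : ℝ) (h : SobolevH1 lam) : ℝ≥0∞ :=
  if h.MemH2 ∧ (∀ᵐ y ∂volume.restrict (Ioo 0 lam), 0 < h.weakDeriv y) ∧ h.BoundaryConditions then
    ENNReal.ofReal (1 / ε) * deformationEnergy W lam (ε * μ) ε h
  else ⊤

/-- The finiteness class of the limit: `h ∈ PC¹(0, lam)`, `h' ∈ {0, 1}` almost everywhere,
`h(0) = 0` and `h(lam) = 1`. -/
def IsSharp {lam : ℝ} (h : SobolevH1 lam) : Prop :=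
  h.MemPC1 ∧ (∀ᵐ y ∂volume.restrict (Ioo 0 lam), h.weakDeriv y = 0 ∨ h.weakDeriv y = 1) ∧
    h.BoundaryConditions

open Classical in
/-- The sharp-interface energy `V`. -/
def sharpEnergy (W : ℝ → ℝ) (lam μ : ℝ) (h : SobolevH1 lam) : ℝ≥0∞ :=
  if IsSharp h then
    ENNReal.ofReal (surfaceConstant W * (discontSet lam h.weakDeriv).ncard
      + μ / 2 * ∫ y in Ioo 0 lam, h.weakDeriv y * (y - lam * h.toFun y) ^ 2)
  else ⊤

/-- Γ-convergence of a family `F ε` to `G` as `ε ↘ 0` on a metric space: along every positive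
sequence tending to zero, the lower bound holds and recovery sequences exist. -/
def GammaConverges {X : Type*} [PseudoMetricSpace X] (F : ℝ → X → ℝ≥0∞) (G : X → ℝ≥0∞) : Prop :=
  ∀ ε : ℕ → ℝ, (∀ n, 0 < ε n) → Tendsto ε atTop (𝓝 0) → ∀ x : X,
    (∀ u : ℕ → X, Tendsto u atTop (𝓝 x) → G x ≤ liminf (fun n => F (ε n) (u n)) atTop) ∧
    ∃ u : ℕ → X, Tendsto u atTop (𝓝 x) ∧ limsup (fun n => F (ε n) (u n)) atTop ≤ G x

end

theorem setIntegral_Ioo_eq_intervalIntegral {a b : ℝ} (hab : a ≤ b) (f : ℝ → ℝ) :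
    ∫ y in Ioo a b, f y = ∫ y in a..b, f y := by
  rw [intervalIntegral.integral_of_le hab, integral_Ioc_eq_integral_Ioo]

theorem IntegrableOn.intervalIntegrable_of_Ioo {a b : ℝ} (hab : a ≤ b) {f : ℝ → ℝ}
    (hf : IntegrableOn f (Ioo a b)) : IntervalIntegrable f volume a b := by
  rw [intervalIntegrable_iff_integrableOn_Ioo_of_le hab]; exact hf

theorem ae_restrict_Ioo_mono {a b c d : ℝ} {p : ℝ → Prop} (hac : a ≤ c) (hdb : d ≤ b)
    (h : ∀ᵐ y ∂volume.restrict (Ioo a b), p y) : ∀ᵐ y ∂volume.restrict (Ioo c d), p y :=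
  ae_restrict_of_ae_restrict_of_subset (Ioo_subset_Ioo hac hdb) h

theorem intervalIntegral_congr_ae_Ioo {a b : ℝ} (hab : a ≤ b) {f g : ℝ → ℝ}
    (h : f =ᵐ[volume.restrict (Ioo a b)] g) : ∫ y in a..b, f y = ∫ y in a..b, g y := by
  rw [← setIntegral_Ioo_eq_intervalIntegral hab, ← setIntegral_Ioo_eq_intervalIntegral hab]
  exact integral_congr_ae h

theorem tsupport_vanish_endpoints {lam : ℝ} {φ : ℝ → ℝ} (h : tsupport φ ⊆ Ioo 0 lam) :
    φ 0 = 0 ∧ φ lam = 0 := by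
  constructor
  · by_contra h0
    exact absurd (h (subset_tsupport φ h0)).1 (lt_irrefl _)
  · by_contra h0
    exact absurd (h (subset_tsupport φ h0)).2 (lt_irrefl _)

theorem IsWeakDeriv.congr {lam : ℝ} {f f' g g' : ℝ → ℝ} (h : IsWeakDeriv lam f g)
    (hf : f' =ᵐ[volume.restrict (Ioo 0 lam)] f) (hg : g' =ᵐ[volume.restrict (Ioo 0 lam)] g) :
    IsWeakDeriv lam f' g' := by
  intro φ h1 h2 h3
  have e1 : ∫ y in Ioo 0 lam, f' y * deriv φ y = ∫ y in Ioo 0 lam, f y * deriv φ y :=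
    integral_congr_ae (hf.mono fun y hy => by simp [hy])
  have e2 : ∫ y in Ioo 0 lam, g' y * φ y = ∫ y in Ioo 0 lam, g y * φ y :=
    integral_congr_ae (hg.mono fun y hy => by simp [hy])
  rw [e1, e2]; exact h φ h1 h2 h3

theorem AbsolutelyContinuousOnInterval.isWeakDeriv {lam : ℝ} (hl : 0 ≤ lam) {f : ℝ → ℝ}
    (hf : AbsolutelyContinuousOnInterval f 0 lam) : IsWeakDeriv lam f (deriv f) := by
  intro φ h1 h2 h3
  have hφ : AbsolutelyContinuousOnInterval φ 0 lam :=
    ((h1.of_le (by simp)).contDiffOn).absolutelyContinuousOnInterval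
  obtain ⟨h4, h5⟩ := tsupport_vanish_endpoints h3
  rw [setIntegral_Ioo_eq_intervalIntegral hl, setIntegral_Ioo_eq_intervalIntegral hl,
    hf.integral_mul_deriv_eq_deriv_mul hφ, h4, h5]
  simp

/-- The primitive of an integrable function is absolutely continuous and has it as derivative. -/
theorem ae_deriv_primitive {lam : ℝ} (hl : 0 ≤ lam) {g : ℝ → ℝ}
    (hg : IntegrableOn g (Ioo 0 lam)) (c : ℝ) :
    AbsolutelyContinuousOnInterval (fun y => c + ∫ t in (0 : ℝ)..y, g t) 0 lam ∧
    ∀ᵐ y ∂volume.restrict (Ioo 0 lam),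
      HasDerivAt (fun y => c + ∫ t in (0 : ℝ)..y, g t) (g y) y := by
  have hi := IntegrableOn.intervalIntegrable_of_Ioo hl hg
  constructor
  · have h1 : AbsolutelyContinuousOnInterval (fun _ : ℝ => c) 0 lam :=
      (LipschitzWith.const c).lipschitzOnWith.absolutelyContinuousOnInterval
    exact h1.add (hi.absolutelyContinuousOnInterval_intervalIntegral (by simp))
  · rw [ae_restrict_iff' measurableSet_Ioo]
    filter_upwards [hi.ae_hasDerivAt_integral] with y hy hmem
    exact (hy (by rw [uIcc_of_le hl]; exact Ioo_subset_Icc_self hmem) 0 (by simp)).const_add c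

theorem isWeakDeriv_primitive {lam : ℝ} (hl : 0 ≤ lam) {g : ℝ → ℝ}
    (hg : IntegrableOn g (Ioo 0 lam)) (c : ℝ) :
    IsWeakDeriv lam (fun y => c + ∫ t in (0 : ℝ)..y, g t) g := by
  obtain ⟨h1, h2⟩ := ae_deriv_primitive hl hg c
  exact (h1.isWeakDeriv hl).congr (EventuallyEq.refl _ _) (h2.mono fun y hy => hy.deriv.symm)

theorem exists_Icc_of_isCompact_subset_Ioo {K : Set ℝ} {lam : ℝ} (hl : 0 < lam) (hK : IsCompact K)
    (hKI : K ⊆ Ioo 0 lam) : ∃ a b, 0 < a ∧ a ≤ b ∧ b < lam ∧ K ⊆ Icc a b := by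
  rcases K.eq_empty_or_nonempty with rfl | hne
  · exact ⟨lam / 2, lam / 2, by linarith, le_rfl, by linarith, by simp⟩
  · obtain ⟨a, ha, ha'⟩ := hK.exists_isLeast hne
    obtain ⟨b, hb, hb'⟩ := hK.exists_isGreatest hne
    exact ⟨a, b, (hKI ha).1, ha' hb, (hKI hb).2, fun x hx => ⟨ha' hx, hb' hx⟩⟩

theorem integral_eq_setIntegral_of_tsupport {U : Set ℝ} {φ f : ℝ → ℝ} (h : tsupport φ ⊆ U) :
    ∫ y, f y * φ y = ∫ y in U, f y * φ y := by
  rw [setIntegral_eq_integral_of_forall_compl_eq_zero]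
  intro x hx
  have : φ x = 0 := by
    by_contra h0
    exact hx (h (subset_tsupport φ h0))
  simp [this]

theorem ae_eq_zero_of_test {lam : ℝ} {f : ℝ → ℝ} (hf : IntegrableOn f (Ioo 0 lam))
    (h : ∀ φ : ℝ → ℝ, ContDiff ℝ ∞ φ → HasCompactSupport φ → tsupport φ ⊆ Ioo 0 lam →
      ∫ y in Ioo 0 lam, f y * φ y = 0) : ∀ᵐ y ∂volume.restrict (Ioo 0 lam), f y = 0 := by
  rw [ae_restrict_iff' measurableSet_Ioo]
  refine isOpen_Ioo.ae_eq_zero_of_integral_contDiff_smul_eq_zero hf.locallyIntegrableOn ?_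
  intro φ h1 h2 h3
  rw [← h φ h1 h2 h3, ← integral_eq_setIntegral_of_tsupport h3]
  simp [mul_comm]

theorem integrableOn_mul_test {lam : ℝ} {f φ : ℝ → ℝ} (hf : IntegrableOn f (Ioo 0 lam))
    (h1 : Continuous φ) (h2 : HasCompactSupport φ) :
    IntegrableOn (fun y => f y * φ y) (Ioo 0 lam) := by
  obtain ⟨C, hC⟩ := h2.exists_bound_of_continuous h1
  have := hf.bdd_mul (c := C) (f := φ) h1.aestronglyMeasurable (ae_of_all _ hC)
  rw [IntegrableOn]
  simpa only [mul_comm] using this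

theorem exists_test_integral_one {lam : ℝ} (hl : 0 < lam) :
    ∃ ψ : ℝ → ℝ, ContDiff ℝ ∞ ψ ∧ HasCompactSupport ψ ∧ tsupport ψ ⊆ Ioo 0 lam ∧
      ∫ y, ψ y = 1 := by
  let b : ContDiffBump (lam / 2) := ⟨lam / 8, lam / 4, by linarith, by linarith⟩
  refine ⟨b.normed volume, b.contDiff_normed, b.hasCompactSupport_normed, ?_, b.integral_normed⟩
  rw [b.tsupport_normed_eq, Real.closedBall_eq_Icc]
  intro x hx
  simp only [mem_Icc, mem_Ioo, b] at *
  constructor <;> linarith [hx.1, hx.2]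

/-- The du Bois-Reymond lemma. -/
theorem IsWeakDeriv.exists_ae_eq_const {lam : ℝ} (hl : 0 < lam) {f : ℝ → ℝ}
    (hf : IntegrableOn f (Ioo 0 lam)) (h : IsWeakDeriv lam f (fun _ => 0)) :
    ∃ c : ℝ, ∀ᵐ y ∂volume.restrict (Ioo 0 lam), f y = c := by
  obtain ⟨ψ, p1, p2, p3, p4⟩ := exists_test_integral_one hl
  refine ⟨∫ y in Ioo 0 lam, f y * ψ y, ?_⟩
  set c := ∫ y in Ioo 0 lam, f y * ψ y with hc
  suffices ∀ᵐ y ∂volume.restrict (Ioo 0 lam), f y - c = 0 from this.mono fun y hy => by linarith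
  refine ae_eq_zero_of_test (hf.sub (integrableOn_const (by simp))) ?_
  intro φ q1 q2 q3
  set m := ∫ y, φ y with hm
  set χ : ℝ → ℝ := fun y => φ y - m * ψ y with hχ
  have χ1 : ContDiff ℝ ∞ χ := q1.sub (contDiff_const.mul p1)
  obtain ⟨a, b, ha, hab, hb, hK⟩ := exists_Icc_of_isCompact_subset_Ioo hl
    (q2.isCompact.union p2.isCompact) (union_subset q3 p3)
  have χ0 : ∀ y, y ∉ Icc a b → χ y = 0 := by
    intro y hy
    have e1 : φ y = 0 := by
      by_contra h0; exact hy (hK (Or.inl (subset_tsupport φ h0)))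
    have e2 : ψ y = 0 := by
      by_contra h0; exact hy (hK (Or.inr (subset_tsupport ψ h0)))
    simp [hχ, e1, e2]
  have iφ : Integrable φ := q1.continuous.integrable_of_hasCompactSupport q2
  have iψ : Integrable ψ := p1.continuous.integrable_of_hasCompactSupport p2
  have χint : ∫ y, χ y = 0 := by
    simp only [hχ]
    rw [integral_sub iφ (iψ.const_mul m), integral_const_mul, p4, ← hm]; simp
  set θ : ℝ → ℝ := fun y => ∫ t in (0 : ℝ)..y, χ t with hθ
  have θd : ∀ y, HasDerivAt θ (χ y) y := fun y =>
    intervalIntegral.integral_hasDerivAt_right (χ1.continuous.intervalIntegrable _ _)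
      (χ1.continuous.stronglyMeasurableAtFilter _ _) χ1.continuous.continuousAt
  have θd' : deriv θ = χ := funext fun y => (θd y).deriv
  have θ1 : ContDiff ℝ ∞ θ := by
    rw [contDiff_infty_iff_deriv]
    exact ⟨fun y => (θd y).differentiableAt, by rw [θd']; exact χ1⟩
  have θ0 : ∀ y, y ∉ Icc a b → θ y = 0 := by
    intro y hy
    rcases not_and_or.1 hy with hy | hy
    · push Not at hy
      have : ∫ t in (0 : ℝ)..y, χ t = ∫ t in (0 : ℝ)..y, (0 : ℝ) := by
        apply intervalIntegral.integral_congr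
        intro t ht
        apply χ0
        rintro ⟨h1, h2⟩
        rw [mem_uIcc] at ht
        rcases ht with ht | ht <;> linarith [ht.1, ht.2]
      simp [hθ, this]
    · push Not at hy
      rw [← χint, hθ]
      simp only
      rw [intervalIntegral.integral_of_le (by linarith)]
      apply setIntegral_eq_integral_of_forall_compl_eq_zero
      intro t ht
      apply χ0
      rintro ⟨h1, h2⟩
      exact ht ⟨by linarith, by linarith⟩
  have θs : tsupport θ ⊆ Icc a b :=
    closure_minimal (fun y hy => by by_contra h0; exact hy (θ0 y h0)) isClosed_Icc
  have key := h θ θ1 (isCompact_Icc.of_isClosed_subset (isClosed_tsupport θ) θs)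
    (θs.trans fun y hy => ⟨by linarith [hy.1], by linarith [hy.2]⟩)
  rw [θd'] at key
  have i1 := integrableOn_mul_test hf q1.continuous q2
  have i2 := integrableOn_mul_test hf p1.continuous p2
  have e : ∫ y in Ioo 0 lam, f y * χ y =
      (∫ y in Ioo 0 lam, f y * φ y) - m * c := by
    rw [hc, ← integral_const_mul, ← integral_sub i1 (i2.const_mul m)]
    congr 1; ext y; simp only [hχ]; ring
  have e2 : ∫ y in Ioo 0 lam, (f y - c) * φ y =
      (∫ y in Ioo 0 lam, f y * φ y) - c * m := by
    rw [hm, setIntegral_eq_integral_of_forall_compl_eq_zero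
      (s := Ioo 0 lam) (f := φ) (fun x hx => by
        by_contra h0; exact hx (q3 (subset_tsupport φ h0))) |>.symm, ← integral_const_mul,
      ← integral_sub i1 (iφ.integrableOn.const_mul c)]
    congr 1; ext y; ring
  rw [e2]
  simp only [zero_mul, integral_zero, neg_zero] at key
  rw [e] at key
  linarith

/-- A function with an integrable weak derivative is a.e. equal to a primitive of it. -/
theorem IsWeakDeriv.exists_ae_eq_primitive {lam : ℝ} (hl : 0 < lam) {f g : ℝ → ℝ}
    (hf : IntegrableOn f (Ioo 0 lam)) (hg : IntegrableOn g (Ioo 0 lam))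
    (h : IsWeakDeriv lam f g) :
    ∃ c : ℝ, ∀ᵐ y ∂volume.restrict (Ioo 0 lam), f y = c + ∫ t in (0 : ℝ)..y, g t := by
  set G : ℝ → ℝ := fun y => 0 + ∫ t in (0 : ℝ)..y, g t with hG
  have hGw := isWeakDeriv_primitive hl.le hg 0
  have hGc := (ae_deriv_primitive hl.le hg 0).1.continuousOn
  rw [uIcc_of_le hl.le] at hGc
  have hGi : IntegrableOn G (Ioo 0 lam) :=
    (hGc.integrableOn_compact isCompact_Icc).mono_set Ioo_subset_Icc_self
  obtain ⟨c, hc⟩ := IsWeakDeriv.exists_ae_eq_const hl (f := fun y => f y - G y) (hf.sub hGi) (by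
    intro φ h1 h2 h3
    have hd1 : Continuous (deriv φ) := h1.continuous_deriv (by simp)
    have i1 := integrableOn_mul_test hf hd1 h2.deriv
    have i2 := integrableOn_mul_test hGi hd1 h2.deriv
    simp only [sub_mul]
    rw [integral_sub i1 i2, h φ h1 h2 h3, hGw φ h1 h2 h3]
    simp)
  exact ⟨c, hc.mono fun y hy => by simp only [hG] at hy; linarith⟩

theorem IsWeakDeriv.ae_unique {lam : ℝ} {f g g' : ℝ → ℝ}
    (hg : IntegrableOn g (Ioo 0 lam)) (hg' : IntegrableOn g' (Ioo 0 lam))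
    (h : IsWeakDeriv lam f g) (h' : IsWeakDeriv lam f g') :
    g =ᵐ[volume.restrict (Ioo 0 lam)] g' := by
  have : ∀ᵐ y ∂volume.restrict (Ioo 0 lam), g y - g' y = 0 := by
    refine ae_eq_zero_of_test (hg.sub hg') ?_
    intro φ h1 h2 h3
    have i1 := integrableOn_mul_test hg h1.continuous h2
    have i2 := integrableOn_mul_test hg' h1.continuous h2
    simp only [sub_mul]
    rw [integral_sub i1 i2]
    linarith [h φ h1 h2 h3, h' φ h1 h2 h3]
  exact this.mono fun y hy => by linarith

theorem L2.integrableOn {lam : ℝ} (f : L2 lam) : IntegrableOn f (Ioo 0 lam) :=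
  (Lp.memLp f).integrable one_le_two

namespace SobolevH1

variable {lam : ℝ}

theorem toFun_integrableOn (h : SobolevH1 lam) : IntegrableOn h.toFun (Ioo 0 lam) :=
  L2.integrableOn _

theorem weakDeriv_integrableOn (h : SobolevH1 lam) : IntegrableOn h.weakDeriv (Ioo 0 lam) :=
  L2.integrableOn _

theorem isWeakDeriv (h : SobolevH1 lam) : IsWeakDeriv lam h.toFun h.weakDeriv := h.2

theorem weakDeriv_intervalIntegrable (hl : 0 ≤ lam) (h : SobolevH1 lam) :
    IntervalIntegrable h.weakDeriv volume 0 lam :=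
  IntegrableOn.intervalIntegrable_of_Ioo hl h.weakDeriv_integrableOn

theorem continuousOn_primitive (hl : 0 ≤ lam) {g : ℝ → ℝ} (hg : IntegrableOn g (Ioo 0 lam)) (c : ℝ) :
    ContinuousOn (fun y => c + ∫ t in (0 : ℝ)..y, g t) (Icc 0 lam) := by
  have := (ae_deriv_primitive hl hg c).1.continuousOn
  rwa [uIcc_of_le hl] at this

end SobolevH1

theorem eqOn_Icc_of_ae_eq {a b : ℝ} (hab : a < b) {f g : ℝ → ℝ} (hf : ContinuousOn f (Icc a b))
    (hg : ContinuousOn g (Icc a b)) (h : f =ᵐ[volume.restrict (Ioo a b)] g) :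
    EqOn f g (Icc a b) := by
  have h1 : EqOn f g (Ioo a b) :=
    Measure.eqOn_open_of_ae_eq h isOpen_Ioo (hf.mono Ioo_subset_Icc_self)
      (hg.mono Ioo_subset_Icc_self)
  exact h1.of_subset_closure hf hg Ioo_subset_Icc_self (by rw [closure_Ioo hab.ne])

namespace SobolevH1

variable {lam : ℝ}

theorem IsContRep.eqOn_primitive (hl : 0 < lam) {h : SobolevH1 lam} {g : ℝ → ℝ}
    (hg : h.IsContRep g) : ∀ y ∈ Icc 0 lam, g y = g 0 + ∫ t in (0 : ℝ)..y, h.weakDeriv t := by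
  obtain ⟨c, hc⟩ := h.isWeakDeriv.exists_ae_eq_primitive hl h.toFun_integrableOn
    h.weakDeriv_integrableOn
  have h1 := eqOn_Icc_of_ae_eq hl hg.1 (continuousOn_primitive hl.le h.weakDeriv_integrableOn c)
    (hg.2.trans hc)
  intro y hy
  have e0 := h1 (left_mem_Icc.2 hl.le)
  have ey := h1 hy
  simp only [intervalIntegral.integral_same, add_zero] at e0
  rw [ey, e0]

theorem boundaryConditions_iff (hl : 0 < lam) (h : SobolevH1 lam) :
    h.BoundaryConditions ↔
      (∀ᵐ y ∂volume.restrict (Ioo 0 lam), h.toFun y = ∫ t in (0 : ℝ)..y, h.weakDeriv t) ∧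
        ∫ t in (0 : ℝ)..lam, h.weakDeriv t = 1 := by
  constructor
  · rintro ⟨g, hg, h0, h1⟩
    have := hg.eqOn_primitive hl
    constructor
    · filter_upwards [hg.2, ae_restrict_mem measurableSet_Ioo] with y hy hm
      rw [← hy, this y (Ioo_subset_Icc_self hm), h0, zero_add]
    · have := this lam (right_mem_Icc.2 hl.le)
      rw [h0, h1, zero_add] at this
      exact this.symm
  · rintro ⟨h1, h2⟩
    refine ⟨fun y => 0 + ∫ t in (0 : ℝ)..y, h.weakDeriv t,
      ⟨continuousOn_primitive hl.le h.weakDeriv_integrableOn 0, ?_⟩, by simp, by simpa using h2⟩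
    filter_upwards [h1] with y hy
    rw [hy, zero_add]

theorem exists_of_deriv (hl : 0 < lam) {v : ℝ → ℝ}
    (hv : MemLp v 2 (volume.restrict (Ioo 0 lam))) :
    ∃ h : SobolevH1 lam,
      (∀ᵐ y ∂volume.restrict (Ioo 0 lam), h.toFun y = ∫ t in (0 : ℝ)..y, v t) ∧
      h.weakDeriv =ᵐ[volume.restrict (Ioo 0 lam)] v := by
  have hvi : IntegrableOn v (Ioo 0 lam) := hv.integrable one_le_two
  have hc := continuousOn_primitive hl.le hvi 0
  obtain ⟨C, hC⟩ := isCompact_Icc.exists_bound_of_continuousOn hc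
  have hu : MemLp (fun y => 0 + ∫ t in (0 : ℝ)..y, v t) 2 (volume.restrict (Ioo 0 lam)) := by
    refine MemLp.of_bound ((hc.mono Ioo_subset_Icc_self).aestronglyMeasurable measurableSet_Ioo) C ?_
    filter_upwards [ae_restrict_mem measurableSet_Ioo] with y hm
    exact hC y (Ioo_subset_Icc_self hm)
  refine ⟨⟨WithLp.toLp 2 (hu.toLp _, hv.toLp _), ?_⟩, ?_, ?_⟩
  · exact (isWeakDeriv_primitive hl.le hvi 0).congr hu.coeFn_toLp hv.coeFn_toLp
  · filter_upwards [hu.coeFn_toLp] with y hy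
    rw [← zero_add (∫ t in (0 : ℝ)..y, v t), ← hy]; rfl
  · exact hv.coeFn_toLp

theorem tendsto_iff {ι : Type*} {l : Filter ι} {h : ι → SobolevH1 lam} {x : SobolevH1 lam} :
    Tendsto h l (𝓝 x) ↔ Tendsto (fun n => (h n).1.fst) l (𝓝 x.1.fst) ∧
      Tendsto (fun n => (h n).1.snd) l (𝓝 x.1.snd) := by
  constructor
  · intro hh
    have h1 : Tendsto (fun n => (h n).1) l (𝓝 x.1) := (continuous_subtype_val.tendsto x).comp hh
    have h2 := ((WithLp.prod_continuous_ofLp 2 (L2 lam) (L2 lam)).tendsto x.1).comp h1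
    exact ⟨(continuous_fst.tendsto _).comp h2, (continuous_snd.tendsto _).comp h2⟩
  · rintro ⟨h1, h2⟩
    rw [tendsto_subtype_rng]
    exact ((WithLp.prod_continuous_toLp 2 (L2 lam) (L2 lam)).tendsto _).comp (h1.prodMk_nhds h2)

end SobolevH1

theorem L2.tendsto_of_bounded_ae {lam : ℝ} {f : ℕ → L2 lam} {g : L2 lam} {R : ℝ}
    (hb : ∀ n, ∀ᵐ y ∂volume.restrict (Ioo 0 lam), |f n y| ≤ R)
    (hc : ∀ᵐ y ∂volume.restrict (Ioo 0 lam), Tendsto (fun n => f n y) atTop (𝓝 (g y))) :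
    Tendsto f atTop (𝓝 g) := by
  rw [Lp.tendsto_Lp_iff_tendsto_eLpNorm']
  have hg : ∀ᵐ y ∂volume.restrict (Ioo 0 lam), |g y| ≤ R := by
    filter_upwards [hc, ae_all_iff.2 hb] with y h1 h2
    exact le_of_tendsto h1.abs (Eventually.of_forall h2)
  have hlint : Tendsto (fun n => ∫⁻ y in Ioo 0 lam, ‖(f n - g) y‖ₑ ^ (2 : ℝ)) atTop (𝓝 0) := by
    have h0 : ∫⁻ y in Ioo 0 lam, (0 : ℝ≥0∞) = 0 := by simp
    rw [← h0]
    refine tendsto_lintegral_of_dominated_convergence' (fun _ => ENNReal.ofReal (2 * R) ^ (2 : ℝ))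
      ?_ ?_ ?_ ?_
    · intro n
      exact ((Lp.aestronglyMeasurable _).enorm).pow_const _
    · intro n
      filter_upwards [hb n, hg, Lp.coeFn_sub (f n) g] with y h1 h2 h3
      rw [h3, Pi.sub_apply]
      gcongr
      rw [Real.enorm_eq_ofReal_abs]
      apply ENNReal.ofReal_le_ofReal
      have := abs_sub (f n y) (g y)
      linarith
    · rw [lintegral_const]
      exact ENNReal.mul_ne_top (ENNReal.rpow_ne_top_of_nonneg (by norm_num) ENNReal.ofReal_ne_top)
        (by simp)
    · filter_upwards [hc, ae_all_iff.2 fun n => Lp.coeFn_sub (f n) g] with y h1 h3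
      have h4 : Tendsto (fun n => (f n - g) y) atTop (𝓝 0) := by
        have : (fun n => (f n - g) y) = fun n => f n y - g y := funext fun n => h3 n
        have h6 := h1.sub_const (g y)
        rw [sub_self] at h6
        rw [this]
        exact h6
      have h5 := (ENNReal.continuous_rpow_const (y := 2)).tendsto _ |>.comp h4.enorm
      simpa [Function.comp_def] using h5
  have key := (ENNReal.continuous_rpow_const (y := 1 / 2)).tendsto _ |>.comp hlint
  have : (fun n => eLpNorm (f n - g : ℝ → ℝ) 2 (volume.restrict (Ioo 0 lam))) =
      (fun a => a ^ (1 / 2 : ℝ)) ∘ fun n => ∫⁻ y in Ioo 0 lam, ‖(f n - g) y‖ₑ ^ (2 : ℝ) := by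
    ext n
    rw [← eLpNorm_congr_ae (Lp.coeFn_sub (f n) g),
      eLpNorm_eq_lintegral_rpow_enorm_toReal (by norm_num) (by norm_num)]
    simp
  rw [this]
  simpa using key

theorem L2.exists_subseq_ae {lam : ℝ} {f : ℕ → L2 lam} {g : L2 lam} (h : Tendsto f atTop (𝓝 g)) :
    ∃ φ : ℕ → ℕ, StrictMono φ ∧
      ∀ᵐ y ∂volume.restrict (Ioo 0 lam), Tendsto (fun n => f (φ n) y) atTop (𝓝 (g y)) :=
  (tendstoInMeasure_of_tendsto_Lp h).exists_seq_tendsto_ae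

namespace SobolevH1

variable {lam : ℝ}

theorem exists_subseq_ae {h : ℕ → SobolevH1 lam} {x : SobolevH1 lam}
    (hx : Tendsto h atTop (𝓝 x)) :
    ∃ φ : ℕ → ℕ, StrictMono φ ∧
      (∀ᵐ y ∂volume.restrict (Ioo 0 lam),
        Tendsto (fun n => (h (φ n)).toFun y) atTop (𝓝 (x.toFun y))) ∧
      (∀ᵐ y ∂volume.restrict (Ioo 0 lam),
        Tendsto (fun n => (h (φ n)).weakDeriv y) atTop (𝓝 (x.weakDeriv y))) := by
  obtain ⟨h1, h2⟩ := tendsto_iff.1 hx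
  obtain ⟨φ, hφ, a1⟩ := L2.exists_subseq_ae h1
  obtain ⟨ψ, hψ, a2⟩ := L2.exists_subseq_ae (h2.comp hφ.tendsto_atTop)
  exact ⟨φ ∘ ψ, hφ.comp hψ, a1.mono fun y hy => hy.comp hψ.tendsto_atTop, a2⟩

/-- The primitives converge along `H¹`-convergent sequences. -/
theorem tendsto_primitive {h : ℕ → SobolevH1 lam} {x : SobolevH1 lam}
    (hx : Tendsto h atTop (𝓝 x)) {y : ℝ} (hy : y ∈ Icc 0 lam) :
    Tendsto (fun n => ∫ t in (0 : ℝ)..y, (h n).weakDeriv t) atTop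
      (𝓝 (∫ t in (0 : ℝ)..y, x.weakDeriv t)) := by
  obtain ⟨-, h2⟩ := tendsto_iff.1 hx
  have e : ∀ z : SobolevH1 lam, ∫ t in (0 : ℝ)..y, z.weakDeriv t =
      ∫ t in Ioc 0 y, z.weakDeriv t ∂volume.restrict (Ioo 0 lam) := by
    intro z
    rw [intervalIntegral.integral_of_le hy.1, integral_Ioc_eq_integral_Ioo,
      integral_Ioc_eq_integral_Ioo' , Measure.restrict_restrict measurableSet_Ioo,
      Ioo_inter_Ioo]
    · simp [hy.2]
    · simp
  simp only [e]
  refine tendsto_setIntegral_of_L1' _ x.weakDeriv_integrableOn.aestronglyMeasurable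
    (Eventually.of_forall fun n => (h n).weakDeriv_integrableOn) ?_ _
  have h3 : Tendsto (fun n => eLpNorm ((h n).weakDeriv - x.weakDeriv) 2
      (volume.restrict (Ioo 0 lam))) atTop (𝓝 0) := (Lp.tendsto_Lp_iff_tendsto_eLpNorm' _ _).1 h2
  have h4 := ENNReal.Tendsto.mul_const h3 (b := (volume.restrict (Ioo 0 lam)) univ ^
    (1 / (1 : ℝ≥0∞).toReal - 1 / (2 : ℝ≥0∞).toReal))
    (Or.inr (ENNReal.rpow_ne_top_of_nonneg (by norm_num) (by simp)))
  rw [zero_mul] at h4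
  refine tendsto_of_tendsto_of_tendsto_of_le_of_le tendsto_const_nhds h4 (fun _ => zero_le) ?_
  intro n
  exact eLpNorm_le_eLpNorm_mul_rpow_measure_univ one_le_two
    ((Lp.aestronglyMeasurable _).sub (Lp.aestronglyMeasurable _))

theorem tendsto_of_bounded_ae (hl : 0 < lam) {h : ℕ → SobolevH1 lam} {x : SobolevH1 lam} {R : ℝ}
    (hh : ∀ n, ∀ᵐ y ∂volume.restrict (Ioo 0 lam),
      (h n).toFun y = ∫ t in (0 : ℝ)..y, (h n).weakDeriv t)
    (hx : ∀ᵐ y ∂volume.restrict (Ioo 0 lam), x.toFun y = ∫ t in (0 : ℝ)..y, x.weakDeriv t)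
    (hb : ∀ n, ∀ᵐ y ∂volume.restrict (Ioo 0 lam), |(h n).weakDeriv y| ≤ R)
    (hc : ∀ᵐ y ∂volume.restrict (Ioo 0 lam),
      Tendsto (fun n => (h n).weakDeriv y) atTop (𝓝 (x.weakDeriv y))) :
    Tendsto h atTop (𝓝 x) := by
  refine tendsto_iff.2 ⟨?_, L2.tendsto_of_bounded_ae hb hc⟩
  have hsub : ∀ y ∈ Ioo 0 lam, uIoc 0 y ⊆ Ioo 0 lam := by
    intro y hy t ht
    rw [uIoc_of_le hy.1.le] at ht
    exact ⟨ht.1, ht.2.trans_lt hy.2⟩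
  refine L2.tendsto_of_bounded_ae (R := R * lam) ?_ ?_
  · intro n
    have hR : 0 ≤ R := by
      have : (ae (volume.restrict (Ioo 0 lam))).NeBot := by
        rw [ae_neBot]; simp [Measure.restrict_eq_zero, hl]
      obtain ⟨y, hy⟩ := (hb n).exists
      exact (abs_nonneg _).trans hy
    filter_upwards [hh n, ae_restrict_mem measurableSet_Ioo] with y hy hm
    change |(h n).toFun y| ≤ _
    rw [hy]
    have h1 : ‖∫ t in (0 : ℝ)..y, (h n).weakDeriv t‖ ≤ R * |y - 0| := by
      apply intervalIntegral.norm_integral_le_of_norm_le_const_ae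
      filter_upwards [(ae_restrict_iff' measurableSet_Ioo).1 (hb n)] with t ht hm'
      exact ht (hsub y hm hm')
    refine h1.trans ?_
    rw [sub_zero, abs_of_pos hm.1]
    gcongr
    exact hm.2.le
  · filter_upwards [ae_all_iff.2 hh, hx, ae_restrict_mem measurableSet_Ioo] with y hy hy' hm
    change Tendsto (fun n => (h n).toFun y) atTop (𝓝 (x.toFun y))
    simp only [hy, hy']
    refine intervalIntegral.tendsto_integral_filter_of_dominated_convergence (fun _ => R) ?_ ?_ ?_ ?_
    · refine Eventually.of_forall fun n => ?_
      exact ((h n).weakDeriv_integrableOn.mono_set (hsub y hm)).aestronglyMeasurable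
    · refine Eventually.of_forall fun n => ?_
      filter_upwards [(ae_restrict_iff' measurableSet_Ioo).1 (hb n)] with t ht hm'
      exact ht (hsub y hm hm')
    · exact intervalIntegrable_const
    · filter_upwards [(ae_restrict_iff' measurableSet_Ioo).1 hc] with t ht hm'
      exact ht (hsub y hm hm')

theorem MemH2.weakDeriv2_spec {h : SobolevH1 lam} (hh : h.MemH2) :
    MemLp h.weakDeriv2 2 (volume.restrict (Ioo 0 lam)) ∧
      IsWeakDeriv lam h.weakDeriv h.weakDeriv2 := by
  have e : h.weakDeriv2 = (hh.choose : L2 lam) := by simp [weakDeriv2, hh]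
  rw [e]
  exact ⟨Lp.memLp _, hh.choose_spec⟩

/-- The absolutely continuous representative of the derivative of an `H²` function. -/
theorem MemH2.exists_ac_rep (hl : 0 < lam) {h : SobolevH1 lam} (hh : h.MemH2) :
    ∃ V : ℝ → ℝ, AbsolutelyContinuousOnInterval V 0 lam ∧
      V =ᵐ[volume.restrict (Ioo 0 lam)] h.weakDeriv ∧
      ∀ᵐ y ∂volume.restrict (Ioo 0 lam), HasDerivAt V (h.weakDeriv2 y) y := by
  obtain ⟨h1, h2⟩ := hh.weakDeriv2_spec
  have h1' : IntegrableOn h.weakDeriv2 (Ioo 0 lam) := h1.integrable one_le_two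
  obtain ⟨c, hc⟩ := h2.exists_ae_eq_primitive hl h.weakDeriv_integrableOn h1'
  obtain ⟨a1, a2⟩ := ae_deriv_primitive hl.le h1' c
  exact ⟨_, a1, hc.mono fun y hy => hy.symm, a2⟩

theorem memH2_of_ac (hl : 0 < lam) {h : SobolevH1 lam} {V : ℝ → ℝ}
    (hV : AbsolutelyContinuousOnInterval V 0 lam)
    (hVh : h.weakDeriv =ᵐ[volume.restrict (Ioo 0 lam)] V)
    (hd : MemLp (deriv V) 2 (volume.restrict (Ioo 0 lam))) :
    h.MemH2 ∧ h.weakDeriv2 =ᵐ[volume.restrict (Ioo 0 lam)] deriv V := by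
  have hw : IsWeakDeriv lam h.weakDeriv (deriv V) :=
    (hV.isWeakDeriv hl.le).congr hVh (EventuallyEq.refl _ _)
  have hm : h.MemH2 := ⟨hd.toLp _, hw.congr (EventuallyEq.refl _ _) hd.coeFn_toLp⟩
  obtain ⟨h1, h2⟩ := hm.weakDeriv2_spec
  exact ⟨hm, h2.ae_unique (h1.integrable one_le_two) (hd.integrable one_le_two) hw⟩

end SobolevH1

/-- The standing assumptions on the stored energy. -/
structure IsStoredEnergy (W : ℝ → ℝ) : Prop where
  cont : ContinuousOn W (Ioi 0)
  nonneg : ∀ F, 0 < F → 0 ≤ W F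
  zero : ∀ F, 0 < F → (W F = 0 ↔ F = 1)
  asymptote : ∃ w : ℝ, Tendsto W atTop (𝓝 w)
  growth : ∃ C M : ℝ, 0 < C ∧ 1 < M ∧ ∀ F, 0 < F → F ≤ 1 / M → C * (1 / F) ≤ W F

/-- The even extension of the inverse stored energy. -/
noncomputable def evenEnergy (W : ℝ → ℝ) (t : ℝ) : ℝ := inverseEnergy W |t|

/-- The Modica-Mortola primitive `∫₀ᵗ √(2 W*)`. -/
noncomputable def phasePrimitive (W : ℝ → ℝ) (t : ℝ) : ℝ :=
  ∫ s in (0 : ℝ)..t, √(2 * evenEnergy W s)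

theorem evenEnergy_of_nonneg (W : ℝ → ℝ) {t : ℝ} (ht : 0 ≤ t) :
    evenEnergy W t = inverseEnergy W t := by
  rw [evenEnergy, abs_of_nonneg ht]

theorem evenEnergy_zero (W : ℝ → ℝ) : evenEnergy W 0 = 0 := by
  simp [evenEnergy, inverseEnergy]

theorem phasePrimitive_zero (W : ℝ → ℝ) : phasePrimitive W 0 = 0 := by
  simp [phasePrimitive]

theorem phasePrimitive_one (W : ℝ → ℝ) : phasePrimitive W 1 = surfaceConstant W := by
  refine intervalIntegral.integral_congr fun s hs => ?_
  rw [uIcc_of_le zero_le_one] at hs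
  simp only [evenEnergy_of_nonneg W hs.1]

namespace IsStoredEnergy

variable {W : ℝ → ℝ}

theorem evenEnergy_nonneg (hW : IsStoredEnergy W) (t : ℝ) : 0 ≤ evenEnergy W t := by
  rcases eq_or_ne t 0 with rfl | ht
  · rw [evenEnergy_zero]
  · exact mul_nonneg (abs_nonneg t) (hW.nonneg _ (inv_pos.2 (abs_pos.2 ht)))

theorem evenEnergy_one (hW : IsStoredEnergy W) : evenEnergy W 1 = 0 := by
  simp [evenEnergy, inverseEnergy, (hW.zero 1 one_pos).2 rfl]

theorem evenEnergy_eq_zero (hW : IsStoredEnergy W) {t : ℝ} (ht : 0 ≤ t)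
    (h : evenEnergy W t = 0) : t = 0 ∨ t = 1 := by
  rcases ht.eq_or_lt with h0 | h0
  · exact Or.inl h0.symm
  · rw [evenEnergy_of_nonneg W ht, inverseEnergy, mul_eq_zero] at h
    rcases h with h | h
    · exact Or.inl h
    · exact Or.inr (inv_eq_one.1 ((hW.zero _ (inv_pos.2 h0)).1 h))

theorem continuous_evenEnergy (hW : IsStoredEnergy W) : Continuous (evenEnergy W) := by
  rw [continuous_iff_continuousAt]
  intro t
  rcases eq_or_ne t 0 with rfl | ht
  · obtain ⟨w, hw⟩ := hW.asymptote
    rw [← continuousWithinAt_compl_self, ContinuousWithinAt, evenEnergy_zero]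
    have h1 : Tendsto (fun t : ℝ => |t|) (𝓝[{0}ᶜ] 0) (𝓝[>] 0) := tendsto_abs_nhdsNE_zero
    have h2 := (hw.comp tendsto_inv_nhdsGT_zero).comp h1
    have h3 := (h1.mono_right nhdsWithin_le_nhds).mul h2
    simpa [evenEnergy, inverseEnergy, Function.comp_def] using! h3
  · have h1 : ContinuousAt (fun t : ℝ => |t|) t := continuous_abs.continuousAt
    have h2 : ContinuousAt (fun t : ℝ => |t|⁻¹) t := h1.inv₀ (abs_ne_zero.2 ht)
    have h3 : ContinuousAt W (|t|⁻¹) :=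
      hW.cont.continuousAt (Ioi_mem_nhds (inv_pos.2 (abs_pos.2 ht)))
    exact h1.mul (h3.comp_of_eq h2 rfl)

theorem continuous_sqrt (hW : IsStoredEnergy W) : Continuous fun s => √(2 * evenEnergy W s) :=
  Real.continuous_sqrt.comp (continuous_const.mul hW.continuous_evenEnergy)

theorem hasDerivAt_phasePrimitive (hW : IsStoredEnergy W) (t : ℝ) :
    HasDerivAt (phasePrimitive W) (√(2 * evenEnergy W t)) t :=
  intervalIntegral.integral_hasDerivAt_right (hW.continuous_sqrt.intervalIntegrable _ _)
    (hW.continuous_sqrt.stronglyMeasurableAtFilter _ _) hW.continuous_sqrt.continuousAt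

theorem continuous_phasePrimitive (hW : IsStoredEnergy W) : Continuous (phasePrimitive W) :=
  continuous_iff_continuousAt.2 fun t => (hW.hasDerivAt_phasePrimitive t).continuousAt

theorem phasePrimitive_sub (hW : IsStoredEnergy W) (a b : ℝ) :
    phasePrimitive W b - phasePrimitive W a = ∫ s in a..b, √(2 * evenEnergy W s) :=
  intervalIntegral.integral_interval_sub_left (hW.continuous_sqrt.intervalIntegrable _ _)
    (hW.continuous_sqrt.intervalIntegrable _ _)

theorem monotone_phasePrimitive (hW : IsStoredEnergy W) : Monotone (phasePrimitive W) := by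
  intro a b hab
  have := intervalIntegral.integral_nonneg hab
    (fun u _ => Real.sqrt_nonneg (2 * evenEnergy W u)) (μ := volume)
  rw [← hW.phasePrimitive_sub] at this
  linarith

theorem strictMonoOn_phasePrimitive (hW : IsStoredEnergy W) :
    StrictMonoOn (phasePrimitive W) (Ici 0) := by
  intro a ha b hb hab
  have ha' : 0 ≤ a := ha
  obtain ⟨c, hc, hc1⟩ : ∃ c ∈ Ioo a b, c ≠ 1 := by
    by_contra! h
    have h1 := h ((2 * a + b) / 3) ⟨by linarith, by linarith⟩
    have h2 := h ((a + 2 * b) / 3) ⟨by linarith, by linarith⟩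
    linarith
  have hpos : 0 < √(2 * evenEnergy W c) := by
    apply Real.sqrt_pos.2
    have h1 := hW.evenEnergy_nonneg c
    have h2 : evenEnergy W c ≠ 0 := fun h0 => by
      rcases hW.evenEnergy_eq_zero (ha'.trans hc.1.le) h0 with h | h
      · linarith [hc.1]
      · exact hc1 h
    positivity
  have := intervalIntegral.integral_pos hab hW.continuous_sqrt.continuousOn
    (fun x _ => Real.sqrt_nonneg _) ⟨c, Ioo_subset_Icc_self hc, hpos⟩
  rw [← hW.phasePrimitive_sub] at this
  linarith

theorem surfaceConstant_pos (hW : IsStoredEnergy W) : 0 < surfaceConstant W := by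
  rw [← phasePrimitive_one, ← phasePrimitive_zero W]
  exact hW.strictMonoOn_phasePrimitive (mem_Ici.2 le_rfl) (mem_Ici.2 zero_le_one) zero_lt_one

theorem tendsto_phasePrimitive (hW : IsStoredEnergy W) :
    Tendsto (phasePrimitive W) atTop atTop := by
  obtain ⟨C, M, hC, hM, h⟩ := hW.growth
  have hs : 0 < √(2 * C) := Real.sqrt_pos.2 (by positivity)
  have hlow : ∀ s, M ≤ s → √(2 * C) ≤ √(2 * evenEnergy W s) := by
    intro s hs
    have hs0 : 0 < s := by linarith
    apply Real.sqrt_le_sqrt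
    rw [evenEnergy_of_nonneg W hs0.le, inverseEnergy]
    have h1 := h s⁻¹ (inv_pos.2 hs0) (by rw [one_div]; exact inv_anti₀ (by linarith) hs)
    rw [one_div, inv_inv] at h1
    have h2 : C ≤ s * W s⁻¹ := by
      calc C ≤ s * (C * s) := by nlinarith [mul_pos hC hs0, mul_le_mul hs hs (by linarith) hs0.le]
        _ ≤ _ := by gcongr
    linarith
  have h2 : ∀ t, M ≤ t → √(2 * C) * (t - M) + phasePrimitive W M ≤ phasePrimitive W t := by
    intro t ht
    have := intervalIntegral.integral_mono_on ht (intervalIntegrable_const (μ := volume))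
      (hW.continuous_sqrt.intervalIntegrable M t) (fun x hx => hlow x hx.1)
    rw [intervalIntegral.integral_const, ← hW.phasePrimitive_sub, smul_eq_mul] at this
    linarith
  refine tendsto_atTop_mono' _ (eventually_ge_atTop M |>.mono h2) ?_
  refine tendsto_atTop_add_const_right _ _ (Tendsto.const_mul_atTop hs ?_)
  exact tendsto_atTop_add_const_right _ _ tendsto_id

theorem phasePrimitive_comp_ac (hW : IsStoredEnergy W) {a b : ℝ} {V : ℝ → ℝ}
    (hV : AbsolutelyContinuousOnInterval V a b) :
    AbsolutelyContinuousOnInterval (fun y => phasePrimitive W (V y)) a b := by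
  obtain ⟨R, hR⟩ := hV.exists_bound
  obtain ⟨K, hK⟩ := (isCompact_Icc (a := -R) (b := R)).exists_bound_of_continuousOn
    hW.continuous_sqrt.continuousOn
  have hlip : ∀ s ∈ Icc (-R) R, ∀ t ∈ Icc (-R) R,
      dist (phasePrimitive W s) (phasePrimitive W t) ≤ |K| * dist s t := by
    intro s hs t ht
    rw [Real.dist_eq, Real.dist_eq, hW.phasePrimitive_sub, ← Real.norm_eq_abs]
    refine intervalIntegral.norm_integral_le_of_norm_le_const fun x hx => ?_
    exact (hK x (ordConnected_Icc.uIcc_subset ht hs (uIoc_subset_uIcc hx))).trans (le_abs_self K)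
  rw [absolutelyContinuousOnInterval_iff] at hV ⊢
  intro ε hε
  obtain ⟨δ, hδ, h⟩ := hV (ε / (|K| + 1)) (by positivity)
  refine ⟨δ, hδ, fun E hE hEδ => ?_⟩
  have h1 := h E hE hEδ
  have hm : ∀ x ∈ uIcc a b, V x ∈ Icc (-R) R := fun x hx => abs_le.1 (hR x hx)
  calc _ ≤ ∑ i ∈ Finset.range E.1, |K| * dist (V (E.2 i).1) (V (E.2 i).2) :=
        Finset.sum_le_sum fun i hi =>
          hlip _ (hm _ (hE.1 i hi).1) _ (hm _ (hE.1 i hi).2)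
    _ = |K| * ∑ i ∈ Finset.range E.1, dist (V (E.2 i).1) (V (E.2 i).2) := (Finset.mul_sum _ _ _).symm
    _ ≤ (|K| + 1) * ∑ i ∈ Finset.range E.1, dist (V (E.2 i).1) (V (E.2 i).2) := by
        gcongr
        linarith
    _ < (|K| + 1) * (ε / (|K| + 1)) := by gcongr
    _ = ε := by field_simp

/-- The Modica-Mortola inequality. -/
theorem ofReal_abs_phasePrimitive_sub_le (hW : IsStoredEnergy W) {lam ε : ℝ} (hε : 0 < ε)
    {V w : ℝ → ℝ} (hV : AbsolutelyContinuousOnInterval V 0 lam)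
    (hd : ∀ᵐ y ∂volume.restrict (Ioo 0 lam), HasDerivAt V (w y) y) {a b : ℝ}
    (ha : 0 ≤ a) (hab : a ≤ b) (hb : b ≤ lam) :
    ENNReal.ofReal |phasePrimitive W (V b) - phasePrimitive W (V a)| ≤
      ∫⁻ y in Ioo a b, ENNReal.ofReal (ε / 2 * w y ^ 2 + 1 / ε * evenEnergy W (V y)) := by
  have hl : 0 ≤ lam := by linarith
  have hsub : uIcc a b ⊆ uIcc 0 lam := by
    rw [uIcc_of_le hab, uIcc_of_le hl]; exact Icc_subset_Icc ha hb
  have hac := hW.phasePrimitive_comp_ac (hV.mono hsub)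
  rw [← hac.integral_deriv_eq_sub, ← Real.enorm_eq_ofReal_abs, intervalIntegral.integral_of_le hab,
    integral_Ioc_eq_integral_Ioo]
  refine (enorm_integral_le_lintegral_enorm _).trans (lintegral_mono_ae ?_)
  filter_upwards [ae_restrict_Ioo_mono ha hb hd] with y hy
  have h1 : HasDerivAt (fun y => phasePrimitive W (V y)) (√(2 * evenEnergy W (V y)) * w y) y :=
    (hW.hasDerivAt_phasePrimitive (V y)).comp y hy
  rw [h1.deriv, Real.enorm_eq_ofReal_abs]
  apply ENNReal.ofReal_le_ofReal
  have h2 := hW.evenEnergy_nonneg (V y)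
  have h3 : √(2 * evenEnergy W (V y)) ^ 2 = 2 * evenEnergy W (V y) := Real.sq_sqrt (by positivity)
  set s := √(2 * evenEnergy W (V y))
  have h4 : evenEnergy W (V y) = s ^ 2 / 2 := by linarith
  rw [h4, abs_mul, abs_of_nonneg (Real.sqrt_nonneg _), ← sq_abs (w y)]
  have h5 : ε / 2 * |w y| ^ 2 + 1 / ε * (s ^ 2 / 2) - s * |w y| =
      (ε * |w y| - s) ^ 2 / (2 * ε) := by field_simp; ring
  have h6 : 0 ≤ (ε * |w y| - s) ^ 2 / (2 * ε) := by positivity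
  linarith

end IsStoredEnergy

theorem exists_pos_ball_subset_pairwise_disjoint {U : Set ℝ} (hU : IsOpen U) (S : Finset ℝ)
    (hS : ∀ p ∈ S, p ∈ U) :
    ∃ r : ℝ, 0 < r ∧ (∀ p ∈ S, Ioo (p - r) (p + r) ⊆ U) ∧
      (∀ p ∈ S, ∀ q ∈ S, p ≠ q → 2 * r ≤ |p - q|) := by
  have h1 : ∀ᶠ r in 𝓝[>] (0 : ℝ), ∀ p ∈ S, Ioo (p - r) (p + r) ⊆ U := by
    rw [Finset.eventually_all]
    intro p hp
    obtain ⟨δ, hδ, h⟩ := Metric.isOpen_iff.1 hU p (hS p hp)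
    filter_upwards [Ioo_mem_nhdsGT hδ] with r hr
    rw [Real.ball_eq_Ioo] at h
    exact (Ioo_subset_Ioo (by linarith [hr.2]) (by linarith [hr.2])).trans h
  have h2 : ∀ᶠ r in 𝓝[>] (0 : ℝ), ∀ p ∈ S, ∀ q ∈ S, p ≠ q → 2 * r ≤ |p - q| := by
    rw [Finset.eventually_all]
    intro p _
    rw [Finset.eventually_all]
    intro q _
    by_cases hpq : p = q
    · simp [hpq]
    · have : 0 < |p - q| / 2 := by
        have := abs_pos.2 (sub_ne_zero.2 hpq)
        linarith
      filter_upwards [Ioo_mem_nhdsGT this] with r hr _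
      linarith [hr.2]
  obtain ⟨r, ⟨h3, h4⟩, h5⟩ := ((h1.and h2).and self_mem_nhdsWithin).exists
  exact ⟨r, h5, h3, h4⟩

theorem notMem_discontSet_of_ae_const {lam : ℝ} {u : ℝ → ℝ} {y δ c : ℝ} (hδ : 0 < δ)
    (h : ∀ᵐ z ∂volume.restrict (Ioo (y - δ) (y + δ)), u z = c) : y ∉ discontSet lam u := by
  classical
  rintro ⟨-, hn⟩
  refine hn ⟨fun z => if z ∈ Ioo (y - δ) (y + δ) then c else u z, ?_, ?_⟩
  · apply ae_restrict_of_ae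
    filter_upwards [(ae_restrict_iff' measurableSet_Ioo).1 h] with z hz
    by_cases hm : z ∈ Ioo (y - δ) (y + δ)
    · rw [if_pos hm, hz hm]
    · rw [if_neg hm]
  · refine (continuousAt_const (y := c)).congr ?_
    filter_upwards [Ioo_mem_nhds (by linarith : y - δ < y) (by linarith : y < y + δ)] with z hz
    rw [if_pos hz]

theorem exists_ae_const_of_notMem_discontSet {lam : ℝ} {u : ℝ → ℝ}
    (hu : ∀ᵐ z ∂volume.restrict (Ioo 0 lam), u z = 0 ∨ u z = 1) {y : ℝ} (hy : y ∈ Ioo 0 lam)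
    (hn : y ∉ discontSet lam u) :
    ∃ c : ℝ, (c = 0 ∨ c = 1) ∧ ∃ δ, 0 < δ ∧ Ioo (y - δ) (y + δ) ⊆ Ioo 0 lam ∧
      ∀ᵐ z ∂volume.restrict (Ioo (y - δ) (y + δ)), u z = c := by
  have : ∃ w : ℝ → ℝ, w =ᵐ[volume.restrict (Ioo 0 lam)] u ∧ ContinuousAt w y := by
    by_contra h; exact hn ⟨hy, h⟩
  obtain ⟨w, hw, hc⟩ := this
  obtain ⟨δ₁, hδ₁, h1⟩ := Metric.isOpen_iff.1 (isOpen_Ioo (a := (0 : ℝ)) (b := lam)) y hy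
  obtain ⟨δ₂, hδ₂, h2⟩ := Metric.continuousAt_iff.1 hc (1 / 2) (by norm_num)
  have hs1 : Ioo (y - min δ₁ δ₂) (y + min δ₁ δ₂) ⊆ Ioo 0 lam := by
    rw [← Real.ball_eq_Ioo]
    exact (Metric.ball_subset_ball (min_le_left _ _)).trans h1
  have hpt : ∀ᵐ z ∂volume.restrict (Ioo (y - min δ₁ δ₂) (y + min δ₁ δ₂)),
      |u z - w y| < 1 / 2 ∧ (u z = 0 ∨ u z = 1) := by
    have h3 := ae_restrict_of_ae_restrict_of_subset hs1 (hw.and hu)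
    filter_upwards [h3, ae_restrict_mem measurableSet_Ioo] with z hz hm
    refine ⟨?_, hz.2⟩
    rw [← hz.1]
    rw [← Real.ball_eq_Ioo] at hm
    exact h2 (Metric.ball_subset_ball (min_le_right _ _) hm)
  by_cases hwy : w y < 1 / 2
  · refine ⟨0, Or.inl rfl, _, lt_min hδ₁ hδ₂, hs1, ?_⟩
    filter_upwards [hpt] with z hz
    rcases hz.2 with h | h
    · exact h
    · rw [h] at hz
      linarith [(abs_lt.1 hz.1).2]
  · refine ⟨1, Or.inr rfl, _, lt_min hδ₁ hδ₂, hs1, ?_⟩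
    filter_upwards [hpt] with z hz
    rcases hz.2 with h | h
    · rw [h] at hz
      linarith [(abs_lt.1 hz.1).1]
    · exact h

namespace SobolevH1

variable {lam : ℝ}

/-- The density of the interfacial part of the rescaled energy. -/
noncomputable def interfaceDensity (W : ℝ → ℝ) (ε : ℝ) (h : SobolevH1 lam) (y : ℝ) : ℝ :=
  ε / 2 * h.weakDeriv2 y ^ 2 + 1 / ε * evenEnergy W (h.weakDeriv y)

/-- The density of the foundation part of the rescaled energy. -/
noncomputable def foundationDensity (μ : ℝ) (h : SobolevH1 lam) (y : ℝ) : ℝ :=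
  μ / 2 * (h.weakDeriv y * (y - lam * h.toFun y) ^ 2)

theorem aestronglyMeasurable_toFun (h : SobolevH1 lam) :
    AEStronglyMeasurable h.toFun (volume.restrict (Ioo 0 lam)) := Lp.aestronglyMeasurable _

theorem aestronglyMeasurable_weakDeriv (h : SobolevH1 lam) :
    AEStronglyMeasurable h.weakDeriv (volume.restrict (Ioo 0 lam)) := Lp.aestronglyMeasurable _

theorem aestronglyMeasurable_foundationDensity (μ : ℝ) (h : SobolevH1 lam) :
    AEStronglyMeasurable (h.foundationDensity μ) (volume.restrict (Ioo 0 lam)) :=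
  (h.aestronglyMeasurable_weakDeriv.mul
    ((aestronglyMeasurable_id.sub (h.aestronglyMeasurable_toFun.const_mul lam)).pow 2)).const_mul _

theorem aestronglyMeasurable_evenEnergy {W : ℝ → ℝ} (hW : IsStoredEnergy W) (h : SobolevH1 lam) :
    AEStronglyMeasurable (fun y => evenEnergy W (h.weakDeriv y)) (volume.restrict (Ioo 0 lam)) :=
  hW.continuous_evenEnergy.comp_aestronglyMeasurable h.aestronglyMeasurable_weakDeriv

theorem foundationDensity_nonneg {μ : ℝ} (hμ : 0 ≤ μ) {h : SobolevH1 lam} {y : ℝ}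
    (hy : 0 ≤ h.weakDeriv y) : 0 ≤ h.foundationDensity μ y := by
  unfold foundationDensity; positivity

theorem interfaceDensity_nonneg {W : ℝ → ℝ} (hW : IsStoredEnergy W) {ε : ℝ} (hε : 0 < ε)
    (h : SobolevH1 lam) (y : ℝ) : 0 ≤ h.interfaceDensity W ε y := by
  have := hW.evenEnergy_nonneg (h.weakDeriv y)
  unfold interfaceDensity; positivity

end SobolevH1

open SobolevH1

theorem rescaledEnergy_eq {W : ℝ → ℝ} (hW : IsStoredEnergy W) {lam μ ε : ℝ} (hμ : 0 ≤ μ)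
    (hε : 0 < ε) {h : SobolevH1 lam} (h2 : h.MemH2)
    (hpos : ∀ᵐ y ∂volume.restrict (Ioo 0 lam), 0 < h.weakDeriv y) (hbc : h.BoundaryConditions) :
    rescaledEnergy W lam μ ε h = (∫⁻ y in Ioo 0 lam, ENNReal.ofReal (h.interfaceDensity W ε y)) +
      ∫⁻ y in Ioo 0 lam, ENNReal.ofReal (h.foundationDensity μ y) := by
  rw [rescaledEnergy, if_pos ⟨h2, hpos, hbc⟩, deformationEnergy,
    ← lintegral_const_mul' _ _ ENNReal.ofReal_ne_top, ← lintegral_add_right']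
  · refine lintegral_congr_ae ?_
    filter_upwards [hpos] with y hy
    rw [← ENNReal.ofReal_mul (by positivity), ← ENNReal.ofReal_add
      (interfaceDensity_nonneg hW hε h y) (foundationDensity_nonneg hμ hy.le)]
    congr 1
    rw [interfaceDensity, foundationDensity, evenEnergy_of_nonneg W hy.le]
    field_simp
  · exact (h.aestronglyMeasurable_foundationDensity μ).aemeasurable.ennreal_ofReal

theorem rescaledEnergy_lt_top_spec {W : ℝ → ℝ} {lam μ ε : ℝ} {h : SobolevH1 lam}
    (hE : rescaledEnergy W lam μ ε h ≠ ⊤) :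
    h.MemH2 ∧ (∀ᵐ y ∂volume.restrict (Ioo 0 lam), 0 < h.weakDeriv y) ∧ h.BoundaryConditions := by
  by_contra hn
  exact hE (by rw [rescaledEnergy, if_neg hn])

/-- Energy bounds force the derivative of the limit into the wells. -/
theorem ae_eq_zero_or_one_of_energy_le {W : ℝ → ℝ} (hW : IsStoredEnergy W) {lam : ℝ}
    {ε : ℕ → ℝ} (hε : ∀ n, 0 < ε n) (hε0 : Tendsto ε atTop (𝓝 0))
    {h : ℕ → SobolevH1 lam} {x : SobolevH1 lam} {B : ℝ}
    (hpos : ∀ n, ∀ᵐ y ∂volume.restrict (Ioo 0 lam), 0 < (h n).weakDeriv y)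
    (hB : ∀ n, ∫⁻ y in Ioo 0 lam, ENNReal.ofReal ((h n).interfaceDensity W (ε n) y) ≤
      ENNReal.ofReal B)
    (hv : ∀ᵐ y ∂volume.restrict (Ioo 0 lam),
      Tendsto (fun n => (h n).weakDeriv y) atTop (𝓝 (x.weakDeriv y))) :
    ∀ᵐ y ∂volume.restrict (Ioo 0 lam), x.weakDeriv y = 0 ∨ x.weakDeriv y = 1 := by
  have hmeas : ∀ z : SobolevH1 lam, AEMeasurable (fun y => ENNReal.ofReal
      (evenEnergy W (z.weakDeriv y))) (volume.restrict (Ioo 0 lam)) := fun z =>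
    (aestronglyMeasurable_evenEnergy hW z).aemeasurable.ennreal_ofReal
  have h1 : ∀ n, ∫⁻ y in Ioo 0 lam, ENNReal.ofReal (evenEnergy W ((h n).weakDeriv y)) ≤
      ENNReal.ofReal (ε n) * ENNReal.ofReal B := by
    intro n
    refine le_trans ?_ (mul_le_mul_right (hB n) _)
    rw [← lintegral_const_mul' _ _ ENNReal.ofReal_ne_top]
    refine lintegral_mono fun y => ?_
    rw [← ENNReal.ofReal_mul (hε n).le]
    apply ENNReal.ofReal_le_ofReal
    have := hε n
    have e : ε n * (h n).interfaceDensity W (ε n) y =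
        ε n ^ 2 / 2 * (h n).weakDeriv2 y ^ 2 + evenEnergy W ((h n).weakDeriv y) := by
      rw [interfaceDensity]; field_simp
    rw [e]
    have : 0 ≤ ε n ^ 2 / 2 * (h n).weakDeriv2 y ^ 2 := by positivity
    linarith
  have h2 : Tendsto (fun n => ENNReal.ofReal (ε n) * ENNReal.ofReal B) atTop (𝓝 0) := by
    have := ENNReal.Tendsto.mul_const (ENNReal.tendsto_ofReal hε0) (b := ENNReal.ofReal B)
      (Or.inr ENNReal.ofReal_ne_top)
    simpa using this
  have h3 : ∫⁻ y in Ioo 0 lam, ENNReal.ofReal (evenEnergy W (x.weakDeriv y)) = 0 := by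
    refine le_antisymm ?_ zero_le
    calc _ = ∫⁻ y in Ioo 0 lam, liminf (fun n => ENNReal.ofReal
            (evenEnergy W ((h n).weakDeriv y))) atTop := by
          refine lintegral_congr_ae ?_
          filter_upwards [hv] with y hy
          exact (ENNReal.tendsto_ofReal
            ((hW.continuous_evenEnergy.tendsto _).comp hy)).liminf_eq.symm
      _ ≤ liminf (fun n => ∫⁻ y in Ioo 0 lam, ENNReal.ofReal
            (evenEnergy W ((h n).weakDeriv y))) atTop := lintegral_liminf_le' fun n => hmeas _
      _ ≤ liminf (fun n => ENNReal.ofReal (ε n) * ENNReal.ofReal B) atTop :=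
          liminf_le_liminf (Eventually.of_forall h1)
      _ = 0 := h2.liminf_eq
  rw [lintegral_eq_zero_iff' (hmeas x)] at h3
  filter_upwards [h3, hv, ae_all_iff.2 hpos] with y hy hy2 hy3
  have h4 : 0 ≤ x.weakDeriv y := ge_of_tendsto hy2 (Eventually.of_forall fun n => (hy3 n).le)
  have h5 : evenEnergy W (x.weakDeriv y) = 0 :=
    le_antisymm (ENNReal.ofReal_eq_zero.1 hy) (hW.evenEnergy_nonneg _)
  exact hW.evenEnergy_eq_zero h4 h5

/-- The lower bound, localized at finitely many discontinuities. -/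
theorem card_mul_surfaceConstant_add_le {W : ℝ → ℝ} (hW : IsStoredEnergy W) {lam μ : ℝ}
    (hl : 0 < lam) (hμ : 0 ≤ μ) {ε : ℕ → ℝ} (hε : ∀ n, 0 < ε n)
    {h : ℕ → SobolevH1 lam} {x : SobolevH1 lam} {B : ℝ}
    (hB : ∀ n, rescaledEnergy W lam μ (ε n) (h n) ≤ ENNReal.ofReal B)
    (hu : ∀ᵐ y ∂volume.restrict (Ioo 0 lam),
      Tendsto (fun n => (h n).toFun y) atTop (𝓝 (x.toFun y)))
    (hv : ∀ᵐ y ∂volume.restrict (Ioo 0 lam),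
      Tendsto (fun n => (h n).weakDeriv y) atTop (𝓝 (x.weakDeriv y)))
    (hx : ∀ᵐ y ∂volume.restrict (Ioo 0 lam), x.weakDeriv y = 0 ∨ x.weakDeriv y = 1)
    (S : Finset ℝ) (hS : ∀ p ∈ S, p ∈ discontSet lam x.weakDeriv) :
    ENNReal.ofReal (surfaceConstant W * S.card) +
      ∫⁻ y in Ioo 0 lam, ENNReal.ofReal (x.foundationDensity μ y) ≤ ENNReal.ofReal B := by
  have hspec := fun n => rescaledEnergy_lt_top_spec
    (ne_top_of_le_ne_top ENNReal.ofReal_ne_top (hB n))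
  choose V hVac hVae hVd using fun n => (hspec n).1.exists_ac_rep hl
  obtain ⟨r, hr, hrsub, hrsep⟩ := exists_pos_ball_subset_pairwise_disjoint isOpen_Ioo S
    (fun p hp => (hS p hp).1)
  have hgood : ∀ᵐ y ∂volume.restrict (Ioo 0 lam), (x.weakDeriv y = 0 ∨ x.weakDeriv y = 1) ∧
      Tendsto (fun n => V n y) atTop (𝓝 (x.weakDeriv y)) := by
    filter_upwards [hx, hv, ae_all_iff.2 hVae] with y h1 h2 h3
    exact ⟨h1, by simpa only [h3] using h2⟩
  have hpick : ∀ p ∈ S, ∀ c : ℝ, ∃ a ∈ Ioo (p - r) (p + r), x.weakDeriv a ≠ c ∧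
      (x.weakDeriv a = 0 ∨ x.weakDeriv a = 1) ∧
      Tendsto (fun n => V n a) atTop (𝓝 (x.weakDeriv a)) := by
    intro p hp c
    by_contra! hcon
    refine notMem_discontSet_of_ae_const hr (c := c) ?_ (hS p hp)
    filter_upwards [ae_restrict_of_ae_restrict_of_subset (hrsub p hp) hgood,
      ae_restrict_mem measurableSet_Ioo] with y hy hm
    by_contra hne
    exact hcon y hm hne hy.1 hy.2
  have hpick0 : ∀ p ∈ S, ∃ a ∈ Ioo (p - r) (p + r), Tendsto (fun n => V n a) atTop (𝓝 0) := by
    intro p hp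
    obtain ⟨a, ha, h1, h2, h3⟩ := hpick p hp 1
    exact ⟨a, ha, by rwa [h2.resolve_right h1] at h3⟩
  have hpick1 : ∀ p ∈ S, ∃ a ∈ Ioo (p - r) (p + r), Tendsto (fun n => V n a) atTop (𝓝 1) := by
    intro p hp
    obtain ⟨a, ha, h1, h2, h3⟩ := hpick p hp 0
    exact ⟨a, ha, by rwa [h2.resolve_left h1] at h3⟩
  choose! a ha hat using hpick0
  choose! b hb hbt using hpick1
  have hdisj : Pairwise (Function.onFun Disjoint fun p : S => Ioo ((p : ℝ) - r) (p + r)) := by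
    intro p q hpq
    have h1 := hrsep p p.2 q q.2 (fun h => hpq (Subtype.ext h))
    rw [Function.onFun, Set.disjoint_left]
    rintro z ⟨h2, h3⟩ ⟨h4, h5⟩
    rcases abs_cases ((p : ℝ) - q) with ⟨h6, -⟩ | ⟨h6, -⟩ <;> linarith
  have hjump : ∀ n, ∀ p ∈ S,
      ENNReal.ofReal |phasePrimitive W (V n (b p)) - phasePrimitive W (V n (a p))| ≤
        ∫⁻ y in Ioo (p - r) (p + r), ENNReal.ofReal ((h n).interfaceDensity W (ε n) y) := by
    intro n p hp
    have key : ∀ s ∈ Ioo (p - r) (p + r), ∀ t ∈ Ioo (p - r) (p + r), s ≤ t →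
        ENNReal.ofReal |phasePrimitive W (V n t) - phasePrimitive W (V n s)| ≤
        ∫⁻ y in Ioo (p - r) (p + r), ENNReal.ofReal ((h n).interfaceDensity W (ε n) y) := by
      intro s hs t ht hst
      have hs' := hrsub p hp hs
      have ht' := hrsub p hp ht
      refine (hW.ofReal_abs_phasePrimitive_sub_le (hε n) (hVac n) (hVd n) hs'.1.le hst
        ht'.2.le).trans ?_
      calc _ = ∫⁻ y in Ioo s t, ENNReal.ofReal ((h n).interfaceDensity W (ε n) y) := by
            refine lintegral_congr_ae ?_
            filter_upwards [ae_restrict_Ioo_mono hs'.1.le ht'.2.le (hVae n)] with y hy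
            rw [interfaceDensity, hy]
        _ ≤ _ := lintegral_mono_set (Ioo_subset_Ioo hs.1.le ht.2.le)
    rcases le_total (a p) (b p) with hab | hab
    · exact key _ (ha p hp) _ (hb p hp) hab
    · rw [abs_sub_comm]; exact key _ (hb p hp) _ (ha p hp) hab
  have hsum : ∀ n, ∑ p ∈ S,
      ENNReal.ofReal |phasePrimitive W (V n (b p)) - phasePrimitive W (V n (a p))| +
      ∫⁻ y in Ioo 0 lam, ENNReal.ofReal ((h n).foundationDensity μ y) ≤ ENNReal.ofReal B := by
    intro n
    refine le_trans ?_ (hB n)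
    rw [rescaledEnergy_eq hW hμ (hε n) (hspec n).1 (hspec n).2.1 (hspec n).2.2]
    gcongr
    calc _ ≤ ∑ p ∈ S, ∫⁻ y in Ioo (p - r) (p + r),
            ENNReal.ofReal ((h n).interfaceDensity W (ε n) y) := Finset.sum_le_sum (hjump n)
      _ = ∫⁻ y in ⋃ p ∈ S, Ioo (p - r) (p + r),
            ENNReal.ofReal ((h n).interfaceDensity W (ε n) y) := by
          rw [lintegral_biUnion_finset]
          · intro p hp q hq hpq
            exact hdisj (i := ⟨p, hp⟩) (j := ⟨q, hq⟩) (fun h => hpq (congrArg Subtype.val h))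
          · exact fun _ _ => measurableSet_Ioo
      _ ≤ _ := lintegral_mono_set (iUnion₂_subset hrsub)
  have hlim1 : Tendsto (fun n => ∑ p ∈ S,
      ENNReal.ofReal |phasePrimitive W (V n (b p)) - phasePrimitive W (V n (a p))|) atTop
      (𝓝 (∑ p ∈ S, ENNReal.ofReal (surfaceConstant W))) := by
    refine tendsto_finsetSum _ fun p hp => ENNReal.tendsto_ofReal ?_
    have h1 := ((hW.continuous_phasePrimitive.tendsto _).comp (hbt p hp)).sub
      ((hW.continuous_phasePrimitive.tendsto _).comp (hat p hp))
    rw [phasePrimitive_one, phasePrimitive_zero, sub_zero] at h1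
    have h2 := h1.abs
    rwa [abs_of_pos hW.surfaceConstant_pos] at h2
  have hcard : ∑ p ∈ S, ENNReal.ofReal (surfaceConstant W) =
      ENNReal.ofReal (surfaceConstant W * S.card) := by
    rw [Finset.sum_const, nsmul_eq_mul, mul_comm, ENNReal.ofReal_mul hW.surfaceConstant_pos.le,
      ENNReal.ofReal_natCast]
  have hlim2 : ∫⁻ y in Ioo 0 lam, ENNReal.ofReal (x.foundationDensity μ y) ≤
      liminf (fun n => ∫⁻ y in Ioo 0 lam, ENNReal.ofReal ((h n).foundationDensity μ y)) atTop := by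
    calc _ = ∫⁻ y in Ioo 0 lam, liminf (fun n => ENNReal.ofReal
            ((h n).foundationDensity μ y)) atTop := by
          refine lintegral_congr_ae ?_
          filter_upwards [hu, hv] with y h1 h2
          refine (Tendsto.liminf_eq (ENNReal.tendsto_ofReal ?_)).symm
          exact (h2.mul ((tendsto_const_nhds.sub (h1.const_mul lam)).pow 2)).const_mul _
      _ ≤ _ := lintegral_liminf_le' fun n =>
          ((h n).aestronglyMeasurable_foundationDensity μ).aemeasurable.ennreal_ofReal
  have hle : ∑ p ∈ S, ENNReal.ofReal (surfaceConstant W) ≤ ENNReal.ofReal B :=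
    le_of_tendsto hlim1 (Eventually.of_forall fun n => le_self_add.trans (hsum n))
  have hlim3 := ENNReal.Tendsto.sub (tendsto_const_nhds (x := ENNReal.ofReal B)) hlim1
    (Or.inl ENNReal.ofReal_ne_top)
  have hfin : ∫⁻ y in Ioo 0 lam, ENNReal.ofReal (x.foundationDensity μ y) ≤
      ENNReal.ofReal B - ∑ p ∈ S, ENNReal.ofReal (surfaceConstant W) := by
    refine hlim2.trans ?_
    rw [← hlim3.liminf_eq]
    refine liminf_le_liminf (Eventually.of_forall fun n => ?_)
    exact ENNReal.le_sub_of_add_le_left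
      (ENNReal.sum_ne_top.2 fun p _ => ENNReal.ofReal_ne_top) (hsum n)
  rw [← hcard]
  exact (add_le_add_right hfin _).trans (add_tsub_cancel_of_le hle).le

theorem memPC1_of_finite_discontSet {lam : ℝ} (hl : 0 < lam) {x : SobolevH1 lam}
    (hx : ∀ᵐ y ∂volume.restrict (Ioo 0 lam), x.weakDeriv y = 0 ∨ x.weakDeriv y = 1)
    (hbc : x.BoundaryConditions) (hfin : (discontSet lam x.weakDeriv).Finite) : x.MemPC1 := by
  obtain ⟨g, hg, -, -⟩ := hbc
  refine ⟨g, hg, hfin.toFinset, fun y hy hn => ?_⟩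
  rw [Set.Finite.mem_toFinset] at hn
  obtain ⟨c, -, δ, hδ, hsub, hc⟩ := exists_ae_const_of_notMem_discontSet hx hy hn
  have hym : y ∈ Ioo (y - δ) (y + δ) := ⟨by linarith, by linarith⟩
  have hlin : ∀ z ∈ Ioo (y - δ) (y + δ), g z = g y + c * (z - y) := by
    intro z hz
    have hzl := hsub hz
    have hi := x.weakDeriv_intervalIntegrable hl.le
    have h1 := hg.eqOn_primitive hl z (Ioo_subset_Icc_self hzl)
    have h2 := hg.eqOn_primitive hl y (Ioo_subset_Icc_self hy)
    have hiz : ∀ s ∈ Ioo 0 lam, IntervalIntegrable x.weakDeriv volume 0 s := fun s hs =>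
      hi.mono_set (by
        rw [uIcc_of_le hs.1.le, uIcc_of_le hl.le]; exact Icc_subset_Icc le_rfl hs.2.le)
    have h3 : ∫ t in y..z, x.weakDeriv t = ∫ _ in y..z, c := by
      apply intervalIntegral.integral_congr_ae
      filter_upwards [(ae_restrict_iff' measurableSet_Ioo).1 hc] with t ht hm
      exact ht (ordConnected_Ioo.uIcc_subset hym hz (uIoc_subset_uIcc hm))
    rw [← intervalIntegral.integral_interval_sub_left (hiz z hzl) (hiz y hy),
      intervalIntegral.integral_const, smul_eq_mul] at h3
    linarith
  refine ⟨c, ?_⟩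
  filter_upwards [Ioo_mem_nhds hym.1 hym.2] with z hz
  have h4 : HasDerivAt (fun z => g y + c * (z - y)) c z := by
    simpa using (((hasDerivAt_id z).sub_const y).const_mul c).const_add (g y)
  refine h4.congr_of_eventuallyEq ?_
  filter_upwards [Ioo_mem_nhds hz.1 hz.2] with t ht
  exact hlin t ht

theorem SobolevH1.MemPC1.finite_discontSet {lam : ℝ} (hl : 0 < lam) {x : SobolevH1 lam}
    (hx : x.MemPC1) : (discontSet lam x.weakDeriv).Finite := by
  obtain ⟨g, hg, S, hS⟩ := hx
  refine S.finite_toSet.subset fun y hy => ?_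
  by_contra hyS
  obtain ⟨c, hc⟩ := hS y hy.1 hyS
  obtain ⟨δ, hδ, hball⟩ := Metric.eventually_nhds_iff_ball.1
    (hc.and (isOpen_Ioo.mem_nhds hy.1))
  rw [Real.ball_eq_Ioo] at hball
  refine notMem_discontSet_of_ae_const hδ (c := c) ?_ hy
  have h1 := (ae_deriv_primitive hl.le x.weakDeriv_integrableOn (g 0)).2
  filter_upwards [ae_restrict_of_ae_restrict_of_subset (fun z hz => (hball z hz).2) h1,
    ae_restrict_mem measurableSet_Ioo] with z hz hm
  refine hz.unique ((hball z hm).1.congr_of_eventuallyEq ?_)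
  filter_upwards [isOpen_Ioo.mem_nhds (hball z hm).2] with t ht
  exact (hg.eqOn_primitive hl t (Ioo_subset_Icc_self ht)).symm

theorem isSharp_and_sharpEnergy_le {W : ℝ → ℝ} (hW : IsStoredEnergy W) {lam μ : ℝ}
    (hl : 0 < lam) (hμ : 0 ≤ μ) {ε : ℕ → ℝ} (hε : ∀ n, 0 < ε n) (hε0 : Tendsto ε atTop (𝓝 0))
    {h : ℕ → SobolevH1 lam} {x : SobolevH1 lam} (hx : Tendsto h atTop (𝓝 x)) {B : ℝ}
    (hB : ∀ n, rescaledEnergy W lam μ (ε n) (h n) ≤ ENNReal.ofReal B) :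
    IsSharp x ∧ sharpEnergy W lam μ x ≤ ENNReal.ofReal B := by
  obtain ⟨φ, hφ, hu, hv⟩ := exists_subseq_ae hx
  have hspec := fun n => rescaledEnergy_lt_top_spec
    (ne_top_of_le_ne_top ENNReal.ofReal_ne_top (hB n))
  have hvx : ∀ᵐ y ∂volume.restrict (Ioo 0 lam), x.weakDeriv y = 0 ∨ x.weakDeriv y = 1 := by
    refine ae_eq_zero_or_one_of_energy_le hW (fun n => hε (φ n)) (hε0.comp hφ.tendsto_atTop)
      (h := fun n => h (φ n)) (B := B) (fun n => (hspec (φ n)).2.1) (fun n => ?_) hv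
    refine le_trans ?_ (hB (φ n))
    rw [rescaledEnergy_eq hW hμ (hε _) (hspec _).1 (hspec _).2.1 (hspec _).2.2]
    exact le_self_add
  have hcount := card_mul_surfaceConstant_add_le hW hl hμ (fun n => hε (φ n))
    (h := fun n => h (φ n)) (fun n => hB (φ n)) hu hv hvx
  have hbc : x.BoundaryConditions := by
    have hbcn := fun n => (boundaryConditions_iff hl (h n)).1 (hspec n).2.2
    refine (boundaryConditions_iff hl x).2 ⟨?_, ?_⟩
    · filter_upwards [hu, ae_all_iff.2 fun n => (hbcn n).1, ae_restrict_mem measurableSet_Ioo]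
        with y h1 h2 hm
      refine tendsto_nhds_unique h1 ?_
      simp only [h2]
      exact (tendsto_primitive hx (Ioo_subset_Icc_self hm)).comp hφ.tendsto_atTop
    · refine tendsto_nhds_unique (tendsto_primitive hx (right_mem_Icc.2 hl.le)) ?_
      simp only [(hbcn _).2]
      exact tendsto_const_nhds
  have hfin : (discontSet lam x.weakDeriv).Finite := by
    by_contra hinf
    obtain ⟨N, hN⟩ := exists_nat_gt (max B 0 / surfaceConstant W)
    obtain ⟨S, hS, hcard⟩ := Set.Infinite.exists_subset_card_eq hinf N
    have h1 := le_self_add.trans (hcount S fun p hp => hS hp)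
    rw [hcard] at h1
    have h2 := hW.surfaceConstant_pos
    rw [div_lt_iff₀ h2] at hN
    have h3 : 0 < surfaceConstant W * N := by
      have := le_max_right B 0
      linarith
    have h4 := (ENNReal.ofReal_le_ofReal_iff' (p := surfaceConstant W * N) (q := B)).1 h1
    rcases h4 with h4 | h4
    · linarith [le_max_left B 0]
    · linarith
  have hsharp : IsSharp x := ⟨memPC1_of_finite_discontSet hl hvx hbc hfin, hvx, hbc⟩
  refine ⟨hsharp, ?_⟩
  have h1 := hcount hfin.toFinset fun p hp => hfin.mem_toFinset.1 hp
  rw [← ncard_eq_toFinset_card _ hfin] at h1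
  rw [sharpEnergy, if_pos hsharp]
  refine ENNReal.ofReal_add_le.trans (le_trans ?_ h1)
  gcongr
  rw [← integral_const_mul]
  change ENNReal.ofReal (∫ y in Ioo 0 lam, x.foundationDensity μ y) ≤ _
  rw [integral_eq_lintegral_of_nonneg_ae ?_ (x.aestronglyMeasurable_foundationDensity μ)]
  · exact ENNReal.ofReal_toReal_le
  · filter_upwards [hvx] with y hy
    refine foundationDensity_nonneg hμ ?_
    rcases hy with hy | hy <;> simp [hy]

theorem sharpEnergy_le_liminf {W : ℝ → ℝ} (hW : IsStoredEnergy W) {lam μ : ℝ}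
    (hl : 0 < lam) (hμ : 0 ≤ μ) {ε : ℕ → ℝ} (hε : ∀ n, 0 < ε n) (hε0 : Tendsto ε atTop (𝓝 0))
    {h : ℕ → SobolevH1 lam} {x : SobolevH1 lam} (hx : Tendsto h atTop (𝓝 x)) :
    sharpEnergy W lam μ x ≤ liminf (fun n => rescaledEnergy W lam μ (ε n) (h n)) atTop := by
  refine le_of_forall_gt_imp_ge_of_dense fun b hb => ?_
  rcases eq_or_ne b ⊤ with rfl | hbt
  · exact le_top
  obtain ⟨φ, hφ, h1⟩ := extraction_of_frequently_atTop (frequently_lt_of_liminf_lt (by isBoundedDefault) hb)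
  rw [← ENNReal.ofReal_toReal hbt]
  refine (isSharp_and_sharpEnergy_le hW hl hμ (fun n => hε (φ n)) (hε0.comp hφ.tendsto_atTop)
    (hx.comp hφ.tendsto_atTop) (fun n => ?_)).2
  rw [ENNReal.ofReal_toReal hbt]
  exact (h1 n).le

/-- A Helly type selection principle for functions controlled by bounded monotone functions. -/
theorem exists_subseq_ae_tendsto_of_control {lam K : ℝ} {f e : ℕ → ℝ → ℝ}
    (hmono : ∀ n, Monotone (e n)) (he : ∀ n y, e n y ∈ Icc 0 K)
    (hf : ∀ n, ∀ y ∈ Ioo 0 lam, f n y ∈ Icc (-K) K)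
    (hfe : ∀ n, ∀ a ∈ Ioo 0 lam, ∀ b ∈ Ioo 0 lam, a ≤ b → |f n b - f n a| ≤ e n b - e n a) :
    ∃ φ : ℕ → ℕ, StrictMono φ ∧ ∀ᵐ y ∂volume.restrict (Ioo 0 lam),
      ∃ l, Tendsto (fun n => f (φ n) y) atTop (𝓝 l) := by
  classical
  set g : ℕ → ℚ → ℝ × ℝ := fun n q => (e n q, if (q : ℝ) ∈ Ioo 0 lam then f n q else 0) with hg
  have hK : 0 ≤ K := (he 0 0).1.trans (he 0 0).2
  have hcomp : IsCompact (Set.pi univ fun _ : ℚ => Icc (0 : ℝ) K ×ˢ Icc (-K) K) :=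
    isCompact_univ_pi fun _ => isCompact_Icc.prod isCompact_Icc
  obtain ⟨G, -, φ, hφ, hG⟩ := hcomp.tendsto_subseq (x := g) (fun n q _ => by
    refine ⟨he n q, ?_⟩
    by_cases hq : (q : ℝ) ∈ Ioo 0 lam
    · simpa only [hg, if_pos hq] using hf n q hq
    · simp only [hg, if_neg hq]
      exact ⟨by linarith, hK⟩)
  rw [tendsto_pi_nhds] at hG
  have hGe : ∀ q : ℚ, Tendsto (fun n => e (φ n) q) atTop (𝓝 (G q).1) := fun q =>
    (continuous_fst.tendsto _).comp (hG q)
  have hGf : ∀ q : ℚ, (q : ℝ) ∈ Ioo 0 lam → Tendsto (fun n => f (φ n) q) atTop (𝓝 (G q).2) := by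
    intro q hq
    have := (continuous_snd.tendsto _).comp (hG q)
    simpa only [hg, Function.comp_def, if_pos hq] using this
  set E : ℝ → ℝ≥0∞ := fun y => limsup (fun n => ENNReal.ofReal (e (φ n) y)) atTop with hE
  have hEmono : Monotone E := fun a b hab => limsup_le_limsup
    (Eventually.of_forall fun n => ENNReal.ofReal_le_ofReal (hmono _ hab))
  have hEK : ∀ y, E y ≤ ENNReal.ofReal K := by
    intro y
    refine (limsup_le_limsup (v := fun _ : ℕ => ENNReal.ofReal K)
      (Eventually.of_forall fun n => ENNReal.ofReal_le_ofReal (he _ y).2)).trans (by simp)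
  have hEt : ∀ y, E y ≠ ⊤ := fun y => ne_top_of_le_ne_top ENNReal.ofReal_ne_top (hEK y)
  set F : ℝ → ℝ := fun y => (E y).toReal with hF
  have hFmono : Monotone F := fun a b hab => ENNReal.toReal_mono (hEt b) (hEmono hab)
  have hFq : ∀ q : ℚ, Tendsto (fun n => e (φ n) q) atTop (𝓝 (F q)) := by
    intro q
    have h1 : E q = ENNReal.ofReal (G q).1 := (ENNReal.tendsto_ofReal (hGe q)).limsup_eq
    have h2 : F q = (G q).1 := by
      rw [hF]
      simp only [h1]
      exact ENNReal.toReal_ofReal (ge_of_tendsto (hGe q) (Eventually.of_forall fun n => (he _ _).1))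
    rw [h2]
    exact hGe q
  refine ⟨φ, hφ, ?_⟩
  have hae : ∀ᵐ y ∂volume.restrict (Ioo 0 lam), ContinuousAt F y :=
    ae_restrict_of_ae (hFmono.countable_not_continuousAt.ae_notMem volume |>.mono fun y hy => by
      simpa using hy)
  filter_upwards [hae, ae_restrict_mem measurableSet_Ioo] with y hc hm
  refine cauchySeq_tendsto_of_complete (Metric.cauchySeq_iff'.2 fun δ hδ => ?_)
  have hnear : ∀ᶠ z in 𝓝 y, z ∈ Ioo 0 lam ∧ |F z - F y| < δ / 16 := by
    have h1 := hc.eventually (Metric.ball_mem_nhds (F y) (by positivity : 0 < δ / 16))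
    filter_upwards [h1, isOpen_Ioo.mem_nhds hm] with z hz hz'
    exact ⟨hz', hz⟩
  obtain ⟨r, hr, hball⟩ := Metric.eventually_nhds_iff_ball.1 hnear
  rw [Real.ball_eq_Ioo] at hball
  obtain ⟨q, hq1, hq2⟩ := exists_rat_btwn (by linarith : y - r < y)
  obtain ⟨q', hq'1, hq'2⟩ := exists_rat_btwn (by linarith : y < y + r)
  obtain ⟨hqm, hqF⟩ := hball q ⟨hq1, by linarith⟩
  obtain ⟨hq'm, hq'F⟩ := hball q' ⟨by linarith, hq'2⟩
  have ev1 := (hFq q).eventually (Metric.ball_mem_nhds _ (by positivity : 0 < δ / 16))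
  have ev2 := (hFq q').eventually (Metric.ball_mem_nhds _ (by positivity : 0 < δ / 16))
  have ev3 := (hGf q hqm).eventually (Metric.ball_mem_nhds _ (by positivity : 0 < δ / 16))
  obtain ⟨N, hN⟩ := eventually_atTop.1 (ev1.and (ev2.and ev3))
  have hclose : ∀ n ≥ N, |f (φ n) y - (G q).2| < δ / 2 := by
    intro n hn
    obtain ⟨h1, h2, h3⟩ := hN n hn
    have h4 := hfe (φ n) q hqm y hm hq2.le
    have h5 := hmono (φ n) hq'1.le
    rw [Real.dist_eq, abs_lt] at h1 h2 h3
    rw [abs_lt] at hqF hq'F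
    rw [abs_le] at h4
    rw [abs_lt]
    constructor <;> linarith
  refine ⟨N, fun n hn => ?_⟩
  have h1 := abs_lt.1 (hclose n hn)
  have h2 := abs_lt.1 (hclose N le_rfl)
  rw [Real.dist_eq, abs_lt]
  constructor <;> linarith

namespace IsStoredEnergy

theorem tendsto_of_tendsto_phasePrimitive {W : ℝ → ℝ} (hW : IsStoredEnergy W) {s : ℕ → ℝ} {R l : ℝ}
    (hs : ∀ n, s n ∈ Icc 0 R)
    (h : Tendsto (fun n => phasePrimitive W (s n)) atTop (𝓝 l)) :
    ∃ t, Tendsto s atTop (𝓝 t) := by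
  have hcl : IsClosed (phasePrimitive W '' Icc 0 R) :=
    (isCompact_Icc.image hW.continuous_phasePrimitive).isClosed
  obtain ⟨t, ht, rfl⟩ := hcl.mem_of_tendsto h
    (Eventually.of_forall fun n => mem_image_of_mem _ (hs n))
  refine ⟨t, tendsto_order.2 ⟨fun a ha => ?_, fun b hb => ?_⟩⟩
  · rcases lt_or_ge a 0 with h0 | h0
    · exact Eventually.of_forall fun n => h0.trans_le (hs n).1
    · filter_upwards [h.eventually (lt_mem_nhds (hW.strictMonoOn_phasePrimitive h0 ht.1 ha))]
        with n hn
      exact hW.monotone_phasePrimitive.reflect_lt hn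
  · filter_upwards [h.eventually (gt_mem_nhds (hW.strictMonoOn_phasePrimitive ht.1
      (ht.1.trans hb.le) hb))] with n hn
    exact hW.monotone_phasePrimitive.reflect_lt hn

end IsStoredEnergy

/-- Sequences of bounded energy have `H¹`-convergent subsequences. -/
theorem exists_subseq_tendsto_of_energy_le {W : ℝ → ℝ} (hW : IsStoredEnergy W) {lam μ : ℝ}
    (hl : 0 < lam) (hμ : 0 ≤ μ) {ε : ℕ → ℝ} (hε : ∀ n, 0 < ε n) {h : ℕ → SobolevH1 lam} {B : ℝ}
    (hB : ∀ n, rescaledEnergy W lam μ (ε n) (h n) ≤ ENNReal.ofReal B) :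
    ∃ φ : ℕ → ℕ, StrictMono φ ∧ ∃ x, Tendsto (h ∘ φ) atTop (𝓝 x) := by
  have hspec := fun n => rescaledEnergy_lt_top_spec
    (ne_top_of_le_ne_top ENNReal.ofReal_ne_top (hB n))
  have hbcn := fun n => (boundaryConditions_iff hl (h n)).1 (hspec n).2.2
  choose V hVac hVae hVd using fun n => (hspec n).1.exists_ac_rep hl
  set ρ : ℕ → ℝ → ℝ≥0∞ := fun n y =>
    ENNReal.ofReal (ε n / 2 * (h n).weakDeriv2 y ^ 2 + 1 / ε n * evenEnergy W (V n y)) with hρ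
  have hρB : ∀ n, ∫⁻ y in Ioo 0 lam, ρ n y ≤ ENNReal.ofReal B := by
    intro n
    refine le_trans (le_of_eq_of_le ?_ le_self_add)
      ((rescaledEnergy_eq hW hμ (hε n) (hspec n).1 (hspec n).2.1 (hspec n).2.2).symm.le.trans (hB n))
    refine lintegral_congr_ae ?_
    filter_upwards [hVae n] with y hy
    simp only [hρ, interfaceDensity, hy]
  set e : ℕ → ℝ → ℝ := fun n y => (∫⁻ z in Ioo 0 lam ∩ Iio y, ρ n z).toReal with he
  have hEB : ∀ n y, ∫⁻ z in Ioo 0 lam ∩ Iio y, ρ n z ≤ ENNReal.ofReal B := fun n y =>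
    (lintegral_mono_set inter_subset_left).trans (hρB n)
  have hEt : ∀ n y, ∫⁻ z in Ioo 0 lam ∩ Iio y, ρ n z ≠ ⊤ := fun n y =>
    ne_top_of_le_ne_top ENNReal.ofReal_ne_top (hEB n y)
  have hemono : ∀ n, Monotone (e n) := fun n a b hab =>
    ENNReal.toReal_mono (hEt n b)
      (lintegral_mono_set (inter_subset_inter_right _ (Iio_subset_Iio hab)))
  set K₀ := (ENNReal.ofReal B).toReal with hK₀
  have heK : ∀ n y, e n y ∈ Icc 0 K₀ := fun n y =>
    ⟨ENNReal.toReal_nonneg, ENNReal.toReal_mono ENNReal.ofReal_ne_top (hEB n y)⟩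
  set f : ℕ → ℝ → ℝ := fun n y => phasePrimitive W (V n y) with hf
  have hfe : ∀ n, ∀ a ∈ Ioo 0 lam, ∀ b ∈ Ioo 0 lam, a ≤ b → |f n b - f n a| ≤ e n b - e n a := by
    intro n a ha b hb hab
    have h1 := hW.ofReal_abs_phasePrimitive_sub_le (hε n) (hVac n) (hVd n) ha.1.le hab hb.2.le
    have h2 : (∫⁻ z in Ioo 0 lam ∩ Iio a, ρ n z) + ∫⁻ z in Ioo a b, ρ n z ≤
        ∫⁻ z in Ioo 0 lam ∩ Iio b, ρ n z := by
      rw [← lintegral_union measurableSet_Ioo]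
      · refine lintegral_mono_set (union_subset
          (inter_subset_inter_right _ (Iio_subset_Iio hab)) fun z hz => ?_)
        exact ⟨⟨ha.1.trans hz.1, hz.2.trans hb.2⟩, hz.2⟩
      · rw [Set.disjoint_left]
        rintro z ⟨-, hz⟩ ⟨hz', -⟩
        exact lt_asymm hz hz'
    have h3 : ENNReal.ofReal (|f n b - f n a| + e n a) ≤ ENNReal.ofReal (e n b) := by
      rw [ENNReal.ofReal_add (abs_nonneg _) ENNReal.toReal_nonneg, ENNReal.ofReal_toReal (hEt n a),
        ENNReal.ofReal_toReal (hEt n b), add_comm]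
      exact (add_le_add_right h1 _).trans h2
    rw [ENNReal.ofReal_le_ofReal_iff ENNReal.toReal_nonneg] at h3
    linarith
  have hosc : ∀ n, ∀ a ∈ Ioo 0 lam, ∀ b ∈ Ioo 0 lam, |f n b - f n a| ≤ K₀ := by
    intro n a ha b hb
    rcases le_total a b with hab | hab
    · linarith [hfe n a ha b hb hab, (heK n b).2, (heK n a).1]
    · rw [abs_sub_comm]
      linarith [hfe n b hb a ha hab, (heK n a).2, (heK n b).1]
  have hlow : ∀ n, ∃ y ∈ Ioo 0 lam, V n y ≤ 1 / lam := by
    intro n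
    have hi : IntegrableOn (V n) (Ioo 0 lam) :=
      (h n).weakDeriv_integrableOn.congr (hVae n).symm
    obtain ⟨y, hy, hle⟩ := exists_le_setAverage (μ := volume) (s := Ioo 0 lam) (by simp [hl])
      (by simp) hi
    refine ⟨y, hy, hle.trans_eq ?_⟩
    rw [setAverage_eq, integral_congr_ae (hVae n), setIntegral_Ioo_eq_intervalIntegral hl.le,
      (hbcn n).2]
    simp [measureReal_def, hl.le]
  have hhigh : ∀ n, ∃ y ∈ Ioo 0 lam, 0 ≤ V n y := by
    intro n
    have : (ae (volume.restrict (Ioo 0 lam))).NeBot := by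
      rw [ae_neBot]; simp [Measure.restrict_eq_zero, hl]
    obtain ⟨y, ⟨h1, h2⟩, h3⟩ :=
      (((hVae n).and (hspec n).2.1).and (ae_restrict_mem measurableSet_Ioo)).exists
    exact ⟨y, h3, by rw [h1]; exact h2.le⟩
  have hfup : ∀ n, ∀ y ∈ Ioo 0 lam, f n y ≤ K₀ + phasePrimitive W (1 / lam) := by
    intro n y hy
    obtain ⟨y₀, hy₀, h1⟩ := hlow n
    have h2 := (abs_le.1 (hosc n y₀ hy₀ y hy)).2
    have h3 := hW.monotone_phasePrimitive h1
    simp only [hf] at h2 ⊢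
    linarith
  have hflow : ∀ n, ∀ y ∈ Ioo 0 lam, -K₀ ≤ f n y := by
    intro n y hy
    obtain ⟨y₀, hy₀, h1⟩ := hhigh n
    have h2 := (abs_le.1 (hosc n y₀ hy₀ y hy)).1
    have h3 := hW.monotone_phasePrimitive h1
    rw [phasePrimitive_zero] at h3
    simp only [hf] at h2 ⊢
    linarith
  have hΦ : 0 ≤ phasePrimitive W (1 / lam) := by
    rw [← phasePrimitive_zero W]
    exact hW.monotone_phasePrimitive (by positivity)
  set K := K₀ + phasePrimitive W (1 / lam) with hK
  obtain ⟨φ, hφ, hconv⟩ := exists_subseq_ae_tendsto_of_control (lam := lam) (K := K) (f := f) (e := e)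
    hemono (fun n y => ⟨(heK n y).1, by linarith [(heK n y).2]⟩)
    (fun n y hy => ⟨by linarith [hflow n y hy], hfup n y hy⟩) hfe
  obtain ⟨R, hR⟩ := (hW.tendsto_phasePrimitive.eventually (eventually_gt_atTop K)).exists
  have hbound : ∀ᵐ y ∂volume.restrict (Ioo 0 lam), ∀ n,
      V n y = (h n).weakDeriv y ∧ (h n).weakDeriv y ∈ Icc 0 R := by
    filter_upwards [ae_all_iff.2 hVae, ae_all_iff.2 fun n => (hspec n).2.1,
      ae_restrict_mem measurableSet_Ioo] with y h1 h2 hm n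
    refine ⟨h1 n, (h2 n).le, ?_⟩
    rw [← h1 n]
    exact (hW.monotone_phasePrimitive.reflect_lt ((hfup n y hm).trans_lt hR)).le
  have hconvV : ∀ᵐ y ∂volume.restrict (Ioo 0 lam),
      ∃ t, Tendsto (fun n => (h (φ n)).weakDeriv y) atTop (𝓝 t) := by
    filter_upwards [hconv, hbound] with y ⟨l, hl'⟩ h2
    refine hW.tendsto_of_tendsto_phasePrimitive (R := R) (l := l) (fun n => (h2 (φ n)).2) ?_
    simpa only [hf, (h2 _).1] using hl'
  set v : ℝ → ℝ := fun y => limUnder atTop fun n => (h (φ n)).weakDeriv y with hv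
  have hvlim : ∀ᵐ y ∂volume.restrict (Ioo 0 lam),
      Tendsto (fun n => (h (φ n)).weakDeriv y) atTop (𝓝 (v y)) :=
    hconvV.mono fun y hy => tendsto_nhds_limUnder hy
  have hvm : AEStronglyMeasurable v (volume.restrict (Ioo 0 lam)) :=
    aestronglyMeasurable_of_tendsto_ae atTop
      (fun n => (h (φ n)).aestronglyMeasurable_weakDeriv) hvlim
  have hvb : ∀ᵐ y ∂volume.restrict (Ioo 0 lam), ‖v y‖ ≤ R := by
    filter_upwards [hvlim, hbound] with y h1 h2
    refine le_of_tendsto h1.norm (Eventually.of_forall fun n => ?_)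
    rw [Real.norm_eq_abs, abs_of_nonneg (h2 (φ n)).2.1]
    exact (h2 (φ n)).2.2
  obtain ⟨x, hx1, hx2⟩ := SobolevH1.exists_of_deriv hl (MemLp.of_bound hvm R hvb)
  refine ⟨φ, hφ, x, ?_⟩
  refine tendsto_of_bounded_ae hl (R := R) (fun n => (hbcn (φ n)).1) ?_ (fun n => ?_) ?_
  · filter_upwards [hx1, ae_restrict_mem measurableSet_Ioo] with y hy hm
    rw [hy]
    refine intervalIntegral_congr_ae_Ioo hm.1.le ?_
    exact (ae_restrict_Ioo_mono le_rfl hm.2.le hx2).mono fun t ht => ht.symm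
  · filter_upwards [hbound] with y hy
    rw [Function.comp, abs_of_nonneg (hy (φ n)).2.1]
    exact (hy (φ n)).2.2
  · filter_upwards [hvlim, hx2] with y h1 h2
    rw [h2]; exact h1

/-- An autonomous equation `q' = κ(q)` with `κ` continuous and bounded between positive constants
has a global increasing solution. -/
theorem exists_strictMono_hasDerivAt {κ : ℝ → ℝ} (hκ : Continuous κ) {m M : ℝ} (hm : 0 < m)
    (hmκ : ∀ s, m ≤ κ s) (hκM : ∀ s, κ s ≤ M) :
    ∃ q : ℝ → ℝ, StrictMono q ∧ q 0 = 0 ∧ (∀ t, HasDerivAt q (κ (q t)) t) ∧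
      Function.Surjective q := by
  have hκ0 : ∀ s, 0 < κ s := fun s => hm.trans_le (hmκ s)
  have hM : 0 < M := (hκ0 0).trans_le (hκM 0)
  have hic : Continuous fun s => (κ s)⁻¹ := hκ.inv₀ fun s => (hκ0 s).ne'
  set τ : ℝ → ℝ := fun s => ∫ t in (0 : ℝ)..s, (κ t)⁻¹ with hτ
  have hτd : ∀ s, HasDerivAt τ (κ s)⁻¹ s := fun s =>
    intervalIntegral.integral_hasDerivAt_right (hic.intervalIntegrable _ _)
      (hic.stronglyMeasurableAtFilter _ _) hic.continuousAt
  have hτc : Continuous τ := continuous_iff_continuousAt.2 fun s => (hτd s).continuousAt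
  have hτm : StrictMono τ := strictMono_of_deriv_pos fun s => by
    rw [(hτd s).deriv]; exact inv_pos.2 (hκ0 s)
  have hτ0 : τ 0 = 0 := by simp [hτ]
  have hlow : ∀ s, 0 ≤ s → s * M⁻¹ ≤ τ s := by
    intro s hs
    have := intervalIntegral.integral_mono_on hs (intervalIntegrable_const (μ := volume) (c := M⁻¹))
      (hic.intervalIntegrable 0 s) (fun t _ => inv_anti₀ (hκ0 t) (hκM t))
    simpa using this
  have hup : ∀ s, s ≤ 0 → τ s ≤ s * M⁻¹ := by
    intro s hs
    have := intervalIntegral.integral_mono_on hs (intervalIntegrable_const (μ := volume) (c := M⁻¹))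
      (hic.intervalIntegrable s 0) (fun t _ => inv_anti₀ (hκ0 t) (hκM t))
    rw [intervalIntegral.integral_const, smul_eq_mul, intervalIntegral.integral_symm] at this
    simp only [hτ]
    linarith
  have hMi : 0 < M⁻¹ := inv_pos.2 hM
  have htop : Tendsto τ atTop atTop :=
    tendsto_atTop_mono' _ ((eventually_ge_atTop 0).mono hlow) (tendsto_id.atTop_mul_const hMi)
  have hbot : Tendsto τ atBot atBot :=
    tendsto_atBot_mono' _ ((eventually_le_atBot 0).mono hup) (tendsto_id.atBot_mul_const hMi)
  have hsurj : Function.Surjective τ := hτc.surjective htop hbot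
  set o := hτm.orderIsoOfSurjective τ hsurj with ho
  have ho1 : ∀ s, o s = τ s := fun s => rfl
  refine ⟨o.symm, o.symm.strictMono, ?_, fun t => ?_, o.symm.surjective⟩
  · rw [OrderIso.symm_apply_eq, ho1, hτ0]
  · have h1 := (hτd (o.symm t)).of_local_left_inverse (g := o.symm)
      o.symm.continuous.continuousAt (inv_ne_zero (hκ0 _).ne')
      (Eventually.of_forall fun s => o.apply_symm_apply s)
    rwa [inv_inv] at h1

/-- A transition profile between the wells with nearly optimal energy. -/
structure IsProfile (W : ℝ → ℝ) (E T : ℝ) (P : ℝ → ℝ) : Prop where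
  T_pos : 0 < T
  lipschitz : ∃ K, LipschitzWith K P
  mem : ∀ t, P t ∈ Icc 0 1
  eq_zero : ∀ t, t ≤ 0 → P t = 0
  eq_one : ∀ t, T ≤ t → P t = 1
  energy : ∫ t in (0 : ℝ)..T, (1 / 2 * deriv P t ^ 2 + evenEnergy W (P t)) ≤ E

theorem IsStoredEnergy.exists_isProfile {W : ℝ → ℝ} (hW : IsStoredEnergy W) {θ : ℝ} (hθ : 0 < θ) :
    ∃ T P, IsProfile W (surfaceConstant W + θ) T P := by
  set pr : ℝ → ℝ := fun s => max 0 (min s 1) with hpr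
  have hprc : Continuous pr := continuous_const.max (continuous_id.min continuous_const)
  have hprm : ∀ s, pr s ∈ Icc (0 : ℝ) 1 := fun s =>
    ⟨le_max_left _ _, max_le zero_le_one (min_le_right _ _)⟩
  have hpri : ∀ s ∈ Icc (0 : ℝ) 1, pr s = s := fun s hs => by
    simp only [hpr, min_eq_left hs.2, max_eq_right hs.1]
  set κ : ℝ → ℝ := fun s => √(2 * evenEnergy W (pr s)) + θ with hκ
  have hκc : Continuous κ := (hW.continuous_sqrt.comp hprc).add continuous_const
  obtain ⟨M, hM⟩ := isCompact_Icc.exists_bound_of_continuousOn (s := Icc (0 : ℝ) 1)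
    hW.continuous_sqrt.continuousOn
  have hκm : ∀ s, θ ≤ κ s := fun s => by
    have := Real.sqrt_nonneg (2 * evenEnergy W (pr s))
    simp only [hκ]; linarith
  have hκM : ∀ s, κ s ≤ M + θ := fun s => by
    have := (le_abs_self _).trans (hM (pr s) (hprm s))
    simp only [hκ]; linarith
  obtain ⟨q, hqm, hq0, hqd, hqs⟩ := exists_strictMono_hasDerivAt hκc hθ hκm hκM
  obtain ⟨T, hT⟩ := hqs 1
  have hT0 : 0 < T := by
    rw [← hqm.lt_iff_lt, hq0, hT]; exact zero_lt_one
  set P : ℝ → ℝ := fun t => q (max 0 (min t T)) with hP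
  have hqlip : LipschitzWith (Real.toNNReal (M + θ)) q := by
    refine lipschitzWith_of_nnnorm_deriv_le (fun t => (hqd t).differentiableAt) fun t => ?_
    rw [(hqd t).deriv, ← NNReal.coe_le_coe, coe_nnnorm, Real.norm_eq_abs,
      abs_of_pos (hθ.trans_le (hκm _))]
    exact (hκM _).trans (Real.le_coe_toNNReal _)
  have hlip2 : LipschitzWith 1 fun t : ℝ => max 0 (min t T) := by
    simpa using (LipschitzWith.id.min_const T).const_max 0
  have hPq : ∀ t ∈ Ioo 0 T, P t = q t := fun t ht => by
    simp only [hP, min_eq_left ht.2.le, max_eq_right ht.1.le]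
  have hPd : ∀ t ∈ Ioo 0 T, deriv P t = κ (q t) := fun t ht => by
    rw [← (hqd t).deriv]
    refine Filter.EventuallyEq.deriv_eq ?_
    filter_upwards [Ioo_mem_nhds ht.1 ht.2] with s hs
    exact hPq s hs
  have hq01 : ∀ t ∈ Icc 0 T, q t ∈ Icc (0 : ℝ) 1 := fun t ht =>
    ⟨by rw [← hq0]; exact hqm.monotone ht.1, by rw [← hT]; exact hqm.monotone ht.2⟩
  refine ⟨T, P, hT0, ⟨_, hqlip.comp hlip2⟩, fun t => ?_, fun t ht => ?_, fun t ht => ?_, ?_⟩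
  · exact hq01 _ ⟨le_max_left _ _, max_le hT0.le (min_le_right _ _)⟩
  · simp only [hP]
    rw [max_eq_left ((min_le_left _ _).trans ht), hq0]
  · simp only [hP]
    rw [min_eq_right ht, max_eq_right hT0.le, hT]
  · have hqc : Continuous q := hqlip.continuous
    have e1 : ∫ t in (0 : ℝ)..T, (1 / 2 * deriv P t ^ 2 + evenEnergy W (P t)) =
        ∫ t in (0 : ℝ)..T, (1 / 2 * κ (q t) ^ 2 + evenEnergy W (q t)) := by
      refine intervalIntegral_congr_ae_Ioo hT0.le ?_
      filter_upwards [ae_restrict_mem measurableSet_Ioo] with t ht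
      rw [hPd t ht, hPq t ht]
    have e2 : ∫ t in (0 : ℝ)..T, κ (q t) * κ (q t) = ∫ s in (0 : ℝ)..1, κ s := by
      have := intervalIntegral.integral_comp_mul_deriv (a := 0) (b := T) (f := q)
        (f' := fun t => κ (q t)) (g := κ) (fun t _ => hqd t) (hκc.comp hqc).continuousOn hκc
      rw [hq0, hT] at this
      exact this
    have e3 : ∫ s in (0 : ℝ)..1, κ s = surfaceConstant W + θ := by
      rw [← phasePrimitive_one, phasePrimitive]
      rw [intervalIntegral.integral_congr (g := fun s => √(2 * evenEnergy W s) + θ)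
        (fun s hs => by
          rw [uIcc_of_le zero_le_one] at hs
          simp only [hκ, hpri s hs]),
        intervalIntegral.integral_add (hW.continuous_sqrt.intervalIntegrable _ _)
          intervalIntegrable_const]
      simp
    rw [e1, ← e3, ← e2]
    refine intervalIntegral.integral_mono_on hT0.le ?_ ?_ fun t ht => ?_
    · exact ((continuous_const.mul ((hκc.comp hqc).pow 2)).add
        (hW.continuous_evenEnergy.comp hqc)).intervalIntegrable _ _
    · exact ((hκc.comp hqc).mul (hκc.comp hqc)).intervalIntegrable _ _
    · have h1 := hW.evenEnergy_nonneg (q t)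
      have h2 : √(2 * evenEnergy W (q t)) ^ 2 = 2 * evenEnergy W (q t) :=
        Real.sq_sqrt (by positivity)
      have h3 := Real.sqrt_nonneg (2 * evenEnergy W (q t))
      simp only [hκ, hpri _ (hq01 t ht)]
      nlinarith [mul_nonneg h3 hθ.le]

/-- The points near which `u` is a.e. equal to the constant `c`. -/
def locallyAEConst (u : ℝ → ℝ) (c : ℝ) : Set ℝ :=
  {y | ∃ δ, 0 < δ ∧ ∀ᵐ z ∂volume.restrict (Ioo (y - δ) (y + δ)), u z = c}

theorem isOpen_locallyAEConst (u : ℝ → ℝ) (c : ℝ) : IsOpen (locallyAEConst u c) := by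
  rw [isOpen_iff_mem_nhds]
  rintro y ⟨δ, hδ, h⟩
  filter_upwards [Ioo_mem_nhds (by linarith : y - δ / 2 < y) (by linarith : y < y + δ / 2)]
    with z hz
  exact ⟨δ / 2, by positivity, ae_restrict_Ioo_mono (by linarith [hz.1]) (by linarith [hz.2]) h⟩

theorem notMem_locallyAEConst_one {u : ℝ → ℝ} {y : ℝ} (h : y ∈ locallyAEConst u 0) :
    y ∉ locallyAEConst u 1 := by
  obtain ⟨δ₀, hδ₀, h0⟩ := h
  rintro ⟨δ₁, hδ₁, h1⟩
  have hmin : 0 < min δ₀ δ₁ := lt_min hδ₀ hδ₁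
  have e0 := ae_restrict_Ioo_mono (c := y - min δ₀ δ₁) (d := y + min δ₀ δ₁)
    (by linarith [min_le_left δ₀ δ₁]) (by linarith [min_le_left δ₀ δ₁]) h0
  have e1 := ae_restrict_Ioo_mono (c := y - min δ₀ δ₁) (d := y + min δ₀ δ₁)
    (by linarith [min_le_right δ₀ δ₁]) (by linarith [min_le_right δ₀ δ₁]) h1
  have : (ae (volume.restrict (Ioo (y - min δ₀ δ₁) (y + min δ₀ δ₁)))).NeBot := by
    rw [ae_neBot]
    simp only [ne_eq, Measure.restrict_eq_zero, Real.volume_Ioo, ENNReal.ofReal_eq_zero, not_le]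
    linarith
  obtain ⟨z, hz0, hz1⟩ := (e0.and e1).exists
  rw [hz0] at hz1
  exact zero_ne_one hz1

theorem ae_eq_of_mem_locallyAEConst (u : ℝ → ℝ) (c : ℝ) :
    ∀ᵐ z, z ∈ locallyAEConst u c → u z = c := by
  rw [ae_iff]
  refine measure_null_of_locally_null _ fun y hy => ?_
  simp only [Classical.not_imp, mem_ofPred_eq] at hy
  obtain ⟨δ, hδ, h⟩ := hy.1
  refine ⟨{z | ¬(z ∈ locallyAEConst u c → u z = c)} ∩ Ioo (y - δ) (y + δ),
    inter_mem_nhdsWithin _ (Ioo_mem_nhds (by linarith) (by linarith)), ?_⟩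
  rw [ae_restrict_iff' measurableSet_Ioo, ae_iff] at h
  refine measure_mono_null ?_ h
  rintro z ⟨hz1, hz2⟩
  simp only [Classical.not_imp, mem_ofPred_eq] at hz1 ⊢
  exact ⟨hz2, hz1.2⟩

theorem mem_locallyAEConst_of_notMem_discontSet {lam : ℝ} {u : ℝ → ℝ}
    (hu : ∀ᵐ z ∂volume.restrict (Ioo 0 lam), u z = 0 ∨ u z = 1) {y : ℝ} (hy : y ∈ Ioo 0 lam)
    (hn : y ∉ discontSet lam u) : y ∈ locallyAEConst u 0 ∨ y ∈ locallyAEConst u 1 := by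
  obtain ⟨c, hc, δ, hδ, -, h⟩ := exists_ae_const_of_notMem_discontSet hu hy hn
  rcases hc with rfl | rfl
  · exact Or.inl ⟨δ, hδ, h⟩
  · exact Or.inr ⟨δ, hδ, h⟩

theorem subset_locallyAEConst_of_ordConnected {lam : ℝ} {u : ℝ → ℝ}
    (hu : ∀ᵐ z ∂volume.restrict (Ioo 0 lam), u z = 0 ∨ u z = 1) {J : Set ℝ}
    (hJ : J.OrdConnected) (hJs : J ⊆ Ioo 0 lam) (hJD : ∀ y ∈ J, y ∉ discontSet lam u) :
    J ⊆ locallyAEConst u 0 ∨ J ⊆ locallyAEConst u 1 := by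
  refine isPreconnected_iff_subset_of_disjoint.1 (isPreconnected_iff_ordConnected.2 hJ) _ _
    (isOpen_locallyAEConst u 0) (isOpen_locallyAEConst u 1)
    (fun y hy => mem_locallyAEConst_of_notMem_discontSet hu (hJs hy) (hJD y hy)) ?_
  ext y
  simp only [mem_inter_iff, mem_empty_iff_false, iff_false, not_and]
  exact fun _ h0 => notMem_locallyAEConst_one h0

/-- `σ` is a signed distance to the finite set `D` of jump points of the `{0, 1}`-valued function
`u`, positive where `u = 1`; the balls of radius `r` around the jump points are disjoint. -/
structure IsSignedDistance (lam : ℝ) (u : ℝ → ℝ) (D : Finset ℝ) (r : ℝ) (σ : ℝ → ℝ) : Prop where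
  r_pos : 0 < r
  ball_subset : ∀ p ∈ D, Ioo (p - r) (p + r) ⊆ Ioo 0 lam
  sep : ∀ p ∈ D, ∀ q ∈ D, p ≠ q → 2 * r ≤ |p - q|
  lipschitz : LipschitzWith 1 σ
  ae_eq : ∀ᵐ y ∂volume.restrict (Ioo 0 lam), u y = if 0 < σ y then 1 else 0
  near : ∀ p ∈ D, (∀ y ∈ Ioo (p - r) (p + r), σ y = y - p) ∨
    ∀ y ∈ Ioo (p - r) (p + r), σ y = p - y
  far : ∀ y ∈ Ioo 0 lam, (∀ p ∈ D, y ∉ Ioo (p - r) (p + r)) → r ≤ |σ y|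

theorem exists_isSignedDistance {lam : ℝ} {u : ℝ → ℝ}
    (hu : ∀ᵐ z ∂volume.restrict (Ioo 0 lam), u z = 0 ∨ u z = 1) {D : Finset ℝ}
    (hD : (D : Set ℝ) = discontSet lam u) (hne : D.Nonempty) :
    ∃ r σ, IsSignedDistance lam u D r σ := by
  classical
  obtain ⟨r, hr, hrsub, hrsep⟩ := exists_pos_ball_subset_pairwise_disjoint
    (isOpen_Ioo (a := (0 : ℝ)) (b := lam)) D
    (fun p hp => by have : p ∈ (D : Set ℝ) := hp; rw [hD] at this; exact this.1)
  have hneS : (D : Set ℝ).Nonempty := hne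
  set A : ℝ → Set ℝ := locallyAEConst u
  have hAdisj : ∀ y, y ∈ A 0 → y ∉ A 1 := fun y h => notMem_locallyAEConst_one h
  have hAae : ∀ c, ∀ᵐ z, z ∈ A c → u z = c := ae_eq_of_mem_locallyAEConst u
  have hD' : ∀ y, y ∉ D → y ∉ discontSet lam u := fun y hy => by rw [← hD]; exact hy
  have hcover : ∀ y ∈ Ioo 0 lam, y ∉ D → y ∈ A 0 ∨ y ∈ A 1 := fun y hy hyD =>
    mem_locallyAEConst_of_notMem_discontSet hu hy (hD' y hyD)
  have hconn : ∀ J : Set ℝ, J.OrdConnected → J ⊆ Ioo 0 lam → (∀ y ∈ J, y ∉ D) →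
      J ⊆ A 0 ∨ J ⊆ A 1 := fun J hJ hJs hJD =>
    subset_locallyAEConst_of_ordConnected hu hJ hJs fun y hy => hD' y (hJD y hy)
  set d : ℝ → ℝ := fun y => Metric.infDist y (D : Set ℝ) with hd
  have hd0 : ∀ y, 0 ≤ d y := fun y => Metric.infDist_nonneg
  have hdp : ∀ p ∈ D, ∀ y, d y ≤ |y - p| := fun p hp y => Metric.infDist_le_dist_of_mem hp
  have hdlip : ∀ y z, |d z - d y| ≤ |z - y| := by
    intro y z
    have := (Metric.lipschitz_infDist_pt (D : Set ℝ)).dist_le_mul z y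
    simpa [Real.dist_eq] using this
  set σ₀ : ℝ → ℝ := fun y => if y ∈ A 1 then d y else -d y with hσ₀
  have hσabs : ∀ y, |σ₀ y| = d y := by
    intro y
    by_cases h : y ∈ A 1
    · simp only [hσ₀, if_pos h, abs_of_nonneg (hd0 y)]
    · simp only [hσ₀, if_neg h, abs_neg, abs_of_nonneg (hd0 y)]
  have hlip0 : ∀ y ∈ Ioo 0 lam, ∀ z ∈ Ioo 0 lam, y ≤ z → |σ₀ z - σ₀ y| ≤ |z - y| := by
    intro y hy z hz hyz
    by_cases hp : ∃ p ∈ D, p ∈ Icc y z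
    · obtain ⟨p, hpD, hp⟩ := hp
      have h1 := hdp p hpD y
      have h2 := hdp p hpD z
      rw [abs_of_nonpos (by linarith [hp.1])] at h1
      rw [abs_of_nonneg (by linarith [hp.2])] at h2
      rw [abs_of_nonneg (by linarith : 0 ≤ z - y)]
      have h3 := abs_sub (σ₀ z) (σ₀ y)
      rw [hσabs, hσabs] at h3
      linarith
    · push Not at hp
      have hsub : Icc y z ⊆ Ioo 0 lam := fun t ht => ⟨hy.1.trans_le ht.1, ht.2.trans_lt hz.2⟩
      have hyI : y ∈ Icc y z := left_mem_Icc.2 hyz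
      have hzI : z ∈ Icc y z := right_mem_Icc.2 hyz
      rcases hconn (Icc y z) ordConnected_Icc hsub (fun t ht htD => hp t htD ht) with h | h
      · simp only [hσ₀, if_neg (hAdisj y (h hyI)), if_neg (hAdisj z (h hzI))]
        rw [show -d z - -d y = -(d z - d y) by ring, abs_neg]
        exact hdlip y z
      · simp only [hσ₀, if_pos (h hyI), if_pos (h hzI)]
        exact hdlip y z
  have hlip1 : LipschitzOnWith 1 σ₀ (Ioo 0 lam) := by
    refine LipschitzOnWith.of_dist_le_mul fun y hy z hz => ?_
    rw [NNReal.coe_one, one_mul, Real.dist_eq, Real.dist_eq]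
    rcases le_total y z with h | h
    · rw [abs_sub_comm, abs_sub_comm y z]
      exact hlip0 y hy z hz h
    · exact hlip0 z hz y hy h
  obtain ⟨σ, hσlip, hσeq⟩ := hlip1.extend_real
  have hdball : ∀ p ∈ D, ∀ y ∈ Ioo (p - r) (p + r), d y = |y - p| := by
    intro p hp y hy
    refine le_antisymm (hdp p hp y) ((Metric.le_infDist hneS).2 fun q hq => ?_)
    by_cases hpq : p = q
    · rw [hpq, Real.dist_eq]
    · have h1 := hrsep p hp q hq hpq
      have h2 : |y - p| < r := abs_lt.2 ⟨by linarith [hy.1], by linarith [hy.2]⟩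
      have h3 := abs_sub_le p y q
      rw [abs_sub_comm p y] at h3
      rw [Real.dist_eq]
      linarith
  have hnotD : ∀ p ∈ D, ∀ y ∈ Ioo (p - r) (p + r), y ≠ p → y ∉ D := by
    intro p hp y hy hyp hyD
    have h1 := hrsep p hp y hyD (Ne.symm hyp)
    have h2 : |p - y| < r := abs_lt.2 ⟨by linarith [hy.2], by linarith [hy.1]⟩
    linarith
  have haeD : ∀ᵐ y ∂volume.restrict (Ioo 0 lam), y ∉ D :=
    ae_restrict_of_ae (D.countable_toSet.ae_notMem volume)
  refine ⟨r, σ, hr, hrsub, hrsep, hσlip, ?_, ?_, ?_⟩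
  · filter_upwards [haeD, ae_restrict_of_ae (hAae 0), ae_restrict_of_ae (hAae 1),
      ae_restrict_mem measurableSet_Ioo] with y hyD h0 h1 hm
    have hdpos : 0 < d y := (D.finite_toSet.isClosed.notMem_iff_infDist_pos hneS).1 hyD
    rw [← hσeq hm]
    rcases hcover y hm hyD with h | h
    · rw [h0 h, if_neg]
      simp only [hσ₀, if_neg (hAdisj y h)]
      linarith
    · rw [h1 h, if_pos]
      simpa only [hσ₀, if_pos h] using hdpos
  · intro p hp
    have hL : Ioo (p - r) p ⊆ Ioo (p - r) (p + r) := Ioo_subset_Ioo le_rfl (by linarith)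
    have hR : Ioo p (p + r) ⊆ Ioo (p - r) (p + r) := Ioo_subset_Ioo (by linarith) le_rfl
    have cL := hconn _ ordConnected_Ioo (hL.trans (hrsub p hp))
      (fun y hy => hnotD p hp y (hL hy) hy.2.ne)
    have cR := hconn _ ordConnected_Ioo (hR.trans (hrsub p hp))
      (fun y hy => hnotD p hp y (hR hy) hy.1.ne')
    have hpd : p ∈ discontSet lam u := by rw [← hD]; exact hp
    have hboth : ∀ c, Ioo (p - r) p ⊆ A c → ¬ Ioo p (p + r) ⊆ A c := by
      intro c h1 h2
      refine notMem_discontSet_of_ae_const hr (c := c) ?_ hpd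
      filter_upwards [ae_restrict_of_ae (hAae c), ae_restrict_mem measurableSet_Ioo,
        ae_restrict_of_ae ((countable_singleton p).ae_notMem volume)] with y hy hm hyp
      rcases lt_or_gt_of_ne hyp with h | h
      · exact hy (h1 ⟨hm.1, h⟩)
      · exact hy (h2 ⟨h, hm.2⟩)
    have hcenter : σ p = 0 := by
      have hpI := (hrsub p hp ⟨by linarith, by linarith⟩ : p ∈ Ioo 0 lam)
      rw [← hσeq hpI, ← abs_eq_zero, hσabs, hdball p hp p ⟨by linarith, by linarith⟩]
      simp
    rcases cL with cL | cL <;> rcases cR with cR | cR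
    · exact absurd cR (hboth 0 cL)
    · left
      intro y hy
      rcases lt_trichotomy y p with h | h | h
      · rw [← hσeq (hrsub p hp hy)]
        simp only [hσ₀, if_neg (hAdisj y (cL ⟨hy.1, h⟩))]
        rw [hdball p hp y hy, abs_of_neg (by linarith)]
        ring
      · rw [h, hcenter, sub_self]
      · rw [← hσeq (hrsub p hp hy)]
        simp only [hσ₀, if_pos (cR ⟨h, hy.2⟩)]
        rw [hdball p hp y hy, abs_of_pos (by linarith)]
    · right
      intro y hy
      rcases lt_trichotomy y p with h | h | h
      · rw [← hσeq (hrsub p hp hy)]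
        simp only [hσ₀, if_pos (cL ⟨hy.1, h⟩)]
        rw [hdball p hp y hy, abs_of_neg (by linarith)]
        ring
      · rw [h, hcenter, sub_self]
      · rw [← hσeq (hrsub p hp hy)]
        simp only [hσ₀, if_neg (hAdisj y (cR ⟨h, hy.2⟩))]
        rw [hdball p hp y hy, abs_of_pos (by linarith)]
        ring
    · exact absurd cR (hboth 1 cL)
  · intro y hy hfar
    rw [← hσeq hy, hσabs]
    refine (Metric.le_infDist hneS).2 fun p hp => ?_
    rw [Real.dist_eq]
    by_contra! hlt
    rw [abs_lt] at hlt
    exact hfar p hp ⟨by linarith, by linarith⟩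

namespace IsSignedDistance

variable {lam : ℝ} {u : ℝ → ℝ} {D : Finset ℝ} {r : ℝ} {σ : ℝ → ℝ}

theorem setIntegral_ball (h : IsSignedDistance lam u D r σ) (F : ℝ → ℝ) {p : ℝ} (hp : p ∈ D) :
    ∫ y in Ioo (p - r) (p + r), F (σ y) = ∫ t in -r..r, F t := by
  have hr := h.r_pos
  have hle : p - r ≤ p + r := by linarith
  rcases h.near p hp with hσ | hσ
  · rw [setIntegral_congr_fun (g := fun y => F (y - p)) measurableSet_Ioo
      (fun y hy => by simp only [hσ y hy]), setIntegral_Ioo_eq_intervalIntegral hle,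
      intervalIntegral.integral_comp_sub_right]
    congr 1 <;> ring
  · rw [setIntegral_congr_fun (g := fun y => F (p - y)) measurableSet_Ioo
      (fun y hy => by simp only [hσ y hy]), setIntegral_Ioo_eq_intervalIntegral hle,
      intervalIntegral.integral_comp_sub_left]
    congr 1 <;> ring

/-- Integrals of functions of the signed distance split into the contributions of the jump points
and that of the region away from them. -/
theorem setIntegral_comp (h : IsSignedDistance lam u D r σ) {F : ℝ → ℝ}
    (hF : IntegrableOn (fun y => F (σ y)) (Ioo 0 lam)) :
    ∫ y in Ioo 0 lam, F (σ y) = D.card * (∫ t in -r..r, F t) +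
      ∫ y in Ioo 0 lam \ ⋃ p ∈ D, Ioo (p - r) (p + r), F (σ y) := by
  have hsub : (⋃ p ∈ D, Ioo (p - r) (p + r)) ⊆ Ioo 0 lam := iUnion₂_subset h.ball_subset
  have hmeas : MeasurableSet (⋃ p ∈ D, Ioo (p - r) (p + r)) :=
    D.measurableSet_biUnion fun _ _ => measurableSet_Ioo
  rw [setIntegral_sdiff hmeas hF hsub, integral_biUnion_finset D (fun _ _ => measurableSet_Ioo),
    Finset.sum_congr rfl fun p hp => h.setIntegral_ball F hp]
  · simp
  · intro p hp q hq hpq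
    have h1 := h.sep p hp q hq hpq
    rw [Function.onFun, Set.disjoint_left]
    rintro z ⟨h2, h3⟩ ⟨h4, h5⟩
    rcases abs_cases (p - q) with ⟨h6, -⟩ | ⟨h6, -⟩ <;> linarith
  · exact fun p hp => hF.mono_set (h.ball_subset p hp)

theorem le_abs_of_mem_diff (h : IsSignedDistance lam u D r σ) {y : ℝ}
    (hy : y ∈ Ioo 0 lam \ ⋃ p ∈ D, Ioo (p - r) (p + r)) : r ≤ |σ y| :=
  h.far y hy.1 fun p hp hm => hy.2 (mem_biUnion (by exact hp) hm)

theorem ne_zero_of_notMem (h : IsSignedDistance lam u D r σ) {y : ℝ} (hy : y ∈ Ioo 0 lam)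
    (hD : y ∉ D) : σ y ≠ 0 := by
  intro h0
  by_cases hfar : ∀ p ∈ D, y ∉ Ioo (p - r) (p + r)
  · have := h.far y hy hfar
    rw [h0, abs_zero] at this
    linarith [h.r_pos]
  · push Not at hfar
    obtain ⟨p, hp, hm⟩ := hfar
    have hyp : y = p := by
      rcases h.near p hp with hσ | hσ <;> linarith [hσ y hm]
    exact hD (hyp ▸ hp)

end IsSignedDistance

theorem integrableOn_of_measurable_bounded {s : Set ℝ} (hs : volume s ≠ ⊤) {f : ℝ → ℝ}
    (hf : Measurable f) {C : ℝ} (hC : ∀ y, |f y| ≤ C) : IntegrableOn f s := by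
  have : IsFiniteMeasure (volume.restrict s) := isFiniteMeasure_restrict.2 hs
  exact Integrable.of_bound hf.aestronglyMeasurable C (ae_of_all _ hC)

namespace IsProfile

variable {W : ℝ → ℝ} {E T : ℝ} {P : ℝ → ℝ}

theorem continuous (hP : IsProfile W E T P) : Continuous P := by
  obtain ⟨K, hK⟩ := hP.lipschitz
  exact hK.continuous

theorem deriv_of_neg (hP : IsProfile W E T P) {t : ℝ} (ht : t < 0) : deriv P t = 0 := by
  have : P =ᶠ[𝓝 t] fun _ => 0 := by
    filter_upwards [Iio_mem_nhds ht] with s hs using hP.eq_zero s hs.le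
  rw [this.deriv_eq, deriv_const]

theorem deriv_of_gt (hP : IsProfile W E T P) {t : ℝ} (ht : T < t) : deriv P t = 0 := by
  have : P =ᶠ[𝓝 t] fun _ => 1 := by
    filter_upwards [Ioi_mem_nhds ht] with s hs using hP.eq_one s hs.le
  rw [this.deriv_eq, deriv_const]

theorem exists_deriv_bound (hP : IsProfile W E T P) : ∃ K, ∀ t, |deriv P t| ≤ K := by
  obtain ⟨K, hK⟩ := hP.lipschitz
  exact ⟨K, fun t => norm_deriv_le_of_lipschitz hK⟩

theorem integral_eq (hP : IsProfile W E T P) {a b : ℝ} (ha : a ≤ 0) (hb : T ≤ b) :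
    ∫ t in a..b, P t = (∫ t in (0 : ℝ)..T, P t) + (b - T) := by
  have hi := fun a b => hP.continuous.intervalIntegrable (μ := volume) a b
  rw [← intervalIntegral.integral_add_adjacent_intervals (hi a 0) (hi 0 b),
    ← intervalIntegral.integral_add_adjacent_intervals (hi 0 T) (hi T b)]
  have e1 : ∫ t in a..0, P t = 0 := by
    rw [intervalIntegral.integral_congr (g := fun _ => (0 : ℝ)) (fun t ht => by
      rw [uIcc_of_le ha] at ht
      exact hP.eq_zero t ht.2)]
    simp
  have e2 : ∫ t in T..b, P t = b - T := by
    rw [intervalIntegral.integral_congr (g := fun _ => (1 : ℝ)) (fun t ht => by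
      rw [uIcc_of_le hb] at ht
      exact hP.eq_one t ht.1)]
    simp
  rw [e1, e2, zero_add]

/-- The excess mass of a rescaled and shifted profile over the sharp transition. -/
theorem integral_excess (hP : IsProfile W E T P) {r ε c : ℝ} (hr : 0 ≤ r) (hε : 0 < ε)
    (h1 : c - r / ε ≤ 0) (h2 : T ≤ c + r / ε) :
    ∫ t in -r..r, (P (c + t / ε) - if 0 < t then 1 else 0) =
      ε * (c - T + ∫ t in (0 : ℝ)..T, P t) := by
  have hmono : Monotone fun t : ℝ => if 0 < t then (1 : ℝ) else 0 := by
    intro a b hab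
    dsimp only
    split_ifs with h h'
    · rfl
    · exact absurd (h.trans_le hab) h'
    · exact zero_le_one
    · rfl
  have hi := fun a b : ℝ => hmono.intervalIntegrable (μ := volume) (a := a) (b := b)
  have hc : Continuous fun t : ℝ => P (c + t / ε) :=
    hP.continuous.comp (continuous_const.add (continuous_id.div_const ε))
  rw [intervalIntegral.integral_sub (hc.intervalIntegrable _ _) (hi _ _),
    intervalIntegral.integral_comp_add_div _ hε.ne', smul_eq_mul,
    hP.integral_eq (by rw [neg_div]; linarith) h2,
    ← intervalIntegral.integral_add_adjacent_intervals (hi (-r) 0) (hi 0 r)]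
  have e1 : ∫ t in -r..0, (if 0 < t then (1 : ℝ) else 0) = 0 := by
    rw [intervalIntegral_congr_ae_Ioo (g := fun _ => 0) (by linarith)]
    · simp
    · filter_upwards [ae_restrict_mem measurableSet_Ioo] with t ht
      rw [if_neg (not_lt.2 ht.2.le)]
  have e2 : ∫ t in (0 : ℝ)..r, (if 0 < t then (1 : ℝ) else 0) = r := by
    rw [intervalIntegral_congr_ae_Ioo (g := fun _ => 1) hr]
    · simp
    · filter_upwards [ae_restrict_mem measurableSet_Ioo] with t ht
      rw [if_pos ht.1]
  rw [e1, e2]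
  field_simp
  ring

end IsProfile

/-- The energy density of a lifted profile. -/
noncomputable def liftedDensity (W P : ℝ → ℝ) (δ t : ℝ) : ℝ :=
  (1 - δ) ^ 2 / 2 * deriv P t ^ 2 + evenEnergy W (δ + (1 - δ) * P t)

namespace IsProfile

variable {W : ℝ → ℝ} {E T : ℝ} {P : ℝ → ℝ} {δ : ℝ}

theorem lifted_mem (hP : IsProfile W E T P) (hδ : δ ∈ Icc (0 : ℝ) 1) (t : ℝ) :
    δ + (1 - δ) * P t ∈ Icc (0 : ℝ) 1 := by
  have h := hP.mem t
  constructor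
  · nlinarith [h.1, h.2, hδ.1, hδ.2, mul_nonneg (sub_nonneg.2 hδ.2) h.1]
  · nlinarith [mul_nonneg (sub_nonneg.2 hδ.2) (sub_nonneg.2 h.2)]

theorem liftedDensity_nonneg (hW : IsStoredEnergy W) (δ t : ℝ) : 0 ≤ liftedDensity W P δ t := by
  have := hW.evenEnergy_nonneg (δ + (1 - δ) * P t)
  unfold liftedDensity; positivity

theorem measurable_liftedDensity (hW : IsStoredEnergy W) (hP : IsProfile W E T P) (δ : ℝ) :
    Measurable (liftedDensity W P δ) :=
  (((measurable_deriv P).pow_const 2).const_mul _).add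
    (hW.continuous_evenEnergy.comp
      (continuous_const.add (continuous_const.mul hP.continuous))).measurable

theorem exists_liftedDensity_bound (hW : IsStoredEnergy W) (hP : IsProfile W E T P)
    (hδ : δ ∈ Icc (0 : ℝ) 1) : ∃ C, ∀ t, |liftedDensity W P δ t| ≤ C := by
  obtain ⟨K, hK⟩ := hP.exists_deriv_bound
  obtain ⟨M, hM⟩ := (isCompact_Icc (a := (0 : ℝ)) (b := 1)).exists_bound_of_continuousOn
    hW.continuous_evenEnergy.continuousOn
  refine ⟨(1 - δ) ^ 2 / 2 * K ^ 2 + M, fun t => ?_⟩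
  rw [abs_of_nonneg (liftedDensity_nonneg hW δ t), liftedDensity]
  have h1 := (le_abs_self _).trans (hM _ (hP.lifted_mem hδ t))
  have h2 : deriv P t ^ 2 ≤ K ^ 2 := by
    rw [← sq_abs]
    exact pow_le_pow_left₀ (abs_nonneg _) (hK t) 2
  gcongr

theorem liftedDensity_of_neg (hP : IsProfile W E T P) {t : ℝ} (ht : t < 0) :
    liftedDensity W P δ t = evenEnergy W δ := by
  rw [liftedDensity, hP.deriv_of_neg ht, hP.eq_zero t ht.le]; simp

theorem liftedDensity_of_gt (hW : IsStoredEnergy W) (hP : IsProfile W E T P) {t : ℝ} (ht : T < t) :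
    liftedDensity W P δ t = 0 := by
  rw [liftedDensity, hP.deriv_of_gt ht, hP.eq_one t ht.le]; simp [hW.evenEnergy_one]

theorem intervalIntegrable_liftedDensity (hW : IsStoredEnergy W) (hP : IsProfile W E T P)
    (hδ : δ ∈ Icc (0 : ℝ) 1) (a b : ℝ) :
    IntervalIntegrable (liftedDensity W P δ) volume a b := by
  obtain ⟨C, hC⟩ := hP.exists_liftedDensity_bound hW hδ
  rw [intervalIntegrable_iff]
  exact integrableOn_of_measurable_bounded (by simp [uIoc]) (hP.measurable_liftedDensity hW δ) hC

theorem integral_liftedDensity_le (hW : IsStoredEnergy W) (hP : IsProfile W E T P)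
    (hδ : δ ∈ Icc (0 : ℝ) 1) {ρ : ℝ}
    (hρ : ∀ a ∈ Icc (0 : ℝ) 1, evenEnergy W (δ + (1 - δ) * a) ≤ evenEnergy W a + ρ)
    {a b : ℝ} (ha : a ≤ 0) (hb : T ≤ b) :
    ∫ t in a..b, liftedDensity W P δ t ≤ -a * evenEnergy W δ + (E + T * ρ) := by
  have hi := fun a b => hP.intervalIntegrable_liftedDensity hW hδ a b
  have hT := hP.T_pos
  rw [← intervalIntegral.integral_add_adjacent_intervals (hi a 0) (hi 0 b),
    ← intervalIntegral.integral_add_adjacent_intervals (hi 0 T) (hi T b)]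
  have e1 : ∫ t in a..0, liftedDensity W P δ t = -a * evenEnergy W δ := by
    rw [intervalIntegral_congr_ae_Ioo (g := fun _ => evenEnergy W δ) ha]
    · simp
    · filter_upwards [ae_restrict_mem measurableSet_Ioo] with t ht
      exact hP.liftedDensity_of_neg ht.2
  have e2 : ∫ t in T..b, liftedDensity W P δ t = 0 := by
    rw [intervalIntegral_congr_ae_Ioo (g := fun _ => 0) hb]
    · simp
    · filter_upwards [ae_restrict_mem measurableSet_Ioo] with t ht
      exact hP.liftedDensity_of_gt hW ht.1
  have hi0 : IntervalIntegrable (fun t => 1 / 2 * deriv P t ^ 2 + evenEnergy W (P t))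
      volume 0 T := by
    have h0 := hP.intervalIntegrable_liftedDensity hW (δ := 0) ⟨le_rfl, zero_le_one⟩ 0 T
    have : liftedDensity W P 0 = fun t => 1 / 2 * deriv P t ^ 2 + evenEnergy W (P t) := by
      ext t; simp [liftedDensity]
    rwa [this] at h0
  have e3 : ∫ t in (0 : ℝ)..T, liftedDensity W P δ t ≤ E + T * ρ := by
    calc _ ≤ ∫ t in (0 : ℝ)..T, (1 / 2 * deriv P t ^ 2 + evenEnergy W (P t) + ρ) := by
          refine intervalIntegral.integral_mono_on hT.le (hi 0 T)
            (hi0.add intervalIntegrable_const) fun t _ => ?_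
          rw [liftedDensity]
          have h1 := hρ (P t) (hP.mem t)
          have h2 : (1 - δ) ^ 2 ≤ 1 := by nlinarith [hδ.1, hδ.2]
          have h3 : (1 - δ) ^ 2 / 2 * deriv P t ^ 2 ≤ 1 / 2 * deriv P t ^ 2 := by gcongr
          linarith
      _ = (∫ t in (0 : ℝ)..T, (1 / 2 * deriv P t ^ 2 + evenEnergy W (P t))) + T * ρ := by
          rw [intervalIntegral.integral_add hi0 intervalIntegrable_const]; simp
      _ ≤ _ := by linarith [hP.energy]
  rw [e1, e2]
  linarith

end IsProfile

/-- The derivative of the recovery sequence. -/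
noncomputable def recoveryDeriv (P σ : ℝ → ℝ) (c ε δ y : ℝ) : ℝ := δ + (1 - δ) * P (c + σ y / ε)

theorem deriv_comp_affine (P : ℝ → ℝ) (a b y : ℝ) :
    deriv (fun z => P (b + a * z)) y = a * deriv P (b + a * y) := by
  have h1 := deriv_comp_mul_left a (fun w => P (b + w)) y
  rw [smul_eq_mul, deriv_comp_const_add] at h1
  exact h1

namespace IsProfile

variable {W : ℝ → ℝ} {E T : ℝ} {P : ℝ → ℝ} {δ : ℝ} {lam : ℝ} {u : ℝ → ℝ} {D : Finset ℝ} {r : ℝ}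
  {σ : ℝ → ℝ}

theorem continuous_layer (hP : IsProfile W E T P) (hσ : IsSignedDistance lam u D r σ) (c ε : ℝ) :
    Continuous fun y => P (c + σ y / ε) :=
  hP.continuous.comp (continuous_const.add (hσ.lipschitz.continuous.div_const ε))

theorem integral_layer (hP : IsProfile W E T P) (hσ : IsSignedDistance lam u D r σ)
    {c ε : ℝ} (hε : 0 < ε) (h1 : c - r / ε < 0) (h2 : T < c + r / ε)
    (hu : ∫ y in Ioo 0 lam, u y = 1) :
    ∫ y in Ioo 0 lam, P (c + σ y / ε) =
      1 + D.card * (ε * (c - T + ∫ t in (0 : ℝ)..T, P t)) := by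
  have hstep : Measurable fun t : ℝ => if 0 < t then (1 : ℝ) else 0 :=
    Measurable.ite measurableSet_Ioi measurable_const measurable_const
  have i1 : IntegrableOn (fun y => P (c + σ y / ε)) (Ioo 0 lam) :=
    integrableOn_of_measurable_bounded (C := 1) (by simp) (hP.continuous_layer hσ c ε).measurable
      fun y => by
        rw [abs_of_nonneg (hP.mem _).1]; exact (hP.mem _).2
  have i2 : IntegrableOn (fun y => if 0 < σ y then (1 : ℝ) else 0) (Ioo 0 lam) :=
    integrableOn_of_measurable_bounded (C := 1) (by simp)
      (hstep.comp hσ.lipschitz.continuous.measurable) fun y => by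
        split_ifs <;> simp
  have e1 : ∫ y in Ioo 0 lam, (if 0 < σ y then (1 : ℝ) else 0) = 1 := by
    exact (integral_congr_ae (hσ.ae_eq.mono fun y hy => hy.symm)).trans hu
  have key := hσ.setIntegral_comp (F := fun t => P (c + t / ε) - if 0 < t then 1 else 0)
    (i1.sub i2)
  rw [integral_sub i1 i2, e1, hP.integral_excess hσ.r_pos.le hε h1.le h2.le] at key
  have e2 : ∫ y in Ioo 0 lam \ ⋃ p ∈ D, Ioo (p - r) (p + r),
      (P (c + σ y / ε) - if 0 < σ y then 1 else 0) = 0 := by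
    refine setIntegral_eq_zero_of_forall_eq_zero fun y hy => ?_
    have hfar := hσ.le_abs_of_mem_diff hy
    rcases le_abs.1 hfar with h | h
    · rw [if_pos (hσ.r_pos.trans_le h), hP.eq_one, sub_self]
      have : r / ε ≤ σ y / ε := by gcongr
      linarith
    · rw [if_neg (by linarith [hσ.r_pos]), hP.eq_zero, sub_self]
      have : σ y / ε ≤ -r / ε := by
        gcongr
        linarith
      rw [neg_div] at this
      linarith
  rw [e2] at key
  linarith

theorem deriv_recoveryDeriv_sq (hP : IsProfile W E T P) (hσ : IsSignedDistance lam u D r σ)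
    {c ε : ℝ} (hε : 0 < ε) (h1 : c - r / ε < 0) (h2 : T < c + r / ε) {y : ℝ}
    (hy : y ∈ Ioo 0 lam) :
    deriv (recoveryDeriv P σ c ε δ) y ^ 2 = ((1 - δ) / ε) ^ 2 * deriv P (c + σ y / ε) ^ 2 := by
  have hd : ∀ g : ℝ → ℝ, (recoveryDeriv P σ c ε δ) =ᶠ[𝓝 y] (fun z => δ + (1 - δ) * g z) →
      deriv (recoveryDeriv P σ c ε δ) y = (1 - δ) * deriv g y := by
    intro g hg
    rw [hg.deriv_eq, deriv_const_add, deriv_const_mul_field]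
  by_cases hnear : ∃ p ∈ D, y ∈ Ioo (p - r) (p + r)
  · obtain ⟨p, hp, hm⟩ := hnear
    have hlin : ∀ s : ℝ, s ^ 2 = 1 → (∀ z ∈ Ioo (p - r) (p + r), σ z = s * (z - p)) →
        deriv (recoveryDeriv P σ c ε δ) y ^ 2 =
          ((1 - δ) / ε) ^ 2 * deriv P (c + σ y / ε) ^ 2 := by
      intro s hs hσs
      rw [hd (fun z => P ((c - s * p / ε) + s / ε * z)) ?_, deriv_comp_affine, hσs y hm]
      · have : c - s * p / ε + s / ε * y = c + s * (y - p) / ε := by field_simp; ring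
        rw [this]
        have e : ((1 - δ) * (s / ε * deriv P (c + s * (y - p) / ε))) ^ 2 =
          s ^ 2 * (((1 - δ) / ε) ^ 2 * deriv P (c + s * (y - p) / ε) ^ 2) := by
            field_simp
        rw [e, hs, one_mul]
      · filter_upwards [Ioo_mem_nhds hm.1 hm.2] with z hz
        rw [recoveryDeriv, hσs z hz]
        congr 3
        field_simp; ring
    rcases hσ.near p hp with h | h
    · exact hlin 1 (by norm_num) fun z hz => by rw [h z hz]; ring
    · exact hlin (-1) (by norm_num) fun z hz => by rw [h z hz]; ring
  · push Not at hnear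
    have hfar := hσ.far y hy hnear
    have hcont : ContinuousAt (fun z => c + σ z / ε) y :=
      (continuous_const.add (hσ.lipschitz.continuous.div_const ε)).continuousAt
    rcases le_abs.1 hfar with h | h
    · have hgt : T < c + σ y / ε := by
        have : r / ε ≤ σ y / ε := by gcongr
        linarith
      rw [hd (fun _ => 1) ?_, hP.deriv_of_gt hgt]
      · simp
      · filter_upwards [hcont.eventually (lt_mem_nhds hgt)] with z hz
        rw [recoveryDeriv, hP.eq_one _ hz.le]
    · have hlt : c + σ y / ε < 0 := by
        have : σ y / ε ≤ -r / ε := by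
          gcongr
          linarith
        rw [neg_div] at this
        linarith
      rw [hd (fun _ => 0) ?_, hP.deriv_of_neg hlt]
      · simp
      · filter_upwards [hcont.eventually (gt_mem_nhds hlt)] with z hz
        rw [recoveryDeriv, hP.eq_zero _ hz.le]

/-- One member of the recovery sequence. -/
theorem exists_recovery (hW : IsStoredEnergy W) (hP : IsProfile W E T P)
    (hσ : IsSignedDistance lam u D r σ) (hl : 0 < lam) {c ε : ℝ} (hε : 0 < ε)
    (h1 : c - r / ε < 0) (h2 : T < c + r / ε) (hδ0 : 0 < δ) (hδ1 : δ ≤ 1)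
    (hmass : δ * lam + (1 - δ) * ∫ y in Ioo 0 lam, P (c + σ y / ε) = 1) {ρ : ℝ}
    (hρ : ∀ a ∈ Icc (0 : ℝ) 1, evenEnergy W (δ + (1 - δ) * a) ≤ evenEnergy W a + ρ) :
    ∃ h : SobolevH1 lam, h.MemH2 ∧ (∀ᵐ y ∂volume.restrict (Ioo 0 lam), 0 < h.weakDeriv y) ∧
      h.BoundaryConditions ∧
      h.weakDeriv =ᵐ[volume.restrict (Ioo 0 lam)] recoveryDeriv P σ c ε δ ∧
      ∫⁻ y in Ioo 0 lam, ENNReal.ofReal (h.interfaceDensity W ε y) ≤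
        ENNReal.ofReal (D.card * ((r / ε - c) * evenEnergy W δ + (E + T * ρ)) +
          lam / ε * evenEnergy W δ) := by
  have hδ : δ ∈ Icc (0 : ℝ) 1 := ⟨hδ0.le, hδ1⟩
  set V := recoveryDeriv P σ c ε δ with hV
  have hVmem : ∀ y, V y ∈ Icc (0 : ℝ) 1 := fun y => hP.lifted_mem hδ _
  have hVpos : ∀ y, 0 < V y := fun y => by
    have := mul_nonneg (sub_nonneg.2 hδ1) (hP.mem (c + σ y / ε)).1
    simp only [hV, recoveryDeriv]; linarith
  obtain ⟨K, hK⟩ := hP.lipschitz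
  have hVlip : ∃ K', LipschitzWith K' V := by
    have h3 : LipschitzWith (Real.toNNReal (1 / ε)) fun y => c + σ y / ε := by
      refine LipschitzWith.of_dist_le_mul fun y z => ?_
      have h4 := hσ.lipschitz.dist_le_mul y z
      rw [Real.coe_toNNReal _ (by positivity), Real.dist_eq]
      rw [NNReal.coe_one, one_mul, Real.dist_eq] at h4
      have : c + σ y / ε - (c + σ z / ε) = (σ y - σ z) / ε := by ring
      rw [this, abs_div, abs_of_pos hε, div_eq_inv_mul, one_div]
      gcongr
    have h5 := hK.comp h3
    refine ⟨Real.toNNReal |1 - δ| * _, LipschitzWith.of_dist_le_mul (K := Real.toNNReal |1 - δ| *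
      (K * Real.toNNReal (1 / ε))) fun y z => ?_⟩
    have h6 := h5.dist_le_mul y z
    simp only [Function.comp] at h6
    rw [NNReal.coe_mul, Real.coe_toNNReal _ (abs_nonneg _), mul_assoc]
    have h7 : dist (V y) (V z) = |1 - δ| * dist (P (c + σ y / ε)) (P (c + σ z / ε)) := by
      rw [Real.dist_eq, Real.dist_eq, ← abs_mul]
      congr 1
      simp only [hV, recoveryDeriv]; ring
    rw [h7]
    gcongr
  obtain ⟨K', hK'⟩ := hVlip
  have hVm : MemLp V 2 (volume.restrict (Ioo 0 lam)) :=
    MemLp.of_bound hK'.continuous.aestronglyMeasurable 1 (ae_of_all _ fun y => by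
      rw [Real.norm_eq_abs, abs_of_nonneg (hVmem y).1]; exact (hVmem y).2)
  have hVd : MemLp (deriv V) 2 (volume.restrict (Ioo 0 lam)) :=
    MemLp.of_bound (measurable_deriv V).aestronglyMeasurable K'
      (ae_of_all _ fun y => norm_deriv_le_of_lipschitz hK')
  obtain ⟨h, hh1, hh2⟩ := SobolevH1.exists_of_deriv hl hVm
  obtain ⟨hH2, hw2⟩ := SobolevH1.memH2_of_ac hl
    hK'.lipschitzOnWith.absolutelyContinuousOnInterval hh2 hVd
  refine ⟨h, hH2, hh2.mono fun y hy => by rw [hy]; exact hVpos y, ?_, hh2, ?_⟩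
  · refine (SobolevH1.boundaryConditions_iff hl h).2 ⟨?_, ?_⟩
    · filter_upwards [hh1, ae_restrict_mem measurableSet_Ioo] with y hy hm
      rw [hy]
      exact (intervalIntegral_congr_ae_Ioo hm.1.le (ae_restrict_Ioo_mono le_rfl hm.2.le hh2)).symm
    · rw [intervalIntegral_congr_ae_Ioo hl.le hh2, ← setIntegral_Ioo_eq_intervalIntegral hl.le,
        ← hmass]
      simp only [hV, recoveryDeriv]
      rw [integral_add (integrable_const δ), integral_const_mul]
      · simp [hl.le, mul_comm]
      · refine (integrableOn_of_measurable_bounded (C := 1) (by simp)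
          (hP.continuous_layer hσ c ε).measurable fun y => ?_).const_mul _
        rw [abs_of_nonneg (hP.mem _).1]; exact (hP.mem _).2
  · set F : ℝ → ℝ := fun t => 1 / ε * liftedDensity W P δ (c + t / ε) with hF
    obtain ⟨C, hC⟩ := hP.exists_liftedDensity_bound hW hδ
    have hFm : Measurable fun y => F (σ y) :=
      ((hP.measurable_liftedDensity hW δ).comp
        (continuous_const.add (hσ.lipschitz.continuous.div_const ε)).measurable).const_mul _
    have hFi : IntegrableOn (fun y => F (σ y)) (Ioo 0 lam) :=
      integrableOn_of_measurable_bounded (C := 1 / ε * C) (by simp) hFm fun y => by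
        simp only [hF]
        rw [abs_mul, abs_of_pos (by positivity : 0 < 1 / ε)]
        gcongr
        exact hC _
    have hF0 : ∀ t, 0 ≤ F t := fun t =>
      mul_nonneg (by positivity) (liftedDensity_nonneg hW δ _)
    have e1 : ∫⁻ y in Ioo 0 lam, ENNReal.ofReal (h.interfaceDensity W ε y) =
        ∫⁻ y in Ioo 0 lam, ENNReal.ofReal (F (σ y)) := by
      refine lintegral_congr_ae ?_
      filter_upwards [hh2, hw2, ae_restrict_mem measurableSet_Ioo] with y hy1 hy2 hm
      rw [SobolevH1.interfaceDensity, hy1, hy2, hP.deriv_recoveryDeriv_sq hσ hε h1 h2 hm]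
      congr 1
      simp only [hF, liftedDensity, hV, recoveryDeriv]
      field_simp
    rw [e1, ← ofReal_integral_eq_lintegral_ofReal hFi (ae_of_all _ fun y => hF0 _)]
    apply ENNReal.ofReal_le_ofReal
    rw [hσ.setIntegral_comp hFi]
    have e2 : ∫ t in -r..r, F t ≤ (r / ε - c) * evenEnergy W δ + (E + T * ρ) := by
      simp only [hF]
      rw [intervalIntegral.integral_const_mul, intervalIntegral.integral_comp_add_div _ hε.ne',
        smul_eq_mul, ← mul_assoc, one_div_mul_cancel hε.ne', one_mul]
      refine (hP.integral_liftedDensity_le hW hδ hρ ?_ h2.le).trans (le_of_eq ?_)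
      · rw [neg_div]; linarith
      · ring
    have e3 : ∫ y in Ioo 0 lam \ ⋃ p ∈ D, Ioo (p - r) (p + r), F (σ y) ≤
        lam / ε * evenEnergy W δ := by
      have hWδ := hW.evenEnergy_nonneg δ
      have hmeas : MeasurableSet (Ioo 0 lam \ ⋃ p ∈ D, Ioo (p - r) (p + r)) :=
        measurableSet_Ioo.diff (D.measurableSet_biUnion fun _ _ => measurableSet_Ioo)
      calc _ ≤ ∫ _ in Ioo 0 lam \ ⋃ p ∈ D, Ioo (p - r) (p + r), 1 / ε * evenEnergy W δ := by
            refine setIntegral_mono_on (hFi.mono_set sdiff_subset)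
              (integrableOn_const ((measure_mono sdiff_subset).trans_lt (by simp :
                volume (Ioo 0 lam) < ⊤)).ne) hmeas fun y hy => ?_
            have hfar := hσ.le_abs_of_mem_diff hy
            simp only [hF]
            rcases le_abs.1 hfar with h | h
            · rw [hP.liftedDensity_of_gt hW]
              · rw [mul_zero]; positivity
              · have : r / ε ≤ σ y / ε := by gcongr
                linarith
            · rw [hP.liftedDensity_of_neg]
              have : σ y / ε ≤ -r / ε := by
                gcongr
                linarith
              rw [neg_div] at this
              linarith
        _ ≤ ∫ _ in Ioo 0 lam, 1 / ε * evenEnergy W δ :=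
            setIntegral_mono_set (integrableOn_const (by simp))
              (ae_of_all _ fun _ => by simp only [Pi.zero_apply]; positivity)
              (ae_of_all _ fun _ hy => hy.1)
        _ = _ := by
            rw [setIntegral_const]
            simp only [measureReal_def, Real.volume_Ioo, sub_zero, smul_eq_mul,
              ENNReal.toReal_ofReal hl.le]
            ring
    have := mul_le_mul_of_nonneg_left e2 (Nat.cast_nonneg (α := ℝ) D.card)
    linarith

end IsProfile

theorem foundationDensity_le {lam μ : ℝ} (hl : 0 < lam) (hμ : 0 ≤ μ) {h : SobolevH1 lam}
    (hbc : h.BoundaryConditions)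
    (hv : ∀ᵐ y ∂volume.restrict (Ioo 0 lam), h.weakDeriv y ∈ Icc (0 : ℝ) 1) :
    ∀ᵐ y ∂volume.restrict (Ioo 0 lam),
      h.foundationDensity μ y ∈ Icc 0 (μ / 2 * (lam + lam * lam) ^ 2) := by
  filter_upwards [((boundaryConditions_iff hl h).1 hbc).1, hv, ae_restrict_mem measurableSet_Ioo]
    with y h1 h2 hm
  refine ⟨foundationDensity_nonneg hμ h2.1, ?_⟩
  have h3 : |h.toFun y| ≤ lam := by
    rw [h1, ← Real.norm_eq_abs]
    have : ‖∫ t in (0 : ℝ)..y, h.weakDeriv t‖ ≤ 1 * |y - 0| := by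
      apply intervalIntegral.norm_integral_le_of_norm_le_const_ae
      filter_upwards [(ae_restrict_iff' measurableSet_Ioo).1 hv] with t ht hmt
      rw [uIoc_of_le hm.1.le] at hmt
      have := ht ⟨hmt.1, hmt.2.trans_lt hm.2⟩
      rw [Real.norm_eq_abs, abs_of_nonneg this.1]
      exact this.2
    rw [one_mul, sub_zero, abs_of_pos hm.1] at this
    exact this.trans hm.2.le
  have h4 : (y - lam * h.toFun y) ^ 2 ≤ (lam + lam * lam) ^ 2 := by
    rw [abs_le] at h3
    apply sq_le_sq'
    · nlinarith [hm.1, hm.2, h3.1, h3.2]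
    · nlinarith [hm.1, hm.2, h3.1, h3.2]
  rw [foundationDensity]
  have h5 : h.weakDeriv y * (y - lam * h.toFun y) ^ 2 ≤ 1 * (lam + lam * lam) ^ 2 :=
    mul_le_mul h2.2 h4 (sq_nonneg _) zero_le_one
  rw [one_mul] at h5
  gcongr

theorem IsSharp.ofReal_add_lintegral_eq {W : ℝ → ℝ} (hW : IsStoredEnergy W) {lam μ : ℝ}
    (hl : 0 < lam) (hμ : 0 ≤ μ) {x : SobolevH1 lam} (hx : IsSharp x) :
    ENNReal.ofReal (surfaceConstant W * (discontSet lam x.weakDeriv).ncard) +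
      (∫⁻ y in Ioo 0 lam, ENNReal.ofReal (x.foundationDensity μ y)) = sharpEnergy W lam μ x := by
  have hb := foundationDensity_le hl hμ hx.2.2 (hx.2.1.mono fun y hy => by
    rcases hy with hy | hy <;> simp [hy])
  have hi : IntegrableOn (x.foundationDensity μ) (Ioo 0 lam) :=
    Integrable.of_bound (x.aestronglyMeasurable_foundationDensity μ) _ (hb.mono fun y hy => by
      rw [Real.norm_eq_abs, abs_of_nonneg hy.1]; exact hy.2)
  have hC := hW.surfaceConstant_pos
  rw [sharpEnergy, if_pos hx, ← ofReal_integral_eq_lintegral_ofReal hi (hb.mono fun y hy => hy.1),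
    ← ENNReal.ofReal_add (by positivity) (integral_nonneg_of_ae (hb.mono fun y hy => hy.1)),
    ← integral_const_mul]
  rfl

theorem tendsto_lintegral_foundationDensity {lam μ : ℝ} (hl : 0 < lam) (hμ : 0 ≤ μ)
    {h : ℕ → SobolevH1 lam} {x : SobolevH1 lam} (hbc : ∀ n, (h n).BoundaryConditions)
    (hv : ∀ n, ∀ᵐ y ∂volume.restrict (Ioo 0 lam), (h n).weakDeriv y ∈ Icc (0 : ℝ) 1)
    (hu : ∀ᵐ y ∂volume.restrict (Ioo 0 lam),
      Tendsto (fun n => (h n).toFun y) atTop (𝓝 (x.toFun y)))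
    (hvt : ∀ᵐ y ∂volume.restrict (Ioo 0 lam),
      Tendsto (fun n => (h n).weakDeriv y) atTop (𝓝 (x.weakDeriv y))) :
    Tendsto (fun n => ∫⁻ y in Ioo 0 lam, ENNReal.ofReal ((h n).foundationDensity μ y)) atTop
      (𝓝 (∫⁻ y in Ioo 0 lam, ENNReal.ofReal (x.foundationDensity μ y))) := by
  refine tendsto_lintegral_of_dominated_convergence'
    (fun _ => ENNReal.ofReal (μ / 2 * (lam + lam * lam) ^ 2)) (fun n => ?_) (fun n => ?_) ?_ ?_
  · exact ((h n).aestronglyMeasurable_foundationDensity μ).aemeasurable.ennreal_ofReal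
  · filter_upwards [foundationDensity_le hl hμ (hbc n) (hv n)] with y hy
    exact ENNReal.ofReal_le_ofReal hy.2
  · rw [lintegral_const]
    exact ENNReal.mul_ne_top ENNReal.ofReal_ne_top (by simp)
  · filter_upwards [hu, hvt] with y h1 h2
    exact ENNReal.tendsto_ofReal
      ((h2.mul ((tendsto_const_nhds.sub (h1.const_mul lam)).pow 2)).const_mul _)

/-- Without interfaces the sharp deformation has no interfacial energy. -/
theorem rescaledEnergy_le_sharpEnergy {W : ℝ → ℝ} (hW : IsStoredEnergy W) {lam μ ε : ℝ}
    (hl : 0 < lam) (hμ : 0 ≤ μ) (hε : 0 < ε) {x : SobolevH1 lam} (hx : IsSharp x)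
    (hD : discontSet lam x.weakDeriv = ∅) :
    rescaledEnergy W lam μ ε x ≤ sharpEnergy W lam μ x := by
  have hmass := ((boundaryConditions_iff hl x).1 hx.2.2).2
  have hconst : ∃ c, ∀ᵐ y ∂volume.restrict (Ioo 0 lam), x.weakDeriv y = c := by
    have hc : ∀ c, Ioo 0 lam ⊆ locallyAEConst x.weakDeriv c →
        ∀ᵐ y ∂volume.restrict (Ioo 0 lam), x.weakDeriv y = c := fun c h => by
      filter_upwards [ae_restrict_of_ae (ae_eq_of_mem_locallyAEConst x.weakDeriv c),
        ae_restrict_mem measurableSet_Ioo] with y hy hm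
      exact hy (h hm)
    rcases subset_locallyAEConst_of_ordConnected hx.2.1 ordConnected_Ioo Subset.rfl
      (fun y _ => by simp [hD]) with h | h
    · exact ⟨0, hc 0 h⟩
    · exact ⟨1, hc 1 h⟩
  have hone : x.weakDeriv =ᵐ[volume.restrict (Ioo 0 lam)] fun _ => 1 := by
    obtain ⟨c, hc⟩ := hconst
    filter_upwards [hc, hx.2.1] with y h1 h2
    refine h2.resolve_left fun h0 => ?_
    rw [h1] at h0
    rw [intervalIntegral_congr_ae_Ioo (g := fun _ => c) hl.le hc, h0] at hmass
    simp at hmass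
  obtain ⟨hH2, hw⟩ := memH2_of_ac hl (V := fun _ => 1)
    (LipschitzWith.const (1 : ℝ)).lipschitzOnWith.absolutelyContinuousOnInterval hone (by simp)
  rw [rescaledEnergy_eq hW hμ hε hH2 (hone.mono fun y hy => by rw [hy]; exact one_pos) hx.2.2,
    ← hx.ofReal_add_lintegral_eq hW hl hμ]
  gcongr
  refine le_trans (le_of_eq ?_) zero_le
  rw [← lintegral_zero (μ := volume.restrict (Ioo 0 lam))]
  refine lintegral_congr_ae ?_
  filter_upwards [hone, hw] with y h1 h2
  rw [interfaceDensity, h1, h2, hW.evenEnergy_one]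
  simp

theorem IsSharp.one_lt {lam : ℝ} (hl : 1 ≤ lam) {x : SobolevH1 lam} (hx : IsSharp x)
    (hne : (discontSet lam x.weakDeriv).Nonempty) : 1 < lam := by
  have hl0 : 0 < lam := by linarith
  refine lt_of_le_of_ne hl fun h1 => ?_
  have hmass := ((boundaryConditions_iff hl0 x).1 hx.2.2).2
  have h0 : ∫ y in Ioo 0 lam, (1 - x.weakDeriv y) = 0 := by
    rw [integral_sub (integrable_const _) x.weakDeriv_integrableOn,
      setIntegral_Ioo_eq_intervalIntegral hl0.le x.weakDeriv, hmass]
    simp [← h1]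
  have hi : Integrable (fun y => 1 - x.weakDeriv y) (volume.restrict (Ioo 0 lam)) :=
    (integrable_const _).sub x.weakDeriv_integrableOn
  rw [integral_eq_zero_iff_of_nonneg_ae
    (hx.2.1.mono fun y hy => by rcases hy with hy | hy <;> simp [hy]) hi] at h0
  obtain ⟨p, hp⟩ := hne
  obtain ⟨δ, hδ, hball⟩ := Metric.isOpen_iff.1 (isOpen_Ioo (a := (0 : ℝ)) (b := lam)) p hp.1
  rw [Real.ball_eq_Ioo] at hball
  refine notMem_discontSet_of_ae_const hδ (c := 1) ?_ hp
  filter_upwards [ae_restrict_of_ae_restrict_of_subset hball h0] with y hy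
  simp only [Pi.zero_apply] at hy
  linarith

/-- The level to which the zero phase is lifted in the recovery sequence. -/
noncomputable def recoveryLevel (lam N ε : ℝ) : ℝ := N * ε ^ 2 / (lam - 1 + N * ε ^ 2)

section RecoveryLevel

variable {lam N : ℝ}

theorem recoveryLevel_pos {ε : ℝ} (hl : 1 < lam) (hN : 0 < N) (hε : 0 < ε) :
    0 < recoveryLevel lam N ε := by
  have : 0 < lam - 1 := by linarith
  unfold recoveryLevel; positivity

theorem recoveryLevel_le_one {ε : ℝ} (hl : 1 < lam) (hN : 0 < N) (hε : 0 < ε) :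
    recoveryLevel lam N ε ≤ 1 := by
  have h1 : 0 < lam - 1 := by linarith
  unfold recoveryLevel
  rw [div_le_one (by positivity)]
  linarith

theorem recoveryLevel_mass {ε : ℝ} (hl : 1 < lam) (hN : 0 < N) :
    recoveryLevel lam N ε * lam + (1 - recoveryLevel lam N ε) * (1 - N * ε ^ 2) = 1 := by
  have h1 : 0 < lam - 1 := by linarith
  have h2 : lam - 1 + N * ε ^ 2 ≠ 0 := by positivity
  unfold recoveryLevel
  field_simp
  ring

theorem tendsto_recoveryLevel_div {ε : ℕ → ℝ} (hl : 1 < lam) (hε : ∀ n, 0 < ε n)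
    (hε0 : Tendsto ε atTop (𝓝 0)) :
    Tendsto (fun n => recoveryLevel lam N (ε n) / ε n) atTop (𝓝 0) := by
  have h1 : lam - 1 ≠ 0 := by linarith
  have h2 : Tendsto (fun n => N * ε n / (lam - 1 + N * ε n ^ 2)) atTop
      (𝓝 (N * 0 / (lam - 1 + N * 0 ^ 2))) :=
    (hε0.const_mul N).div (((hε0.pow 2).const_mul N).const_add _) (by simpa using h1)
  have h3 : (fun n => recoveryLevel lam N (ε n) / ε n) =
      fun n => N * ε n / (lam - 1 + N * ε n ^ 2) := by
    ext n
    have := (hε n).ne'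
    unfold recoveryLevel
    rw [div_right_comm]
    congr 1
    field_simp
  rw [h3]
  simpa using h2

theorem tendsto_recoveryLevel {ε : ℕ → ℝ} (hl : 1 < lam) (hε : ∀ n, 0 < ε n)
    (hε0 : Tendsto ε atTop (𝓝 0)) :
    Tendsto (fun n => recoveryLevel lam N (ε n)) atTop (𝓝 0) := by
  have h := (tendsto_recoveryLevel_div (N := N) hl hε hε0).mul hε0
  rw [zero_mul] at h
  refine h.congr fun n => ?_
  exact div_mul_cancel₀ _ (hε n).ne'

theorem IsStoredEnergy.tendsto_evenEnergy_recoveryLevel_div {W : ℝ → ℝ} (hW : IsStoredEnergy W)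
    {ε : ℕ → ℝ} (hl : 1 < lam) (hN : 0 < N) (hε : ∀ n, 0 < ε n) (hε0 : Tendsto ε atTop (𝓝 0)) :
    Tendsto (fun n => evenEnergy W (recoveryLevel lam N (ε n)) / ε n) atTop (𝓝 0) := by
  obtain ⟨w, hw⟩ := hW.asymptote
  have hpos := fun n => recoveryLevel_pos hl hN (hε n)
  have h1 : Tendsto (fun n => recoveryLevel lam N (ε n)) atTop (𝓝[>] 0) :=
    tendsto_nhdsWithin_iff.2 ⟨tendsto_recoveryLevel hl hε hε0, Eventually.of_forall hpos⟩
  have h2 := (hw.comp tendsto_inv_nhdsGT_zero).comp h1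
  have h3 := (tendsto_recoveryLevel_div (N := N) hl hε hε0).mul h2
  rw [zero_mul] at h3
  refine h3.congr fun n => ?_
  rw [evenEnergy_of_nonneg W (hpos n).le, inverseEnergy]
  simp only [Function.comp]
  ring

end RecoveryLevel

theorem IsStoredEnergy.eventually_evenEnergy_lift_le {W : ℝ → ℝ} (hW : IsStoredEnergy W)
    {δ : ℕ → ℝ} (hδ0 : ∀ n, 0 < δ n) (hδ1 : ∀ n, δ n ≤ 1) (hδ : Tendsto δ atTop (𝓝 0))
    {ρ : ℝ} (hρ : 0 < ρ) :
    ∀ᶠ n in atTop, ∀ a ∈ Icc (0 : ℝ) 1,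
      evenEnergy W (δ n + (1 - δ n) * a) ≤ evenEnergy W a + ρ := by
  have hu := (isCompact_Icc (a := (0 : ℝ)) (b := 1)).uniformContinuousOn_of_continuous
    hW.continuous_evenEnergy.continuousOn
  obtain ⟨κ, hκ, h⟩ := Metric.uniformContinuousOn_iff.1 hu ρ hρ
  filter_upwards [hδ.eventually (gt_mem_nhds hκ)] with n hn a ha
  have h1 : δ n + (1 - δ n) * a ∈ Icc (0 : ℝ) 1 := by
    constructor
    · nlinarith [ha.1, hδ0 n, mul_nonneg (sub_nonneg.2 (hδ1 n)) ha.1]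
    · nlinarith [mul_nonneg (sub_nonneg.2 (hδ1 n)) (sub_nonneg.2 ha.2)]
  have h2 := h _ h1 a ha (by
    rw [Real.dist_eq, show δ n + (1 - δ n) * a - a = δ n * (1 - a) by ring,
      abs_of_nonneg (mul_nonneg (hδ0 n).le (sub_nonneg.2 ha.2))]
    nlinarith [hδ0 n, ha.1])
  rw [Real.dist_eq] at h2
  linarith [(abs_lt.1 h2).2]

theorem eventually_exists_recovery_of_nonempty {W : ℝ → ℝ} (hW : IsStoredEnergy W) {lam μ : ℝ}
    (hl : 1 ≤ lam) (hμ : 0 ≤ μ) {ε : ℕ → ℝ} (hε : ∀ n, 0 < ε n) (hε0 : Tendsto ε atTop (𝓝 0))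
    {x : SobolevH1 lam} (hx : IsSharp x) (hne : (discontSet lam x.weakDeriv).Nonempty)
    {η : ℝ} (hη : 0 < η) :
    ∀ᶠ n in atTop, ∃ h : SobolevH1 lam, dist h x < η ∧
      rescaledEnergy W lam μ (ε n) h ≤ sharpEnergy W lam μ x + ENNReal.ofReal η := by
  have hl0 : 0 < lam := by linarith
  have hl1 := hx.one_lt hl hne
  have hfin := hx.1.finite_discontSet hl0
  set D := hfin.toFinset with hD
  have hDne : D.Nonempty := by rwa [hD, Set.Finite.toFinset_nonempty]
  obtain ⟨r, σ, hσ⟩ := exists_isSignedDistance hx.2.1 (D := D) hfin.coe_toFinset hDne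
  set N : ℝ := (D.card : ℝ) with hN
  have hN0 : 0 < N := by rw [hN]; exact_mod_cast hDne.card_pos
  have hr := hσ.r_pos
  set θ : ℝ := η / (8 * N) with hθ
  have hθ0 : 0 < θ := by positivity
  obtain ⟨T, P, hP⟩ := hW.exists_isProfile hθ0
  have hT := hP.T_pos
  set J := ∫ t in (0 : ℝ)..T, P t with hJ
  set c : ℕ → ℝ := fun n => T - J - ε n with hc
  set δ : ℕ → ℝ := fun n => recoveryLevel lam N (ε n) with hδ
  have hδ0 : ∀ n, 0 < δ n := fun n => recoveryLevel_pos hl1 hN0 (hε n)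
  have hδ1 : ∀ n, δ n ≤ 1 := fun n => recoveryLevel_le_one hl1 hN0 (hε n)
  have hδt : Tendsto δ atTop (𝓝 0) := tendsto_recoveryLevel hl1 hε hε0
  have hct : Tendsto c atTop (𝓝 (T - J)) := by
    simpa using hε0.const_sub (T - J)
  have hρ0 : 0 < θ / T := by positivity
  have ev1 : ∀ᶠ n in atTop, c n - r / ε n < 0 := by
    have h1 : Tendsto (fun n => c n * ε n) atTop (𝓝 0) := by simpa using hct.mul hε0
    filter_upwards [h1.eventually (gt_mem_nhds hr)] with n hn
    rw [sub_neg, lt_div_iff₀ (hε n)]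
    exact hn
  have ev2 : ∀ᶠ n in atTop, T < c n + r / ε n := by
    have h1 : Tendsto (fun n => (T - c n) * ε n) atTop (𝓝 0) := by
      simpa using (hct.const_sub T).mul hε0
    filter_upwards [h1.eventually (gt_mem_nhds hr)] with n hn
    rw [← sub_lt_iff_lt_add', lt_div_iff₀ (hε n)]
    exact hn
  have ev3 := hW.eventually_evenEnergy_lift_le hδ0 hδ1 hδt hρ0
  obtain ⟨n₀, hn₀⟩ := eventually_atTop.1 (ev1.and (ev2.and ev3))
  have hmass1 := ((boundaryConditions_iff hl0 x).1 hx.2.2).2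
  rw [← setIntegral_Ioo_eq_intervalIntegral hl0.le] at hmass1
  have hex : ∀ n, ∃ h : SobolevH1 lam, h.MemH2 ∧
      (∀ᵐ y ∂volume.restrict (Ioo 0 lam), 0 < h.weakDeriv y) ∧ h.BoundaryConditions ∧
      h.weakDeriv =ᵐ[volume.restrict (Ioo 0 lam)]
        recoveryDeriv P σ (c (n + n₀)) (ε (n + n₀)) (δ (n + n₀)) ∧
      ∫⁻ y in Ioo 0 lam, ENNReal.ofReal (h.interfaceDensity W (ε (n + n₀)) y) ≤
        ENNReal.ofReal (N * ((r / ε (n + n₀) - c (n + n₀)) * evenEnergy W (δ (n + n₀)) +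
          (surfaceConstant W + θ + T * (θ / T))) +
          lam / ε (n + n₀) * evenEnergy W (δ (n + n₀))) := by
    intro n
    obtain ⟨h1, h2, h3⟩ := hn₀ (n + n₀) (Nat.le_add_left _ _)
    refine hP.exists_recovery hW hσ hl0 (hε _) h1 h2 (hδ0 _) (hδ1 _) ?_ h3
    rw [hP.integral_layer hσ (hε _) h1 h2 hmass1]
    have e : 1 + (D.card : ℝ) * (ε (n + n₀) * (c (n + n₀) - T + ∫ t in (0 : ℝ)..T, P t)) =
        1 - N * ε (n + n₀) ^ 2 := by
      simp only [hc, ← hJ, ← hN]; ring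
    rw [e]
    exact recoveryLevel_mass hl1 hN0
  choose h hH2 hpos hbc hder hint using hex
  have hshift : Tendsto (fun n => n + n₀) atTop atTop := tendsto_add_atTop_nat n₀
  have hmem : ∀ n, ∀ᵐ y ∂volume.restrict (Ioo 0 lam), (h n).weakDeriv y ∈ Icc (0 : ℝ) 1 := by
    intro n
    filter_upwards [hder n] with y hy
    rw [hy]
    exact hP.lifted_mem ⟨(hδ0 _).le, hδ1 _⟩ _
  have hvt : ∀ᵐ y ∂volume.restrict (Ioo 0 lam),
      Tendsto (fun n => (h n).weakDeriv y) atTop (𝓝 (x.weakDeriv y)) := by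
    have haeD : ∀ᵐ y ∂volume.restrict (Ioo 0 lam), y ∉ D :=
      ae_restrict_of_ae (D.countable_toSet.ae_notMem volume)
    filter_upwards [ae_all_iff.2 hder, haeD, hσ.ae_eq, ae_restrict_mem measurableSet_Ioo]
      with y h1 h2 h3 hm
    simp only [h1]
    have hεinv : Tendsto (fun n => (ε n)⁻¹) atTop atTop :=
      tendsto_inv_nhdsGT_zero.comp
        (tendsto_nhdsWithin_iff.2 ⟨hε0, Eventually.of_forall hε⟩)
    have hlim : Tendsto (fun n => recoveryDeriv P σ (c n) (ε n) (δ n) y) atTop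
        (𝓝 (x.weakDeriv y)) := by
      rcases lt_or_gt_of_ne (hσ.ne_zero_of_notMem hm h2) with hneg | hpos'
      · rw [h3, if_neg (not_lt.2 hneg.le)]
        have h4 : Tendsto (fun n => c n + σ y / ε n) atTop atBot := by
          simp only [div_eq_mul_inv]
          exact hct.add_atBot (hεinv.const_mul_atTop_of_neg hneg)
        refine hδt.congr' ?_
        filter_upwards [h4.eventually (eventually_le_atBot 0)] with n hn
        rw [recoveryDeriv, hP.eq_zero _ hn]; ring
      · rw [h3, if_pos hpos']
        have h4 : Tendsto (fun n => c n + σ y / ε n) atTop atTop := by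
          simp only [div_eq_mul_inv]
          exact hct.add_atTop (hεinv.const_mul_atTop hpos')
        refine tendsto_const_nhds.congr' ?_
        filter_upwards [h4.eventually (eventually_ge_atTop T)] with n hn
        rw [recoveryDeriv, hP.eq_one _ hn]; ring
    exact hlim.comp hshift
  have hprim := fun n => ((boundaryConditions_iff hl0 (h n)).1 (hbc n)).1
  have hprimx := ((boundaryConditions_iff hl0 x).1 hx.2.2).1
  have hconv : Tendsto h atTop (𝓝 x) := by
    refine tendsto_of_bounded_ae hl0 (R := 1) hprim hprimx (fun n => ?_) hvt
    filter_upwards [hmem n] with y hy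
    rw [abs_of_nonneg hy.1]; exact hy.2
  have hut : ∀ᵐ y ∂volume.restrict (Ioo 0 lam),
      Tendsto (fun n => (h n).toFun y) atTop (𝓝 (x.toFun y)) := by
    filter_upwards [ae_all_iff.2 hprim, hprimx, ae_restrict_mem measurableSet_Ioo] with y h1 h2 hm
    simp only [h1, h2]
    exact tendsto_primitive hconv (Ioo_subset_Icc_self hm)
  have hfound := tendsto_lintegral_foundationDensity hl0 hμ hbc hmem hut hvt
  set Q := ∫⁻ y in Ioo 0 lam, ENNReal.ofReal (x.foundationDensity μ y) with hQ
  have hsharp := hx.ofReal_add_lintegral_eq hW hl0 hμ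
  have hQt : Q ≠ ⊤ := by
    intro htop
    rw [← hQ, htop, add_top, sharpEnergy, if_pos hx] at hsharp
    exact ENNReal.ofReal_ne_top hsharp.symm
  have hbound : Tendsto (fun n => N * ((r / ε n - c n) * evenEnergy W (δ n) +
      (surfaceConstant W + θ + T * (θ / T))) + lam / ε n * evenEnergy W (δ n)) atTop
      (𝓝 (N * (surfaceConstant W + 2 * θ))) := by
    have h1 := hW.tendsto_evenEnergy_recoveryLevel_div hl1 hN0 hε hε0
    have h2 : Tendsto (fun n => evenEnergy W (δ n)) atTop (𝓝 0) := by
      rw [← evenEnergy_zero W]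
      exact (hW.continuous_evenEnergy.tendsto 0).comp hδt
    have h3 := ((((h1.const_mul r).sub (hct.mul h2)).add_const
      (surfaceConstant W + θ + T * (θ / T))).const_mul N).add (h1.const_mul lam)
    have e : N * (r * 0 - (T - J) * 0 + (surfaceConstant W + θ + T * (θ / T))) + lam * 0 =
        N * (surfaceConstant W + 2 * θ) := by
      field_simp; ring
    rw [e] at h3
    refine h3.congr fun n => ?_
    simp only [hδ]
    ring
  have hlt : N * (surfaceConstant W + 2 * θ) < surfaceConstant W * N + η / 2 := by
    have : N * θ = η / 8 := by rw [hθ]; field_simp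
    nlinarith
  have ev4 := (hbound.comp hshift).eventually (gt_mem_nhds hlt)
  have ev5 := hfound.eventually (gt_mem_nhds (ENNReal.lt_add_right hQt
    (ENNReal.ofReal_pos.2 (half_pos hη)).ne'))
  have ev6 := hconv.eventually (Metric.ball_mem_nhds x hη)
  have hall : ∀ᶠ n in atTop, ∃ h : SobolevH1 lam, dist h x < η ∧
      rescaledEnergy W lam μ (ε (n + n₀)) h ≤ sharpEnergy W lam μ x + ENNReal.ofReal η := by
    filter_upwards [ev4, ev5, ev6] with n h4 h5 h6
    refine ⟨h n, h6, ?_⟩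
    rw [rescaledEnergy_eq hW hμ (hε _) (hH2 n) (hpos n) (hbc n), ← hsharp]
    have hC := hW.surfaceConstant_pos
    have hcard : ((discontSet lam x.weakDeriv).ncard : ℝ) = N := by
      rw [ncard_eq_toFinset_card _ hfin]
    have h7 := (hint n).trans (ENNReal.ofReal_le_ofReal (le_of_lt h4))
    rw [ENNReal.ofReal_add (by positivity) (by positivity)] at h7
    refine (add_le_add h7 h5.le).trans (le_of_eq ?_)
    rw [hcard, add_add_add_comm, ← ENNReal.ofReal_add (by positivity) (by positivity), add_halves]
  obtain ⟨n₁, hn₁⟩ := eventually_atTop.1 hall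
  refine eventually_atTop.2 ⟨n₁ + n₀, fun n hn => ?_⟩
  have := hn₁ (n - n₀) (by omega)
  rwa [Nat.sub_add_cancel (by omega)] at this

theorem eventually_exists_recovery {W : ℝ → ℝ} (hW : IsStoredEnergy W) {lam μ : ℝ}
    (hl : 1 ≤ lam) (hμ : 0 ≤ μ) {ε : ℕ → ℝ} (hε : ∀ n, 0 < ε n) (hε0 : Tendsto ε atTop (𝓝 0))
    (x : SobolevH1 lam) {η : ℝ} (hη : 0 < η) :
    ∀ᶠ n in atTop, ∃ h : SobolevH1 lam, dist h x < η ∧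
      rescaledEnergy W lam μ (ε n) h ≤ sharpEnergy W lam μ x + ENNReal.ofReal η := by
  by_cases hx : IsSharp x
  · rcases (discontSet lam x.weakDeriv).eq_empty_or_nonempty with hD | hD
    · refine Eventually.of_forall fun n => ⟨x, by rwa [dist_self], ?_⟩
      exact (rescaledEnergy_le_sharpEnergy hW (by linarith) hμ (hε n) hx hD).trans le_self_add
    · exact eventually_exists_recovery_of_nonempty hW hl hμ hε hε0 hx hD hη
  · refine Eventually.of_forall fun n => ⟨x, by rwa [dist_self], ?_⟩
    rw [sharpEnergy, if_neg hx, top_add]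
    exact le_top

/-- Diagonal selection: approximate objects for every accuracy give a sequence that is eventually
as accurate as required. -/
theorem exists_seq_of_eventually_exists {X : Type*} [Nonempty X] {p : ℕ → ℕ → X → Prop}
    (hanti : ∀ j k n x, j ≤ k → p k n x → p j n x) (h : ∀ k, ∀ᶠ n in atTop, ∃ x, p k n x) :
    ∃ u : ℕ → X, ∀ k, ∀ᶠ n in atTop, p k n (u n) := by
  classical
  have hx : ∀ n, ∃ x, ∀ k, k ≤ n → (∃ y, p k n y) → p k n x := by
    intro n
    set K := Nat.findGreatest (fun k => ∃ y, p k n y) n with hK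
    by_cases hex : ∃ k ≤ n, ∃ y, p k n y
    · obtain ⟨k, hk, hy⟩ := hex
      obtain ⟨x, hx⟩ : ∃ y, p K n y := Nat.findGreatest_spec (P := fun k => ∃ y, p k n y) hk hy
      exact ⟨x, fun j hj hjy => hanti j K n x (Nat.le_findGreatest hj hjy) hx⟩
    · push Not at hex
      exact ⟨Classical.arbitrary X, fun k hk ⟨y, hy⟩ => absurd hy (hex k hk y)⟩
  choose u hu using hx
  refine ⟨u, fun k => ?_⟩
  filter_upwards [h k, eventually_ge_atTop k] with n hn hkn
  exact hu n k hkn hn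

theorem exists_recovery_sequence {W : ℝ → ℝ} (hW : IsStoredEnergy W) {lam μ : ℝ}
    (hl : 1 ≤ lam) (hμ : 0 ≤ μ) {ε : ℕ → ℝ} (hε : ∀ n, 0 < ε n) (hε0 : Tendsto ε atTop (𝓝 0))
    (x : SobolevH1 lam) :
    ∃ u : ℕ → SobolevH1 lam, Tendsto u atTop (𝓝 x) ∧
      limsup (fun n => rescaledEnergy W lam μ (ε n) (u n)) atTop ≤ sharpEnergy W lam μ x := by
  have : Nonempty (SobolevH1 lam) := ⟨x⟩
  obtain ⟨u, hu⟩ := exists_seq_of_eventually_exists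
    (p := fun k n (h : SobolevH1 lam) => dist h x < 1 / ((k : ℝ) + 1) ∧
      rescaledEnergy W lam μ (ε n) h ≤ sharpEnergy W lam μ x + ENNReal.ofReal (1 / ((k : ℝ) + 1)))
    (fun j k n h hjk ⟨h1, h2⟩ => by
      have h3 : 1 / ((k : ℝ) + 1) ≤ 1 / ((j : ℝ) + 1) := Nat.one_div_le_one_div hjk
      exact ⟨h1.trans_le h3, h2.trans (by gcongr)⟩)
    (fun k => eventually_exists_recovery hW hl hμ hε hε0 x (by positivity))
  refine ⟨u, Metric.tendsto_atTop'.2 fun η hη => ?_, ?_⟩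
  · obtain ⟨k, hk⟩ := exists_nat_one_div_lt hη
    obtain ⟨n, hn⟩ := eventually_atTop.1 (hu k)
    exact ⟨n, fun m hm => (hn m hm.le).1.trans hk⟩
  · have hlim : Tendsto (fun k : ℕ => sharpEnergy W lam μ x + ENNReal.ofReal (1 / ((k : ℝ) + 1)))
        atTop (𝓝 (sharpEnergy W lam μ x + 0)) := by
      refine tendsto_const_nhds.add ?_
      have := ENNReal.tendsto_ofReal (tendsto_one_div_add_atTop_nhds_zero_nat (𝕜 := ℝ))
      rwa [ENNReal.ofReal_zero] at this
    rw [add_zero] at hlim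
    refine ge_of_tendsto hlim (Eventually.of_forall fun k => ?_)
    exact limsup_le_of_le (by isBoundedDefault) ((hu k).mono fun n hn => hn.2)

theorem proposition3 (W : ℝ → ℝ)
    (hW_cont : ContinuousOn W (Ioi 0))
    (hW_nonneg : ∀ F, 0 < F → 0 ≤ W F)
    (hW_zero : ∀ F, 0 < F → (W F = 0 ↔ F = 1))
    (hW_asymptote : ∃ w : ℝ, Tendsto W atTop (𝓝 w))
    (hW_growth : ∃ C M : ℝ, 0 < C ∧ 1 < M ∧ ∀ F, 0 < F → F ≤ 1 / M → C * (1 / F) ≤ W F)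
    (lam μ : ℝ) (hlam : 1 ≤ lam) (hμ : 0 < μ) :
    GammaConverges (fun ε => rescaledEnergy W lam μ ε) (sharpEnergy W lam μ) ∧
    ∀ (ε : ℕ → ℝ) (h : ℕ → SobolevH1 lam), (∀ n, 0 < ε n) → Tendsto ε atTop (𝓝 0) →
      (∃ B : ℝ, ∀ n, rescaledEnergy W lam μ (ε n) (h n) ≤ ENNReal.ofReal B) →
      (∃ φ : ℕ → ℕ, StrictMono φ ∧ ∃ hstar, Tendsto (h ∘ φ) atTop (𝓝 hstar)) ∧
      ∀ (φ : ℕ → ℕ) (hstar : SobolevH1 lam), StrictMono φ →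
        Tendsto (h ∘ φ) atTop (𝓝 hstar) →
          hstar.MemPC1 ∧
          (∀ᵐ y ∂volume.restrict (Ioo 0 lam),
            hstar.weakDeriv y = 0 ∨ hstar.weakDeriv y = 1) ∧
          hstar.BoundaryConditions := by
  have hW : IsStoredEnergy W := ⟨hW_cont, hW_nonneg, hW_zero, hW_asymptote, hW_growth⟩
  have hl : 0 < lam := by linarith
  refine ⟨fun ε hε hε0 x => ⟨fun u hu => sharpEnergy_le_liminf hW hl hμ.le hε hε0 hu,
    exists_recovery_sequence hW hlam hμ.le hε hε0 x⟩, ?_⟩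
  rintro ε h hε hε0 ⟨B, hB⟩
  refine ⟨exists_subseq_tendsto_of_energy_le hW hl hμ.le hε hB, fun φ x hφ hx => ?_⟩
  exact (isSharp_and_sharpEnergy_le hW hl hμ.le (fun n => hε (φ n))
    (hε0.comp hφ.tendsto_atTop) hx fun n => hB (φ n)).1
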